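/- \textbf{Setting.} Let $m\ge 1$, $t_0,\dots,t_m\in\mathbb C$, and let $1/N$ be a formal variable; write $\dot f=\frac1N\partial_t f$. The modified Gelfand--Dikii polynomials are the differential polynomials $\hat R_0=u$, $\check R_0=\frac{u^2}{2}$, $\hat R_{k+1}=u\check R_k-\frac14\ddot{\hat R}_k$, where $\check R_k$ is the differential polynomial without constant term such that $\dot{\check R}_k=u\,\dot{\hat R}_k$. Let $u(t)=u_0(t)+O(1/N)$ be a formal power series in $1/N$ with coefficients holomorphic on an open set $U\subset\mathbb C$, with $u_0\neq0$ on $U$, which solves the string equation $\sum_{k=0}^m t_k\hat R_k(u)=-t\,u$. Put $A_0=B_0=0$, $C_0=1$, $A_{k+1}=x^2A_k+\frac12\dot{\hat R}_k(u)$, $B_{k+1}=x^2B_k+\hat R_k(u)$, $C_{k+1}=x^2C_k+\check R_k(u)$, and $$\mathcal R=\begin{pmatrix}0&x+u\\-x+u&0\end{pmatrix},\quad \mathcal D_k=\begin{pmatrix}-A_k&xB_k+C_k\\xB_k-C_k&A_k\end{pmatrix},\quad \mathcal D=t\,\mathcal D_0+\sum_{k=0}^m t_k\mathcal D_k .$$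 Let $V\subset\mathbb C^2$ be a connected open set of points $(x,t)$ with $t\in U$ and $x^2\ne u_0(t)^2$, let $\rho$ be a holomorphic branch of $\left(\frac{u_0+x}{u_0-x}\right)^{1/4}$ on $V$, and set $$z=\rho^{-2}\ \Big(\text{so } z^2=\tfrac{u_0-x}{u_0+x}\Big),\quad \sqrt{u_0^2-x^2}:=(u_0+x)z,\quad y=\sqrt{u_0^2-x^2}\sum_{j=1}^m t_j\sum_{k=0}^{j-1}x^{2(j-k)-1}\tfrac{(2k)!}{2^{2k}(k!)^2}u_0^{2k}.$$ Let $$\Psi=\begin{pmatrix}\psi&\phi\\ \tilde\psi&\tilde\phi\end{pmatrix}=\frac1{\sqrt2}\begin{pmatrix} \rho\,e^{NS}(1+\sum_{k\ge1}\psi_kN^{-k})& -\rho\,e^{-NS}(1+\sum_{k\ge1}\phi_kN^{-k})\\ \rho^{-1}e^{NS}(1+\sum_{k\ge1}\tilde\psi_kN^{-k})& \rho^{-1}e^{-NS}(1+\sum_{k\ge1}\tilde\phi_kN^{-k})\end{pmatrix},$$ with $\partial_tS=\sqrt{u_0^2-x^2}$ and $\partial_xS=y$, and with coefficients $\psi_k,\phi_k,\tilde\psi_k,\tilde\phi_k$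 holomorphic on $V$, be a formal (WKB) solution of $\frac1N\partial_x\Psi=\mathcal D\Psi$, $\frac1N\partial_t\Psi=\mathcal R\Psi$, $\det\Psi=1$. Let $K(x_1,x_2)=\frac{\psi(x_1)\tilde\phi(x_2)-\tilde\psi(x_1)\phi(x_2)}{x_1-x_2}$, $W_1=\partial_x\psi\,\tilde\phi-\partial_x\tilde\psi\,\phi$ and, for $n\ge2$, $$W_n(x_1,\dots,x_n)=-\frac{\delta_{n,2}}{(x_1-x_2)^2}-(-1)^n\sum_{\sigma}\prod_{i=1}^nK(x_i,x_{\sigma(i)}),$$ the sum being over the cyclic permutations $\sigma$ of $\{1,\dots,n\}$ of length $n$ (all at the same $t$, with distinct $x_i$). Let $W_n^{(g)}$ be the coefficient of $N^{2-2g-n}$ in $W_n$. \textbf{Theorem (Pole Structure).} \begin{enumerate} \item For every $k$ the functions $\psi_k,\phi_k,\tilde\psi_k,\tilde\phi_k$ are, in the variable $z$, rational functions with poles only at $z\in\{\pm i,0,\infty\}$; the coefficients of these fractions are rational expressions in $u_0(t)$ and its derivatives, with denominators that do not vanish at the values of $t$ considered. \item In the variables $\zeta_i$ defined by $x_i=\frac{u_0}{2}\left(\zeta_i+\frac1{\zeta_i}\right)$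 and $\sqrt{\frac{u_0-x_i}{u_0+x_i}}=z(x_i,t)=i\,\frac{\zeta_i-1}{\zeta_i+1}$, for every $n\ge1$, $g\ge0$ with $(n,g)\ne(1,0),(2,0)$ and every $t$, the function $W_n^{(g)}$ is a symmetric rational function of $\zeta_1,\dots,\zeta_n$ with poles only at $\zeta_i=\pm1$ (in particular it has no pole at $\zeta_i=0,\infty$). \item In the two remaining cases, $W_1^{(0)}=y$ is a rational function of $\zeta_1$ with poles only at $0,\infty$, and $$W_2^{(0)}=\frac{4\zeta_1^2\zeta_2^2}{u_0^2(\zeta_1^2-1)(\zeta_2^2-1)(\zeta_1\zeta_2-1)^2}.$$ \end{enumerate} -/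

import Mathlib

noncomputable section

namespace MinimalModel

/-! ### The modified Gelfand–Dikii polynomials -/

/-- Differential polynomials in one unknown `u`; the variable `i` stands for the `i`-th
derivative of `u`. -/
abbrev DiffPoly : Type := MvPolynomial ℕ ℚ

/-- The derivation of differential polynomials sending the `i`-th derivative of `u` to the
`(i+1)`-st. -/
def dd : Derivation ℚ DiffPoly DiffPoly :=
  MvPolynomial.mkDerivation ℚ (fun i => (MvPolynomial.X (i + 1) : DiffPoly))

/-- The pair `(R̂_k, Ř_k)`.  The first component follows the recursion
`R̂_{k+1} = u Ř_k - R̂_k'' / 4`.  The second is the antiderivative of `u R̂_k'` without constant term,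
which is written here in closed form; `dd_gdCheck` and `constantCoeff_gdCheck` below show that it
is this antiderivative. -/
def gd : ℕ → DiffPoly × DiffPoly
  | 0 => (MvPolynomial.X 0, MvPolynomial.C (1 / 2) * MvPolynomial.X 0 ^ 2)
  | k + 1 =>
    let h : DiffPoly := MvPolynomial.X 0 * (gd k).2 - MvPolynomial.C (1 / 4) * dd (dd (gd k).1)
    (h, MvPolynomial.C (1 / 2) *
      (2 * MvPolynomial.X 0 * h
        + ∑ i : Fin k, (gd (i.1 + 1)).1 * (gd (k - i.1)).1
        + ∑ i : Fin (k + 1),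
            (MvPolynomial.C (1 / 4) * (dd (gd i.1).1 * dd (gd (k - i.1)).1)
              - (gd i.1).2 * (gd (k - i.1)).2)))
  termination_by k => k
  decreasing_by all_goals omega

/-- The modified Gelfand–Dikii polynomial `R̂_k`. -/
def gdHat (k : ℕ) : DiffPoly := (gd k).1

/-- The modified Gelfand–Dikii polynomial `Ř_k`. -/
def gdCheck (k : ℕ) : DiffPoly := (gd k).2

theorem gdHat_zero : gdHat 0 = MvPolynomial.X 0 := by
  simp [gdHat, gd]

theorem gdCheck_zero : gdCheck 0 = MvPolynomial.C (1 / 2) * MvPolynomial.X 0 ^ 2 := by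
  simp [gdCheck, gd]

theorem gdHat_succ (k : ℕ) :
    gdHat (k + 1)
      = MvPolynomial.X 0 * gdCheck k - MvPolynomial.C (1 / 4) * dd (dd (gdHat k)) := by
  simp only [gdHat, gdCheck]
  rw [gd]

theorem gdCheck_quadratic (k : ℕ) :
    2 * gdCheck (k + 1) =
      ∑ p ∈ Finset.HasAntidiagonal.antidiagonal (k + 1), gdHat p.1 * gdHat p.2
      + ∑ p ∈ Finset.HasAntidiagonal.antidiagonal k,
          (MvPolynomial.C (1 / 4) * (dd (gdHat p.1) * dd (gdHat p.2))
            - gdCheck p.1 * gdCheck p.2) := by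
  have h2 : (2 : DiffPoly) * MvPolynomial.C (1 / 2) = 1 := by
    rw [← map_ofNat MvPolynomial.C 2, ← map_mul]; norm_num
  have e : gdCheck (k + 1) = MvPolynomial.C (1 / 2) *
      (2 * MvPolynomial.X 0 * gdHat (k + 1)
        + ∑ i ∈ Finset.range k, gdHat (i + 1) * gdHat (k - i)
        + ∑ i ∈ Finset.range (k + 1),
            (MvPolynomial.C (1 / 4) * (dd (gdHat i) * dd (gdHat (k - i)))
              - gdCheck i * gdCheck (k - i))) := by
    rw [Finset.sum_range, Finset.sum_range]
    simp only [gdHat, gdCheck]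
    rw [gd]
  have e' : ∑ p ∈ Finset.HasAntidiagonal.antidiagonal (k + 1), gdHat p.1 * gdHat p.2
      = 2 * MvPolynomial.X 0 * gdHat (k + 1)
        + ∑ i ∈ Finset.range k, gdHat (i + 1) * gdHat (k - i) := by
    rw [Finset.Nat.sum_antidiagonal_eq_sum_range_succ (fun i j => gdHat i * gdHat j) (k + 1),
      Finset.sum_range_succ, Finset.sum_range_succ']
    simp only [Nat.sub_zero, Nat.sub_self, gdHat_zero, Nat.add_sub_add_right]
    ring
  rw [e, e', ← mul_assoc, h2, one_mul, Finset.Nat.sum_antidiagonal_eq_sum_range_succ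
    (fun i j => MvPolynomial.C (1 / 4) * (dd (gdHat i) * dd (gdHat j)) - gdCheck i * gdCheck j) k]

/-- `Ř_k' = u R̂_k'`. -/
theorem dd_gdCheck (k : ℕ) : dd (gdCheck k) = MvPolynomial.X 0 * dd (gdHat k) := by
  have h2 : (2 : DiffPoly) * MvPolynomial.C (1 / 2) = 1 := by
    rw [← map_ofNat MvPolynomial.C 2, ← map_mul]; norm_num
  have h4 : (2 : DiffPoly) * MvPolynomial.C (1 / 4) = MvPolynomial.C (1 / 2) := by
    rw [← map_ofNat MvPolynomial.C 2, ← map_mul]; norm_num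
  have hC : ∀ (q : ℚ) (p : DiffPoly), dd (MvPolynomial.C q * p) = MvPolynomial.C q * dd p := by
    intro q p
    rw [MvPolynomial.C_mul', MvPolynomial.C_mul', Derivation.map_smul]
  induction k using Nat.strong_induction_on with
  | _ k ih =>
    cases k with
    | zero =>
      rw [gdCheck_zero, gdHat_zero, hC, pow_two, Derivation.leibniz]
      simp only [smul_eq_mul]
      linear_combination (MvPolynomial.X 0 * dd (MvPolynomial.X 0)) * h2
    | succ k =>
      have key : 2 * dd (gdCheck (k + 1)) = 2 * (MvPolynomial.X 0 * dd (gdHat (k + 1))) := by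
        have hd : 2 * dd (gdCheck (k + 1)) = dd (2 * gdCheck (k + 1)) := by
          rw [two_mul, two_mul, map_add]
        have s1 : dd (∑ p ∈ Finset.HasAntidiagonal.antidiagonal (k + 1), gdHat p.1 * gdHat p.2)
            = 2 * ∑ p ∈ Finset.HasAntidiagonal.antidiagonal (k + 1),
                dd (gdHat p.1) * gdHat p.2 := by
          rw [map_sum, two_mul]
          nth_rewrite 2 [← Finset.Nat.sum_antidiagonal_swap]
          rw [← Finset.sum_add_distrib]
          refine Finset.sum_congr rfl fun p _ => ?_
          simp only [Derivation.leibniz, smul_eq_mul, Prod.fst_swap, Prod.snd_swap]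
          ring
        have s2 : dd (∑ p ∈ Finset.HasAntidiagonal.antidiagonal k,
            (MvPolynomial.C (1 / 4) * (dd (gdHat p.1) * dd (gdHat p.2))
              - gdCheck p.1 * gdCheck p.2))
            = 2 * ∑ p ∈ Finset.HasAntidiagonal.antidiagonal k,
                (MvPolynomial.C (1 / 4) * (dd (gdHat p.1) * dd (dd (gdHat p.2)))
                  - dd (gdCheck p.1) * gdCheck p.2) := by
          rw [map_sum, two_mul]
          nth_rewrite 2 [← Finset.Nat.sum_antidiagonal_swap]
          rw [← Finset.sum_add_distrib]
          refine Finset.sum_congr rfl fun p _ => ?_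
          simp only [map_sub, hC, Derivation.leibniz, smul_eq_mul, Prod.fst_swap, Prod.snd_swap]
          ring
        have s3 : ∑ p ∈ Finset.HasAntidiagonal.antidiagonal k,
                (MvPolynomial.C (1 / 4) * (dd (gdHat p.1) * dd (dd (gdHat p.2)))
                  - dd (gdCheck p.1) * gdCheck p.2)
            = - ∑ p ∈ Finset.HasAntidiagonal.antidiagonal k,
                dd (gdHat p.1) * gdHat (p.2 + 1) := by
          rw [← Finset.sum_neg_distrib]
          refine Finset.sum_congr rfl fun p hp => ?_
          have hle : p.1 < k + 1 := by
            have := Finset.HasAntidiagonal.mem_antidiagonal.1 hp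
            omega
          rw [ih p.1 hle, gdHat_succ]
          ring
        rw [hd, gdCheck_quadratic, map_add, s1, s2, s3,
          Finset.Nat.sum_antidiagonal_succ']
        simp only [gdHat_zero]
        ring
      exact mul_left_cancel₀ (by norm_num) key

theorem constantCoeff_dd (p : DiffPoly) : MvPolynomial.constantCoeff (dd p) = 0 := by
  induction p using MvPolynomial.induction_on with
  | C a => simp [dd]
  | add p q hp hq => rw [map_add, map_add, hp, hq, add_zero]
  | mul_X p i hp =>
    have hX : dd (MvPolynomial.X i) = MvPolynomial.X (i + 1) := MvPolynomial.mkDerivation_X _ _ _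
    rw [Derivation.leibniz, hX]
    simp [hp]

theorem constantCoeff_gdCheck (k : ℕ) : MvPolynomial.constantCoeff (gdCheck k) = 0 := by
  have hh : ∀ j, MvPolynomial.constantCoeff (gdHat j) = 0 := by
    intro j
    cases j with
    | zero => simp [gdHat_zero]
    | succ j => simp [gdHat_succ, constantCoeff_dd]
  induction k using Nat.strong_induction_on with
  | _ k ih =>
    cases k with
    | zero => simp [gdCheck_zero]
    | succ k =>
      have h := congrArg MvPolynomial.constantCoeff (gdCheck_quadratic k)
      rw [map_mul, map_add, map_sum, map_sum, Finset.sum_eq_zero, Finset.sum_eq_zero] at h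
      · have h2 : MvPolynomial.constantCoeff (2 : DiffPoly) = 2 := map_ofNat _ 2
        rw [h2] at h
        simpa using h
      · intro p hp
        have hle : p.1 < k + 1 := by
          have := Finset.HasAntidiagonal.mem_antidiagonal.1 hp
          omega
        simp [constantCoeff_dd, ih p.1 hle]
      · intro p _
        simp [hh]

/-! ### Formal series in `1/N`

The symbol `1/N` is the formal variable of `PowerSeries ℂ`.  A formal series whose coefficients are
functions of `t` (of `(x, t)`) is a function of `t` (of `x` and `t`) with values in
`PowerSeries ℂ`; derivatives are taken coefficient by coefficient. -/

/-- `N⁻¹ ∂F/∂t` for a formal series `F` depending on `t`. -/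
def dot (F : ℂ → PowerSeries ℂ) (t : ℂ) : PowerSeries ℂ :=
  PowerSeries.X * PowerSeries.mk fun k => deriv (fun s => PowerSeries.coeff k (F s)) t

/-- The value at `t` of the differential polynomial `p` in `u`, its derivatives being
`N⁻¹ d/dt`-derivatives. -/
def evalDiff (u : ℂ → PowerSeries ℂ) (p : DiffPoly) (t : ℂ) : PowerSeries ℂ :=
  MvPolynomial.aeval (fun i => (dot^[i] u) t) p

/-- The leading coefficient `u_0(t)` of `u(t)`. -/
def u0 (u : ℂ → PowerSeries ℂ) (t : ℂ) : ℂ := PowerSeries.constantCoeff (u t)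

/-- `u` is a large `N` solution of the string equation `∑_{k=0}^m t_k R̂_k(u) = - t u` on `U`, with
analytic coefficients and with a leading coefficient `u_0` that does not vanish. -/
structure IsStringSolution (m : ℕ) (τ : ℕ → ℂ) (U : Set ℂ) (u : ℂ → PowerSeries ℂ) : Prop where
  differentiableOn : ∀ k, DifferentiableOn ℂ (fun t => PowerSeries.coeff k (u t)) U
  u0_ne_zero : ∀ t ∈ U, u0 u t ≠ 0
  string_eq : ∀ t ∈ U,
    ∑ k ∈ Finset.range (m + 1), PowerSeries.C (τ k) * evalDiff u (gdHat k) t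
      = -(PowerSeries.C t * u t)

/-! ### The Lax pair -/

/-- `A_k(x,t)`. -/
def laxA (u : ℂ → PowerSeries ℂ) (x t : ℂ) : ℕ → PowerSeries ℂ
  | 0 => 0
  | k + 1 => PowerSeries.C (x ^ 2) * laxA u x t k
      + PowerSeries.C (1 / 2) * dot (evalDiff u (gdHat k)) t

/-- `B_k(x,t)`. -/
def laxB (u : ℂ → PowerSeries ℂ) (x t : ℂ) : ℕ → PowerSeries ℂ
  | 0 => 0
  | k + 1 => PowerSeries.C (x ^ 2) * laxB u x t k + evalDiff u (gdHat k) t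

/-- `C_k(x,t)`. -/
def laxC (u : ℂ → PowerSeries ℂ) (x t : ℂ) : ℕ → PowerSeries ℂ
  | 0 => 1
  | k + 1 => PowerSeries.C (x ^ 2) * laxC u x t k + evalDiff u (gdCheck k) t

/-- `𝒟_k(x,t)`. -/
def laxDk (u : ℂ → PowerSeries ℂ) (k : ℕ) (x t : ℂ) : Matrix (Fin 2) (Fin 2) (PowerSeries ℂ) :=
  !![-laxA u x t k, PowerSeries.C x * laxB u x t k + laxC u x t k;
     PowerSeries.C x * laxB u x t k - laxC u x t k, laxA u x t k]

/-- `𝒟(x,t) = t 𝒟_0(x,t) + ∑_{k=0}^m t_k 𝒟_k(x,t)`. -/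
def laxD (m : ℕ) (τ : ℕ → ℂ) (u : ℂ → PowerSeries ℂ) (x t : ℂ) :
    Matrix (Fin 2) (Fin 2) (PowerSeries ℂ) :=
  (PowerSeries.C t : PowerSeries ℂ) • laxDk u 0 x t
    + ∑ k ∈ Finset.range (m + 1), (PowerSeries.C (τ k) : PowerSeries ℂ) • laxDk u k x t

/-- `ℛ(x,t)`. -/
def laxR (u : ℂ → PowerSeries ℂ) (x t : ℂ) : Matrix (Fin 2) (Fin 2) (PowerSeries ℂ) :=
  !![0, PowerSeries.C x + u t; -PowerSeries.C x + u t, 0]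

/-! ### The Baker–Akhiezer function

Throughout, `g(x,t)` is a branch of `((u_0 + x) / (u_0 - x))^{1/4}`. -/

/-- The uniformizing variable `z` with `z² = (u_0 - x) / (u_0 + x)`. -/
def zVar (g : ℂ → ℂ → ℂ) (x t : ℂ) : ℂ := 1 / g x t ^ 2

/-- The branch `(u_0 + x) z` of `√(u_0² - x²)`. -/
def rootH (u : ℂ → PowerSeries ℂ) (g : ℂ → ℂ → ℂ) (x t : ℂ) : ℂ := (u0 u t + x) * zVar g x t

/-- The spectral curve
`y(x,t) = √(u_0² - x²) ∑_{j=1}^m t_j ∑_{k=0}^{j-1} x^{2(j-k)-1} (2k)! / (2^{2k} (k!)²) u_0^{2k}`. -/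
def yLax (m : ℕ) (τ : ℕ → ℂ) (u : ℂ → PowerSeries ℂ) (g : ℂ → ℂ → ℂ) (x t : ℂ) : ℂ :=
  rootH u g x t * ∑ j ∈ Finset.Icc 1 m, τ j * ∑ k ∈ Finset.range j,
    x ^ (2 * (j - k) - 1) * ((2 * k).factorial / (2 ^ (2 * k) * (k.factorial : ℂ) ^ 2))
      * u0 u t ^ (2 * k)

/-- A two by two matrix of formal series in `1/N` with coefficients depending on `(x,t)`. -/
abbrev FormalMatrix : Type := ℂ → ℂ → Matrix (Fin 2) (Fin 2) (PowerSeries ℂ)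

/-- `∂F/∂x`. -/
def partialX (F : FormalMatrix) : FormalMatrix := fun x t =>
  Matrix.of fun i j => PowerSeries.mk fun k => deriv (fun s => PowerSeries.coeff k (F s t i j)) x

/-- `∂F/∂t`. -/
def partialT (F : FormalMatrix) : FormalMatrix := fun x t =>
  Matrix.of fun i j => PowerSeries.mk fun k => deriv (fun s => PowerSeries.coeff k (F x s i j)) t

/-- The amplitude `Ψ̂` of the wave matrix `Ψ = Ψ̂ diag(e^{NS}, e^{-NS})`, where
`S = ∫^t √(u_0² - x²) dt = ∫^x y dx`.  The entries of `a` are the series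
`1 + ψ_1/N + ⋯`, `1 + φ_1/N + ⋯` (first row), `1 + ψ̃_1/N + ⋯`, `1 + φ̃_1/N + ⋯` (second row). -/
def amplitude (g : ℂ → ℂ → ℂ) (a : FormalMatrix) : FormalMatrix := fun x t =>
  !![PowerSeries.C (g x t / (√2 : ℝ)) * a x t 0 0, PowerSeries.C (-(g x t / (√2 : ℝ))) * a x t 0 1;
     PowerSeries.C ((g x t)⁻¹ / (√2 : ℝ)) * a x t 1 0, PowerSeries.C ((g x t)⁻¹ / (√2 : ℝ)) * a x t 1 1]

/-- `diag(c, -c)`. -/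
def diagPM (c : ℂ) : Matrix (Fin 2) (Fin 2) (PowerSeries ℂ) :=
  !![PowerSeries.C c, 0; 0, -PowerSeries.C c]

/-- `N⁻¹ ∂Ψ/∂x · diag(e^{NS}, e^{-NS})⁻¹`, using `∂S/∂x = y`. -/
def waveX (m : ℕ) (τ : ℕ → ℂ) (u : ℂ → PowerSeries ℂ) (g : ℂ → ℂ → ℂ) (a : FormalMatrix) :
    FormalMatrix := fun x t =>
  (PowerSeries.X : PowerSeries ℂ) • partialX (amplitude g a) x t
    + amplitude g a x t * diagPM (yLax m τ u g x t)

/-- `N⁻¹ ∂Ψ/∂t · diag(e^{NS}, e^{-NS})⁻¹`, using `∂S/∂t = √(u_0² - x²)`. -/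
def waveT (u : ℂ → PowerSeries ℂ) (g : ℂ → ℂ → ℂ) (a : FormalMatrix) : FormalMatrix := fun x t =>
  (PowerSeries.X : PowerSeries ℂ) • partialT (amplitude g a) x t
    + amplitude g a x t * diagPM (rootH u g x t)

/-- On the domain `V` of points `(x,t)`, `g` is an analytic branch of
`((u_0 + x) / (u_0 - x))^{1/4}`, and the matrix `Ψ = Ψ̂ diag(e^{NS}, e^{-NS})` with WKB coefficients
`a` is a formal large `N` solution of
`N⁻¹ ∂Ψ/∂x = 𝒟 Ψ`, `N⁻¹ ∂Ψ/∂t = ℛ Ψ`, `det Ψ = 1`, with analytic coefficients. -/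
structure IsBakerAkhiezer (m : ℕ) (τ : ℕ → ℂ) (u : ℂ → PowerSeries ℂ) (V : Set (ℂ × ℂ))
    (g : ℂ → ℂ → ℂ) (a : FormalMatrix) : Prop where
  g_differentiableOn : DifferentiableOn ℂ (fun p : ℂ × ℂ => g p.1 p.2) V
  g_pow : ∀ x t, (x, t) ∈ V → g x t ^ 4 = (u0 u t + x) / (u0 u t - x)
  differentiableOn : ∀ i j k,
    DifferentiableOn ℂ (fun p : ℂ × ℂ => PowerSeries.coeff k (a p.1 p.2 i j)) V
  leading : ∀ i j x t, (x, t) ∈ V → PowerSeries.constantCoeff (a x t i j) = 1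
  det_eq_one : ∀ x t, (x, t) ∈ V → (amplitude g a x t).det = 1
  eq_x : ∀ x t, (x, t) ∈ V → waveX m τ u g a x t = laxD m τ u x t * amplitude g a x t
  eq_t : ∀ x t, (x, t) ∈ V → waveT u g a x t = laxR u x t * amplitude g a x t

/-! ### Determinantal correlation functions -/

/-- The kernel `K(x₁,x₂) = (ψ(x₁) φ̃(x₂) - ψ̃(x₁) φ(x₂)) / (x₁ - x₂)`, without its factor
`e^{N (S(x₁) - S(x₂))}`. -/
def kernelK (g : ℂ → ℂ → ℂ) (a : FormalMatrix) (t x₁ x₂ : ℂ) : PowerSeries ℂ :=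
  PowerSeries.C (1 / (x₁ - x₂)) *
    (amplitude g a x₁ t 0 0 * amplitude g a x₂ t 1 1
      - amplitude g a x₁ t 1 0 * amplitude g a x₂ t 0 1)

open Classical in
/-- The series `N⁻¹ W_n(x_1,…,x_n)`, where `W_1 = (∂ψ/∂x) φ̃ - (∂ψ̃/∂x) φ` and, for `n ≥ 2`,
`W_n = -δ_{n,2} / (x_1 - x_2)² - (-1)^n ∑_σ ∏_i K(x_i, x_{σ(i)})`, the sum being over the
permutations `σ` with a single cycle, of length `n`.  The exponential factors cancel in `W_1` and
along every cycle. -/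
def corrN (m : ℕ) (τ : ℕ → ℂ) (u : ℂ → PowerSeries ℂ) (g : ℂ → ℂ → ℂ) (a : FormalMatrix) (t : ℂ) :
    (n : ℕ) → (Fin n → ℂ) → PowerSeries ℂ
  | 0, _ => 0
  | 1, x =>
      waveX m τ u g a (x 0) t 0 0 * amplitude g a (x 0) t 1 1
        - waveX m τ u g a (x 0) t 1 0 * amplitude g a (x 0) t 0 1
  | n + 2, x => PowerSeries.X *
      (-(if n = 0 then PowerSeries.C (1 / (x 0 - x 1) ^ 2) else 0)
        - (-1) ^ (n + 2) *
          ∑ σ : Equiv.Perm (Fin (n + 2)) with σ.IsCycleOn Set.univ,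
            ∏ i, kernelK g a t (x i) (x (σ i)))

/-- `W_n^{(g)}(x_1,…,x_n)` for `n ≥ 1`: the coefficient of `N^{2-2g-n}` in `W_n` (the genus is called
`γ` here), that is the coefficient of `N^{-(2γ+n-1)}` in `N⁻¹ W_n`. -/
def corrW (m : ℕ) (τ : ℕ → ℂ) (u : ℂ → PowerSeries ℂ) (g : ℂ → ℂ → ℂ) (a : FormalMatrix) (t : ℂ)
    (n γ : ℕ) (x : Fin n → ℂ) : ℂ :=
  PowerSeries.coeff (2 * γ + n - 1) (corrN m τ u g a t n x)

/-- The second uniformizing variable `ζ`, with `x = u_0 (ζ + ζ⁻¹) / 2` and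
`√((u_0 - x) / (u_0 + x)) = i (ζ - 1) / (ζ + 1)`. -/
def zetaVar (g : ℂ → ℂ → ℂ) (x t : ℂ) : ℂ :=
  (Complex.I + zVar g x t) / (Complex.I - zVar g x t)

/-- The values at `t` of `u_0` and all its derivatives. -/
def jet (u : ℂ → PowerSeries ℂ) (t : ℂ) : ℕ → ℂ := fun i => iteratedDeriv i (u0 u) t

end MinimalModel

end

/-! Write h for the root √(u_0² - x²) (`rootH`) and X for 1/N. Everything is governed by the
traceless matrix S = Ψ diag(1,-1) Ψ⁻¹ = !![A, B + C; B - C, -A]. The exponentials cancel in it, it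
solves N⁻¹∂_t S = [ℛ, S] and N⁻¹∂_x S = [𝒟, S], and S² = 1. Functions are measured by `Good`: parity
under h ↦ -h, and order of growth at x = ∞, the coefficients being rational in the jet of u_0 with
powers of u_0 as denominators. The coefficients of u belong to this class, because the linearized
string equation can be solved with the help of its own t-derivative at leading order
(`IsStringSolution.good_u`).

Order by order in X, two of the t-equations and S² = 1 form a linear algebraic system for the
coefficients of A, B, C, with determinant h². So no integration is needed, and these coefficients
are odd in h and bounded at infinity (`IsWave.good_S`).

The one-point function is N⁻¹W_1 = Tr(𝒟S)/2 =: T_S. A Lagrange identity for traceless matrices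
expresses T_S² by -det 𝒟 and the squares of the entries of N⁻¹∂_x S. The quadratic relation between
the Gelfand–Dikii polynomials makes all high powers of x in -det 𝒟 independent of N, so the
coefficients of T_S² of positive order in X are much smaller at infinity than y². Dividing by y
gives O(x⁻²) for the positive-order coefficients of T_S (`IsStringSolution.good_waveTau`). An odd
function of order x⁻² has no residue at infinity and has an odd primitive (`Good.hasOddPrimitive`).

For the WKB coefficients, S determines the products of the two entries of each row of Ψ and the two
diagonal products. What is missing is the ratio E of the products of the entries of the two columns.
Its logarithmic x-derivative is odd of order x⁻², up to T_S - y and entries of S; hence the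
logarithm of E is an odd function plus a constant of integration. This constant does not depend on t
either: its t-derivative would be an odd function independent of x, which is zero
(`ratZ_of_logDeriv`). All four entries then follow by extracting a fourth root
(`ratZ_coefficients`). Odd functions are rational in z, since x and h are.

For n ≥ 3, products of kernels along a cycle are cyclic traces of the projectors (1 + S)/2 divided
by differences x_i - x_{σ(i)}. The poles at x_p = x_q cancel in the sum over cycles: on that
diagonal the matrices commute, and exchanging p and q reverses the sign of the denominator
(`exists_cycleNumer_eq`). Dividing by the differences does not raise the degrees, so one is left
with sums of products of x_i^k h_i^{-L}, k ≤ L, which have poles only at ζ_i = ±1. For n = 2 the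
same cancellation comes from S(x)² = 1 and symmetry (`zetaRat_two_point`), and at leading order an
explicit computation gives W_2^{(0)} (`two_point_zeta`). -/

noncomputable section

namespace MinimalModel

/-! ### Functions P(x) / (u_0^r h^{2b+e}) graded by parity and degree at infinity -/

open Polynomial

/-- The jet derivation on polynomials in the jets. -/
def jetD : Derivation ℂ (MvPolynomial ℕ ℂ) (MvPolynomial ℕ ℂ) :=
  MvPolynomial.mkDerivation ℂ (fun i => (MvPolynomial.X (i + 1) : MvPolynomial ℕ ℂ))

/-- The jet derivation applied to all coefficients of a polynomial in `x`. -/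
def coeffD (P : (MvPolynomial ℕ ℂ)[X]) : (MvPolynomial ℕ ℂ)[X] :=
  ∑ i ∈ Finset.range (P.natDegree + 1), Polynomial.monomial i (jetD (P.coeff i))

/-- The polynomial `P` in `x`, with coefficients evaluated at the jet `j t`. -/
def polyAt (j : ℂ → ℕ → ℂ) (P : (MvPolynomial ℕ ℂ)[X]) (x t : ℂ) : ℂ :=
  (P.map (MvPolynomial.eval (j t))).eval x

/-- `V` is an open set of points `(x,t)` on which `h` is an analytic square root of `j_0² - x²`,
without zeros, and where `j t` is the jet of a function without zeros. -/
structure CurveDomain (V : Set (ℂ × ℂ)) (j : ℂ → ℕ → ℂ) (h : ℂ → ℂ → ℂ) : Prop where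
  isOpen : IsOpen V
  jet_ne : ∀ {x t}, (x, t) ∈ V → j t 0 ≠ 0
  h_ne : ∀ {x t}, (x, t) ∈ V → h x t ≠ 0
  h_sq : ∀ {x t}, (x, t) ∈ V → h x t ^ 2 = j t 0 ^ 2 - x ^ 2
  jet_deriv : ∀ {x t}, (x, t) ∈ V → ∀ i, HasDerivAt (fun s => j s i) (j t (i + 1)) t
  h_diff : DifferentiableOn ℂ (fun p : ℂ × ℂ => h p.1 p.2) V

/-- `F` is, on `V`, of the form `P(x) / (j_0^r h^{2b+e})`, with a polynomial `P` in `x` of degree at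
most `2b+e+d` whose coefficients are polynomials in the jet. -/
def Good (V : Set (ℂ × ℂ)) (j : ℂ → ℕ → ℂ) (h : ℂ → ℂ → ℂ) (e : ℕ) (d : ℤ) (F : ℂ → ℂ → ℂ) :
    Prop :=
  ∃ (b r : ℕ) (P : (MvPolynomial ℕ ℂ)[X]), (P.natDegree : ℤ) ≤ 2 * b + e + d ∧
    ∀ x t, (x, t) ∈ V → F x t * (j t 0 ^ r * h x t ^ (2 * b + e)) = polyAt j P x t

section polyAt

variable (j : ℂ → ℕ → ℂ) (x t : ℂ) (P Q : (MvPolynomial ℕ ℂ)[X])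

@[simp] theorem polyAt_add : polyAt j (P + Q) x t = polyAt j P x t + polyAt j Q x t := by
  simp [polyAt]

@[simp] theorem polyAt_sub : polyAt j (P - Q) x t = polyAt j P x t - polyAt j Q x t := by
  simp [polyAt]

@[simp] theorem polyAt_mul : polyAt j (P * Q) x t = polyAt j P x t * polyAt j Q x t := by
  simp [polyAt]

@[simp] theorem polyAt_pow (n : ℕ) : polyAt j (P ^ n) x t = polyAt j P x t ^ n := by
  simp [polyAt]

@[simp] theorem polyAt_C (p : MvPolynomial ℕ ℂ) :
    polyAt j (Polynomial.C p) x t = MvPolynomial.eval (j t) p := by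
  simp [polyAt]

@[simp] theorem polyAt_X : polyAt j Polynomial.X x t = x := by
  simp [polyAt]

theorem polyAt_eq_sum {n : ℕ} (hn : P.natDegree < n) :
    polyAt j P x t = ∑ i ∈ Finset.range n, MvPolynomial.eval (j t) (P.coeff i) * x ^ i := by
  rw [polyAt, Polynomial.eval_map, Polynomial.eval₂_eq_sum_range' _ hn]

theorem hasDerivAt_polyAt_x :
    HasDerivAt (fun s => polyAt j P s t) (polyAt j (Polynomial.derivative P) x t) x := by
  have := (P.map (MvPolynomial.eval (j t))).hasDerivAt x
  rwa [Polynomial.derivative_map] at this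

variable {j t}

theorem hasDerivAt_eval_jet (hj : ∀ i, HasDerivAt (fun s => j s i) (j t (i + 1)) t)
    (p : MvPolynomial ℕ ℂ) :
    HasDerivAt (fun s => MvPolynomial.eval (j s) p) (MvPolynomial.eval (j t) (jetD p)) t := by
  induction p using MvPolynomial.induction_on with
  | C a => simpa [jetD] using hasDerivAt_const t a
  | add p q hp hq => simpa using hp.fun_add hq
  | mul_X p i hp =>
    have hX : jetD (MvPolynomial.X i) = MvPolynomial.X (i + 1) := MvPolynomial.mkDerivation_X _ _ _
    simp only [Derivation.leibniz, hX, smul_eq_mul, map_add, map_mul, MvPolynomial.eval_X]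
    exact (hp.fun_mul (hj i)).congr_deriv (by ring)

theorem hasDerivAt_polyAt_t (hj : ∀ i, HasDerivAt (fun s => j s i) (j t (i + 1)) t) :
    HasDerivAt (fun s => polyAt j P x s) (polyAt j (coeffD P) x t) t := by
  have e : (fun s => polyAt j P x s) = fun s => ∑ i ∈ Finset.range (P.natDegree + 1),
      MvPolynomial.eval (j s) (P.coeff i) * x ^ i :=
    funext fun s => polyAt_eq_sum j x s P (Nat.lt_succ_self _)
  rw [e]
  have e2 : polyAt j (coeffD P) x t = ∑ i ∈ Finset.range (P.natDegree + 1),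
      MvPolynomial.eval (j t) (jetD (P.coeff i)) * x ^ i := by
    simp [coeffD, polyAt, Polynomial.map_sum, Polynomial.eval_finsetSum]
  rw [e2]
  exact HasDerivAt.fun_sum fun i _ => (hasDerivAt_eval_jet hj _).mul_const _

theorem natDegree_coeffD_le : (coeffD P).natDegree ≤ P.natDegree := by
  refine Polynomial.natDegree_sum_le_of_forall_le _ _ fun i hi => ?_
  exact (Polynomial.natDegree_monomial_le _).trans (Nat.lt_succ_iff.1 (Finset.mem_range.1 hi))

end polyAt

namespace CurveDomain

variable {V : Set (ℂ × ℂ)} {j : ℂ → ℕ → ℂ} {h : ℂ → ℂ → ℂ} (hV : CurveDomain V j h)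
include hV

theorem eventually_x {x t : ℂ} (hp : (x, t) ∈ V) : ∀ᶠ s in nhds x, (s, t) ∈ V :=
  (Continuous.prodMk_left t).continuousAt.eventually (hV.isOpen.mem_nhds hp)

theorem eventually_t {x t : ℂ} (hp : (x, t) ∈ V) : ∀ᶠ s in nhds t, (x, s) ∈ V :=
  (Continuous.prodMk_right x).continuousAt.eventually (hV.isOpen.mem_nhds hp)

/-- Differentiate h² = j_0² - x² and divide by 2h; analyticity of h on V supplies the existence of
the derivative. -/
theorem hasDerivAt_h_x {x t : ℂ} (hp : (x, t) ∈ V) :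
    HasDerivAt (fun s => h s t) (-x / h x t) x := by
  have hd : DifferentiableAt ℂ (fun s => h s t) x :=
    DifferentiableAt.comp (f := fun s : ℂ => (s, t)) (g := fun p : ℂ × ℂ => h p.1 p.2) x
      (hV.h_diff.differentiableAt (hV.isOpen.mem_nhds hp)) (by fun_prop)
  have h1 := hd.hasDerivAt.pow 2
  have h2 : HasDerivAt (fun s => j t 0 ^ 2 - s ^ 2) (-(2 * x)) x := by
    simpa using ((hasDerivAt_id x).pow 2).const_sub (j t 0 ^ 2)
  have h3 := (h1.congr_of_eventuallyEq (f₁ := fun s => j t 0 ^ 2 - s ^ 2)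
    ((hV.eventually_x hp).mono fun s hs => (hV.h_sq hs).symm)).unique h2
  have : deriv (fun s => h s t) x = -x / h x t := by
    rw [eq_div_iff (hV.h_ne hp)]
    simp only [Nat.cast_ofNat, Nat.add_one_sub_one, pow_one] at h3
    linear_combination h3 / 2
  rw [← this]; exact hd.hasDerivAt

theorem hasDerivAt_h_t {x t : ℂ} (hp : (x, t) ∈ V) :
    HasDerivAt (fun s => h x s) (j t 0 * j t 1 / h x t) t := by
  have hd : DifferentiableAt ℂ (fun s => h x s) t :=
    DifferentiableAt.comp (f := fun s : ℂ => (x, s)) (g := fun p : ℂ × ℂ => h p.1 p.2) t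
      (hV.h_diff.differentiableAt (hV.isOpen.mem_nhds hp)) (by fun_prop)
  have h1 := hd.hasDerivAt.pow 2
  have h2 := ((hV.jet_deriv hp 0).pow 2).sub_const (x ^ 2)
  have h3 := (h1.congr_of_eventuallyEq (f₁ := fun s => j s 0 ^ 2 - x ^ 2)
    ((hV.eventually_t hp).mono fun s hs => (hV.h_sq hs).symm)).unique h2
  have : deriv (fun s => h x s) t = j t 0 * j t 1 / h x t := by
    rw [eq_div_iff (hV.h_ne hp)]
    simp only [Nat.cast_ofNat, Nat.add_one_sub_one, pow_one] at h3
    linear_combination h3 / 2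
  rw [← this]; exact hd.hasDerivAt

end CurveDomain

/-- The polynomial `j_0² - x²`. -/
def hSq : (MvPolynomial ℕ ℂ)[X] := Polynomial.C (MvPolynomial.X 0 ^ 2) - Polynomial.X ^ 2

theorem natDegree_hSq_pow (k : ℕ) : (hSq ^ k).natDegree ≤ 2 * k := by
  have : hSq.natDegree ≤ 2 := by unfold hSq; compute_degree
  exact (Polynomial.natDegree_pow_le_of_le k this).trans (by omega)

/-! ### Closure properties of `Good` -/

namespace Good

variable {V : Set (ℂ × ℂ)} {j : ℂ → ℕ → ℂ} {h : ℂ → ℂ → ℂ}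

theorem congr {e : ℕ} {d : ℤ} {F G : ℂ → ℂ → ℂ} (hF : Good V j h e d F)
    (hFG : ∀ x t, (x, t) ∈ V → G x t = F x t) : Good V j h e d G := by
  obtain ⟨b, r, P, h1, h2⟩ := hF
  exact ⟨b, r, P, h1, fun x t hp => by rw [hFG x t hp, h2 x t hp]⟩

theorem mono {e : ℕ} {d d' : ℤ} {F : ℂ → ℂ → ℂ} (hF : Good V j h e d F) (hd : d ≤ d') :
    Good V j h e d' F := by
  obtain ⟨b, r, P, h1, h2⟩ := hF
  exact ⟨b, r, P, by omega, h2⟩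

theorem ofPolyAt (P : (MvPolynomial ℕ ℂ)[X]) {d : ℤ} (hd : (P.natDegree : ℤ) ≤ d) :
    Good V j h 0 d (polyAt j P) :=
  ⟨0, 0, P, by simpa using hd, fun x t _ => by simp⟩

theorem evalJet (p : MvPolynomial ℕ ℂ) : Good V j h 0 0 (fun _ t => MvPolynomial.eval (j t) p) :=
  (ofPolyAt (Polynomial.C p) (by simp)).congr (by simp)

theorem const (c : ℂ) : Good V j h 0 0 (fun _ _ => c) :=
  (evalJet (MvPolynomial.C c)).congr (by simp)

theorem jet (i : ℕ) : Good V j h 0 0 (fun _ t => j t i) :=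
  (evalJet (MvPolynomial.X i)).congr (by simp)

theorem x : Good V j h 0 1 (fun x _ => x) :=
  (ofPolyAt Polynomial.X (by simp)).congr (by simp)

theorem neg {e : ℕ} {d : ℤ} {F : ℂ → ℂ → ℂ} (hF : Good V j h e d F) :
    Good V j h e d (fun x t => -F x t) := by
  obtain ⟨b, r, P, h1, h2⟩ := hF
  refine ⟨b, r, -P, by simpa using h1, fun x t hp => ?_⟩
  rw [neg_mul, h2 x t hp]; simp [polyAt]

theorem mul {e e' : ℕ} {d d' : ℤ} {F G : ℂ → ℂ → ℂ} (hF : Good V j h e d F)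
    (hG : Good V j h e' d' G) : Good V j h (e + e') (d + d') (fun x t => F x t * G x t) := by
  obtain ⟨b, r, P, h1, h2⟩ := hF
  obtain ⟨b', r', P', h1', h2'⟩ := hG
  refine ⟨b + b', r + r', P * P', ?_, fun x t hp => ?_⟩
  · have := Polynomial.natDegree_mul_le (p := P) (q := P')
    push_cast; omega
  · rw [polyAt_mul, ← h2 x t hp, ← h2' x t hp]; ring

theorem zero {e : ℕ} {d : ℤ} : Good V j h e d (fun _ _ => 0) :=
  -- Since `natDegree 0 = 0`, b must be large enough for 2b + e + d to be nonnegative; so zero is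
  -- good of every degree, negative ones included.
  ⟨(e + d).natAbs, 0, 0, by simp only [Polynomial.natDegree_zero]; omega,
    fun x t _ => by simp [polyAt]⟩

variable (hV : CurveDomain V j h)
include hV

/-- The exponents in the denominator may be raised. -/
theorem exists_raise {e : ℕ} {d : ℤ} {F : ℂ → ℂ → ℂ} (hF : Good V j h e d F) :
    ∃ b₀ r₀ : ℕ, ∀ b r : ℕ, b₀ ≤ b → r₀ ≤ r → ∃ P : (MvPolynomial ℕ ℂ)[X],
      (P.natDegree : ℤ) ≤ 2 * b + e + d ∧
      ∀ x t, (x, t) ∈ V → F x t * (j t 0 ^ r * h x t ^ (2 * b + e)) = polyAt j P x t := by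
  obtain ⟨b, r, P, h1, h2⟩ := hF
  refine ⟨b, r, fun b' r' hb hr => ?_⟩
  obtain ⟨k, rfl⟩ := Nat.exists_eq_add_of_le hb
  obtain ⟨s, rfl⟩ := Nat.exists_eq_add_of_le hr
  -- Even powers of h are polynomials in x, so the fraction can be expanded by h^{2k} j_0^s without
  -- changing parity or degree.
  refine ⟨P * (hSq ^ k * Polynomial.C (MvPolynomial.X 0 ^ s)), ?_, fun x t hp => ?_⟩
  · have a1 := Polynomial.natDegree_mul_le (p := P)
      (q := hSq ^ k * Polynomial.C (MvPolynomial.X 0 ^ s))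
    have a2 := Polynomial.natDegree_mul_C_le (hSq ^ k) (MvPolynomial.X 0 ^ s : MvPolynomial ℕ ℂ)
    have a3 := natDegree_hSq_pow k
    push_cast; omega
  · rw [polyAt_mul, ← h2 x t hp]
    have : polyAt j hSq x t = h x t ^ 2 := by rw [hV.h_sq hp]; simp [hSq]
    simp only [polyAt_mul, polyAt_pow, this, polyAt_C, map_pow, MvPolynomial.eval_X]
    ring

theorem add {e : ℕ} {d : ℤ} {F G : ℂ → ℂ → ℂ} (hF : Good V j h e d F) (hG : Good V j h e d G) :
    Good V j h e d (fun x t => F x t + G x t) := by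
  obtain ⟨b, r, H⟩ := hF.exists_raise hV
  obtain ⟨b', r', H'⟩ := hG.exists_raise hV
  obtain ⟨P, h1, h2⟩ := H (max b b') (max r r') (le_max_left _ _) (le_max_left _ _)
  obtain ⟨P', h1', h2'⟩ := H' (max b b') (max r r') (le_max_right _ _) (le_max_right _ _)
  refine ⟨max b b', max r r', P + P', ?_, fun x t hp => ?_⟩
  · have := Polynomial.natDegree_add_le P P'
    omega
  · rw [polyAt_add, ← h2 x t hp, ← h2' x t hp]; ring

theorem sub {e : ℕ} {d : ℤ} {F G : ℂ → ℂ → ℂ} (hF : Good V j h e d F) (hG : Good V j h e d G) :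
    Good V j h e d (fun x t => F x t - G x t) :=
  (hF.add hV hG.neg).congr fun x t _ => by ring

theorem sum {ι : Type*} (s : Finset ι) {e : ℕ} {d : ℤ} {F : ι → ℂ → ℂ → ℂ}
    (hF : ∀ i ∈ s, Good V j h e d (F i)) : Good V j h e d (fun x t => ∑ i ∈ s, F i x t) := by
  classical
  induction s using Finset.induction_on with
  | empty => simpa using zero
  | insert a s ha ih =>
    have := (hF a (Finset.mem_insert_self _ _)).add hV
      (ih fun i hi => hF i (Finset.mem_insert_of_mem hi))
    exact this.congr fun x t _ => by rw [Finset.sum_insert ha]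

-- Two factors h are absorbed into h^{2b}: only the parity of e matters. In this way a product of
-- two odd functions, recorded with e = 2, becomes an even one.
omit hV in
theorem cast_even {e : ℕ} {d : ℤ} {F : ℂ → ℂ → ℂ} (hF : Good V j h (e + 2) d F) :
    Good V j h e d F := by
  obtain ⟨b, r, P, h1, h2⟩ := hF
  exact ⟨b + 1, r, P, by push_cast at h1 ⊢; omega,
    fun x t hp => by rw [← h2 x t hp]; ring⟩

theorem sqrt : Good V j h 1 1 h :=
  ⟨0, 0, hSq, by simpa using natDegree_hSq_pow 1, fun x t hp => by
    have : polyAt j hSq x t = h x t ^ 2 := by rw [hV.h_sq hp]; simp [hSq]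
    rw [this]; ring⟩

theorem inv_sqrt : Good V j h 1 (-1) (fun x t => (h x t)⁻¹) :=
  ⟨0, 0, 1, by simp, fun x t hp => by
    have := hV.h_ne hp
    simp [polyAt, this]⟩

theorem inv_jet : Good V j h 0 0 (fun _ t => (j t 0)⁻¹) :=
  ⟨0, 1, 1, by simp, fun x t hp => by
    have := hV.jet_ne hp
    simp [polyAt, this]⟩

theorem pow_inv_sqrt (n : ℕ) : Good V j h n (-n) (fun x t => (h x t)⁻¹ ^ n) :=
  ⟨0, 0, 1, by simp, fun x t hp => by
    have := hV.h_ne hp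
    simp [polyAt, this]⟩

omit hV in
theorem eq_div (hV : CurveDomain V j h) {b r e : ℕ} {P : (MvPolynomial ℕ ℂ)[X]} {F : ℂ → ℂ → ℂ}
    {x t : ℂ} (hp : (x, t) ∈ V)
    (h2 : F x t * (j t 0 ^ r * h x t ^ (2 * b + e)) = polyAt j P x t) :
    F x t = polyAt j P x t / (j t 0 ^ r * h x t ^ (2 * b + e)) := by
  rw [eq_div_iff, h2]
  exact mul_ne_zero (pow_ne_zero _ (hV.jet_ne hp)) (pow_ne_zero _ (hV.h_ne hp))

/-- As ∂_x h = -x/h, the derivative of P/h^n is (P' h² + n x P)/h^{n+2}: the numerator gains one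
degree and the denominator two. -/
theorem hasDerivAt_x {e : ℕ} {d : ℤ} {F : ℂ → ℂ → ℂ} (hF : Good V j h e d F) :
    ∃ F', Good V j h e (d - 1) F' ∧
      ∀ x t, (x, t) ∈ V → HasDerivAt (fun s => F s t) (F' x t) x := by
  obtain ⟨b, r, P, h1, h2⟩ := hF
  set n := 2 * b + e with hn
  refine ⟨fun x t => (polyAt j (Polynomial.derivative P * hSq
    + (n : (MvPolynomial ℕ ℂ)[X]) * Polynomial.X * P) x t) / (j t 0 ^ r * h x t ^ (n + 2)),
    ⟨b + 1, r, Polynomial.derivative P * hSq + (n : (MvPolynomial ℕ ℂ)[X]) * Polynomial.X * P,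
      ?_, fun x t hp => ?_⟩, fun x t hp => ?_⟩
  -- For constant P the bound deg P' ≤ deg P - 1 is spoiled by truncated subtraction, but then P' =
  -- 0.
  · rcases Nat.eq_zero_or_pos P.natDegree with h0 | h0
    · have : Polynomial.derivative P = 0 := by
        rw [Polynomial.eq_C_of_natDegree_eq_zero h0]; simp
      rw [this, zero_mul, zero_add]
      have a1 : ((n : (MvPolynomial ℕ ℂ)[X]) * Polynomial.X * P).natDegree ≤ 0 + 1 + P.natDegree :=
        Polynomial.natDegree_mul_le_of_le (Polynomial.natDegree_mul_le_of_le
          (Polynomial.natDegree_natCast n).le Polynomial.natDegree_X_le) le_rfl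
      push_cast; omega
    · have a1 : ((n : (MvPolynomial ℕ ℂ)[X]) * Polynomial.X * P).natDegree ≤ 0 + 1 + P.natDegree :=
        Polynomial.natDegree_mul_le_of_le (Polynomial.natDegree_mul_le_of_le
          (Polynomial.natDegree_natCast n).le Polynomial.natDegree_X_le) le_rfl
      have a2 : (Polynomial.derivative P * hSq).natDegree ≤ (P.natDegree - 1) + 2 :=
        Polynomial.natDegree_mul_le_of_le (Polynomial.natDegree_derivative_le P)
          (by simpa using natDegree_hSq_pow 1)
      have a3 := Polynomial.natDegree_add_le (Polynomial.derivative P * hSq)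
        ((n : (MvPolynomial ℕ ℂ)[X]) * Polynomial.X * P)
      push_cast; omega
  · have e1 : 2 * (b + 1) + e = n + 2 := by omega
    rw [e1, div_mul_cancel₀]
    exact mul_ne_zero (pow_ne_zero _ (hV.jet_ne hp)) (pow_ne_zero _ (hV.h_ne hp))
  · have hh := hV.h_ne hp
    have hj := hV.jet_ne hp
    have hden : j t 0 ^ r * h x t ^ n ≠ 0 := mul_ne_zero (pow_ne_zero _ hj) (pow_ne_zero _ hh)
    have key := (hasDerivAt_polyAt_x j x t P).div
      (((hV.hasDerivAt_h_x hp).fun_pow n).const_mul (j t 0 ^ r)) hden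
    have key2 := key.congr_of_eventuallyEq (f₁ := fun s => F s t)
      ((hV.eventually_x hp).mono fun s hs => eq_div hV hs (h2 s t hs))
    refine key2.congr_deriv ?_
    have hs : polyAt j hSq x t = h x t ^ 2 := by rw [hV.h_sq hp]; simp [hSq]
    have hnat : polyAt j (n : (MvPolynomial ℕ ℂ)[X]) x t = n := by simp [polyAt]
    simp only [polyAt_add, polyAt_mul, hs, hnat, polyAt_X]
    rcases Nat.eq_zero_or_pos n with h0 | h0
    · rw [h0]; simp; field_simp
    · obtain ⟨k, hk⟩ := Nat.exists_eq_succ_of_ne_zero h0.ne'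
      rw [hk]
      simp only [Nat.succ_eq_add_one, Nat.add_sub_cancel]
      field_simp
      ring

/-- As ∂_t h = j_0 j_1 / h does not involve x in its numerator, numerator and denominator gain at
most the same two degrees. The coefficients remain polynomials in the jet, at the price of one more
j_0 in the denominator. -/
theorem hasDerivAt_t {e : ℕ} {d : ℤ} {F : ℂ → ℂ → ℂ} (hF : Good V j h e d F) :
    ∃ F', Good V j h e d F' ∧
      ∀ x t, (x, t) ∈ V → HasDerivAt (fun s => F x s) (F' x t) t := by
  obtain ⟨b, r, P, h1, h2⟩ := hF
  set n := 2 * b + e with hn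
  let u0 : (MvPolynomial ℕ ℂ)[X] := Polynomial.C (MvPolynomial.X 0)
  let u1 : (MvPolynomial ℕ ℂ)[X] := Polynomial.C (MvPolynomial.X 1)
  let Q := coeffD P * u0 * hSq - (r : (MvPolynomial ℕ ℂ)[X]) * u1 * (P * hSq)
      - (n : (MvPolynomial ℕ ℂ)[X]) * (u0 ^ 2 * u1) * P
  refine ⟨fun x t => polyAt j Q x t / (j t 0 ^ (r + 1) * h x t ^ (n + 2)),
    ⟨b + 1, r + 1, Q, ?_, fun x t hp => ?_⟩, fun x t hp => ?_⟩
  · have hh : hSq.natDegree ≤ 2 := by simpa using natDegree_hSq_pow 1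
    have a0 : (coeffD P * u0 * hSq).natDegree ≤ P.natDegree + 0 + 2 :=
      Polynomial.natDegree_mul_le_of_le (Polynomial.natDegree_mul_le_of_le
        (natDegree_coeffD_le P) (Polynomial.natDegree_C _).le) hh
    have a1 : ((r : (MvPolynomial ℕ ℂ)[X]) * u1 * (P * hSq)).natDegree
        ≤ 0 + 0 + (P.natDegree + 2) :=
      Polynomial.natDegree_mul_le_of_le (Polynomial.natDegree_mul_le_of_le
        (Polynomial.natDegree_natCast r).le (Polynomial.natDegree_C _).le)
        (Polynomial.natDegree_mul_le_of_le le_rfl hh)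
    have a2 : ((n : (MvPolynomial ℕ ℂ)[X]) * (u0 ^ 2 * u1) * P).natDegree
        ≤ 0 + (2 * 0 + 0) + P.natDegree :=
      Polynomial.natDegree_mul_le_of_le (Polynomial.natDegree_mul_le_of_le
        (Polynomial.natDegree_natCast n).le (Polynomial.natDegree_mul_le_of_le
          (Polynomial.natDegree_pow_le_of_le 2 (Polynomial.natDegree_C _).le)
          (Polynomial.natDegree_C _).le)) le_rfl
    have a3 := Polynomial.natDegree_sub_le_of_le (Polynomial.natDegree_sub_le_of_le a0 a1) a2
    have a4 : (Q.natDegree : ℤ) ≤ P.natDegree + 2 := by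
      refine (Nat.cast_le.2 a3).trans ?_
      push_cast
      omega
    push_cast; omega
  · have e1 : 2 * (b + 1) + e = n + 2 := by omega
    rw [e1, div_mul_cancel₀]
    exact mul_ne_zero (pow_ne_zero _ (hV.jet_ne hp)) (pow_ne_zero _ (hV.h_ne hp))
  · have hh := hV.h_ne hp
    have hj := hV.jet_ne hp
    have hden : j t 0 ^ r * h x t ^ n ≠ 0 := mul_ne_zero (pow_ne_zero _ hj) (pow_ne_zero _ hh)
    have key := (hasDerivAt_polyAt_t x P (hV.jet_deriv hp)).div
      (((hV.jet_deriv hp 0).fun_pow r).fun_mul ((hV.hasDerivAt_h_t hp).fun_pow n)) hden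
    have key2 := key.congr_of_eventuallyEq (f₁ := fun s => F x s)
      ((hV.eventually_t hp).mono fun s hs => eq_div hV hs (h2 x s hs))
    refine key2.congr_deriv ?_
    have hs : polyAt j hSq x t = h x t ^ 2 := by rw [hV.h_sq hp]; simp [hSq]
    have hnat : ∀ n : ℕ, polyAt j (n : (MvPolynomial ℕ ℂ)[X]) x t = n := by simp [polyAt]
    simp only [Q, u0, u1, polyAt_sub, polyAt_mul, polyAt_pow, hs, hnat, polyAt_C,
      MvPolynomial.eval_X]
    have r1 : (r : ℂ) * j t 0 ^ (r - 1) = r * j t 0 ^ r / j t 0 := by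
      rcases Nat.eq_zero_or_pos r with h0 | h0
      · simp [h0]
      · obtain ⟨k, hk⟩ := Nat.exists_eq_succ_of_ne_zero h0.ne'
        rw [hk]; simp only [Nat.succ_eq_add_one, Nat.add_sub_cancel]; field_simp; ring
    have n1 : (n : ℂ) * h x t ^ (n - 1) = n * h x t ^ n / h x t := by
      rcases Nat.eq_zero_or_pos n with h0 | h0
      · simp [h0]
      · obtain ⟨k, hk⟩ := Nat.exists_eq_succ_of_ne_zero h0.ne'
        rw [hk]; simp only [Nat.succ_eq_add_one, Nat.add_sub_cancel]; field_simp; ring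
    rw [r1, n1]
    simp only [zero_add]
    field_simp
    ring

end Good

end MinimalModel

end

/-! ### Rigidity of odd functions, and degrees of factors -/

noncomputable section

namespace MinimalModel

open Polynomial

namespace CurveDomain

variable {V : Set (ℂ × ℂ)} {j : ℂ → ℕ → ℂ} {h : ℂ → ℂ → ℂ} (hV : CurveDomain V j h)
include hV

omit hV in
theorem poly_eq_of_eventually {x : ℂ} {p q : ℂ[X]} (hpq : ∀ᶠ s in nhds x, p.eval s = q.eval s) : p = q :=
  Polynomial.eq_of_infinite_eval_eq p q (infinite_of_mem_nhds x hpq)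

theorem poly_eq {x t : ℂ} (hp : (x, t) ∈ V) {p q : ℂ[X]}
    (hpq : ∀ s, (s, t) ∈ V → p.eval s = q.eval s) : p = q :=
  poly_eq_of_eventually ((hV.eventually_x hp).mono hpq)

end CurveDomain

theorem natDegree_const_sub_sq (c : ℂ) : (Polynomial.C c - X ^ 2 : ℂ[X]).natDegree = 2 := by
  compute_degree!

namespace Good

variable {V : Set (ℂ × ℂ)} {j : ℂ → ℕ → ℂ} {h : ℂ → ℂ → ℂ} (hV : CurveDomain V j h)
include hV

theorem differentiableOn {e : ℕ} {d : ℤ} {F : ℂ → ℂ → ℂ} (hF : Good V j h e d F) :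
    DifferentiableOn ℂ (fun p : ℂ × ℂ => F p.1 p.2) V := by
  obtain ⟨b, r, P, h1, h2⟩ := hF
  have key : DifferentiableOn ℂ (fun p : ℂ × ℂ =>
      polyAt j P p.1 p.2 / (j p.2 0 ^ r * h p.1 p.2 ^ (2 * b + e))) V := by
    have hj : ∀ q : MvPolynomial ℕ ℂ,
        DifferentiableOn ℂ (fun p : ℂ × ℂ => MvPolynomial.eval (j p.2) q) V := by
      intro q p hp
      exact (DifferentiableAt.comp (f := fun p : ℂ × ℂ => p.2)
        (g := fun t => MvPolynomial.eval (j t) q) p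
        (hasDerivAt_eval_jet (hV.jet_deriv (x := p.1) hp) q).differentiableAt
        differentiableAt_snd).differentiableWithinAt
    simp only [div_eq_mul_inv]
    refine DifferentiableOn.fun_mul ?_ (DifferentiableOn.inv ?_ ?_)
    · have : (fun p : ℂ × ℂ => polyAt j P p.1 p.2) = fun p : ℂ × ℂ =>
          ∑ i ∈ Finset.range (P.natDegree + 1),
            MvPolynomial.eval (j p.2) (P.coeff i) * p.1 ^ i :=
        funext fun p => polyAt_eq_sum j p.1 p.2 P (Nat.lt_succ_self _)
      rw [this]
      exact DifferentiableOn.fun_sum fun i _ => (hj _).mul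
        (differentiable_fst.differentiableOn.pow i)
    · have := hj (MvPolynomial.X 0)
      simp only [MvPolynomial.eval_X] at this
      exact (this.pow r).mul (hV.h_diff.pow _)
    · intro p hp
      exact mul_ne_zero (pow_ne_zero _ (hV.jet_ne hp)) (pow_ne_zero _ (hV.h_ne hp))
  exact key.congr fun p hp => eq_div hV hp (h2 p.1 p.2 hp)

/-- An odd function that is locally constant in `x` vanishes. -/
theorem eq_zero_of_eventually_const {d : ℤ} {F : ℂ → ℂ → ℂ} (hF : Good V j h 1 d F) {x t : ℂ}
    (hp : (x, t) ∈ V) (hc : ∀ᶠ s in nhds x, F s t = F x t) : F x t = 0 := by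
  obtain ⟨b, r, P, h1, h2⟩ := hF
  by_contra hne
  have hj := hV.jet_ne hp
  -- If F is a nonzero constant near x, squaring F j_0^r h^{2b+1} = R gives R² = c (j_0² -
  -- x²)^{2b+1} as polynomials in x. The root x = j_0 has even multiplicity on the left and odd
  -- multiplicity on the right.
  set c := (F x t * j t 0 ^ r) ^ 2 with hcdef
  have hc0 : c ≠ 0 := pow_ne_zero _ (mul_ne_zero hne (pow_ne_zero _ hj))
  set R := P.map (MvPolynomial.eval (j t)) with hR
  have key : R ^ 2 = Polynomial.C c * (Polynomial.C (j t 0 ^ 2) - X ^ 2) ^ (2 * b + 1) := by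
    refine CurveDomain.poly_eq_of_eventually (x := x) ?_
    filter_upwards [hc, hV.eventually_x hp] with s hs hsV
    have e1 := h2 s t hsV
    rw [hs] at e1
    have e2 : R.eval s = polyAt j P s t := rfl
    simp only [eval_pow, eval_mul, eval_C, eval_sub, eval_X]
    rw [e2, ← e1, ← hV.h_sq hsV, hcdef]
    ring
  have hfac : (Polynomial.C (j t 0 ^ 2) - X ^ 2 : ℂ[X])
      = Polynomial.C (-1) * ((X - Polynomial.C (j t 0)) * (X - Polynomial.C (-(j t 0)))) := by
    simp only [map_pow, map_neg, map_one]; ring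
  have hXne : ∀ a : ℂ, (X - Polynomial.C a) ≠ 0 := Polynomial.X_sub_C_ne_zero
  have hm : (Polynomial.C (j t 0 ^ 2) - X ^ 2 : ℂ[X]).rootMultiplicity (j t 0) = 1 := by
    have hne' : j t 0 ≠ -(j t 0) := by
      intro hh; apply hj; linear_combination hh / 2
    rw [hfac, Polynomial.rootMultiplicity_mul (mul_ne_zero (by simp) (mul_ne_zero (hXne _) (hXne _))),
      Polynomial.rootMultiplicity_mul (mul_ne_zero (hXne _) (hXne _)),
      Polynomial.rootMultiplicity_X_sub_C_self, Polynomial.rootMultiplicity_C,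
      Polynomial.rootMultiplicity_eq_zero]
    simp only [Polynomial.root_X_sub_C]
    exact fun hh => hne' hh.symm
  have hS0 : (Polynomial.C (j t 0 ^ 2) - X ^ 2 : ℂ[X]) ≠ 0 := by
    intro hh; rw [hh] at hm; simp at hm
  have e := congrArg (Polynomial.rootMultiplicity (j t 0)) key
  rw [Polynomial.rootMultiplicity_mul (mul_ne_zero (by simpa using hc0) (pow_ne_zero _ hS0)),
    Polynomial.rootMultiplicity_C, ← Polynomial.count_roots, ← Polynomial.count_roots,
    Polynomial.roots_pow, Polynomial.roots_pow, Multiset.count_nsmul, Multiset.count_nsmul,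
    Polynomial.count_roots, Polynomial.count_roots, hm] at e
  omega

/-- A function that does not depend on `x`, and whose `t`-derivative is odd, is constant. -/
theorem exists_eq_const {d : ℤ} {F G : ℂ → ℂ → ℂ} (hc : IsPreconnected V)
    (hFd : DifferentiableOn ℂ (fun p : ℂ × ℂ => F p.1 p.2) V)
    (hx : ∀ x t, (x, t) ∈ V → HasDerivAt (fun s => F s t) 0 x)
    (ht : ∀ x t, (x, t) ∈ V → HasDerivAt (fun s => F x s) (G x t) t)
    (hG : Good V j h 1 d G) : ∃ c : ℂ, ∀ x t, (x, t) ∈ V → F x t = c := by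
  -- On a product of discs F depends on t alone, hence so does its t-derivative G; an odd function
  -- locally constant in x vanishes.
  have hG0 : ∀ x t, (x, t) ∈ V → G x t = 0 := by
    intro x t hp
    refine hG.eq_zero_of_eventually_const hV hp ?_
    obtain ⟨ε, hε, hball⟩ := Metric.isOpen_iff.1 hV.isOpen (x, t) hp
    filter_upwards [Metric.ball_mem_nhds x hε] with y hy
    have hmem : ∀ s ∈ Metric.ball t ε, ∀ y ∈ Metric.ball x ε, (y, s) ∈ V := by
      intro s hs y hy
      apply hball
      rw [← ball_prod_same]
      exact ⟨hy, hs⟩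
    have hyx : ∀ s ∈ Metric.ball t ε, F y s = F x s := by
      intro s hs
      refine IsOpen.is_const_of_deriv_eq_zero (f := fun y => F y s) Metric.isOpen_ball
        (convex_ball x ε).isPreconnected (fun w hw => ?_) (fun w hw => ?_) hy
        (Metric.mem_ball_self hε)
      · exact (hx w s (hmem s hs w hw)).differentiableAt.differentiableWithinAt
      · exact (hx w s (hmem s hs w hw)).deriv
    have h1 := ht y t (hmem t (Metric.mem_ball_self hε) y hy)
    have h2 := (ht x t hp).congr_of_eventuallyEq (f₁ := fun s => F y s)
      (Filter.eventually_of_mem (Metric.ball_mem_nhds t hε) hyx)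
    exact h1.unique h2
  obtain ⟨c, hc⟩ := hV.isOpen.exists_is_const_of_fderiv_eq_zero (𝕜 := ℂ) hc hFd (by
    rintro ⟨x, t⟩ hp
    have hd := (hFd.differentiableAt (hV.isOpen.mem_nhds hp)).hasFDerivAt
    have d1 : HasDerivAt (fun s => F s t) _ x :=
      hd.comp_hasDerivAt (l := fun p : ℂ × ℂ => F p.1 p.2) x ((hasDerivAt_id' x).prodMk (hasDerivAt_const x t))
    have d2 : HasDerivAt (fun s => F x s) _ t :=
      hd.comp_hasDerivAt (l := fun p : ℂ × ℂ => F p.1 p.2) t ((hasDerivAt_const t x).prodMk (hasDerivAt_id' t))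
    have e1 := d1.unique (hx x t hp)
    have e2 := d2.unique (ht x t hp)
    rw [hG0 x t hp] at e2
    ext
    · simpa using e1
    · simpa using e2)
  exact ⟨c, fun x t hp => hc (x, t) hp⟩

/-- The degree of a factor is determined by the degree of a product with a function `h Q(x)`, where
the degree of `Q` is constant. -/
theorem of_mul {d₀ d : ℤ} {q : ℕ} {F Y : ℂ → ℂ → ℂ} (hF : Good V j h 1 d₀ F)
    (Q : ℂ → ℂ[X]) (hY : ∀ x t, (x, t) ∈ V → Y x t = h x t * (Q t).eval x)
    (hQ : ∀ x t, (x, t) ∈ V → Q t ≠ 0 ∧ (Q t).natDegree = q)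
    (hYF : Good V j h 0 d (fun x t => Y x t * F x t)) : Good V j h 1 (d - q - 1) F := by
  obtain ⟨b₀, r, H⟩ := hF.exists_raise hV
  obtain ⟨b', r', P', h1', h2'⟩ := hYF
  -- A large b makes the expected bound 2b + d - q a natural number, so that the case of a vanishing
  -- numerator causes no trouble.
  obtain ⟨P, h1, h2⟩ := H (max b₀ (d - q).natAbs) r (le_max_left _ _) le_rfl
  set b := max b₀ (d - q).natAbs with hb
  have hbd : (0 : ℤ) ≤ 2 * b + (d - q) := by
    have : (d - q).natAbs ≤ b := le_max_right _ _
    omega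
  have hdeg : ∀ x t, (x, t) ∈ V →
      ((P.map (MvPolynomial.eval (j t))).natDegree : ℤ) ≤ 2 * b + (d - q) := by
    intro x t hp
    have hj := hV.jet_ne hp
    obtain ⟨hQ0, hQd⟩ := hQ x t hp
    set R := P.map (MvPolynomial.eval (j t)) with hR
    set R' := P'.map (MvPolynomial.eval (j t)) with hR'
    set S : ℂ[X] := Polynomial.C (j t 0 ^ 2) - X ^ 2 with hS
    -- The two representations of Y F, cleared of denominators; the factor h of Y combines with the
    -- odd power in the denominator of F. Comparing degrees in x bounds the degree of R.
    have key : Q t * R * (Polynomial.C (j t 0 ^ r') * S ^ b')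
        = R' * (Polynomial.C (j t 0 ^ r) * S ^ b) := by
      refine hV.poly_eq hp fun s hs => ?_
      have e2 : R.eval s = polyAt j P s t := rfl
      have e2' : R'.eval s = polyAt j P' s t := rfl
      have e3 : S.eval s = h s t ^ 2 := by rw [hV.h_sq hs]; simp [hS]
      simp only [eval_mul, eval_C, eval_pow, e2, e2', e3, ← h2 s t hs, ← h2' s t hs, hY s t hs]
      ring
    have hSd : S.natDegree = 2 := natDegree_const_sub_sq _
    have hS0 : S ≠ 0 := by intro hh; rw [hh] at hSd; simp at hSd
    have hc : ∀ r : ℕ, (Polynomial.C (j t 0 ^ r) : ℂ[X]) ≠ 0 := fun r => by simp [hj]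
    by_cases hR0 : R = 0
    · rw [hR0]; simpa using hbd
    have hd := congrArg Polynomial.natDegree key
    have hR'0 : R' ≠ 0 := by
      intro hh
      rw [hh, zero_mul] at key
      exact mul_ne_zero (mul_ne_zero hQ0 hR0) (mul_ne_zero (hc _) (pow_ne_zero _ hS0)) key
    rw [natDegree_mul (mul_ne_zero hQ0 hR0) (mul_ne_zero (hc _) (pow_ne_zero _ hS0)),
      natDegree_mul hQ0 hR0, natDegree_C_mul (pow_ne_zero _ hj), natDegree_pow, hSd, hQd,
      natDegree_mul hR'0 (mul_ne_zero (hc _) (pow_ne_zero _ hS0)),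
      natDegree_C_mul (pow_ne_zero _ hj), natDegree_pow, hSd] at hd
    have hle : R'.natDegree ≤ P'.natDegree := Polynomial.natDegree_map_le
    push_cast at h1'
    omega
  obtain ⟨N, hN⟩ := Int.eq_ofNat_of_zero_le hbd
  -- The degree is known only after evaluation at the jets that occur. The coefficients of P beyond
  -- N vanish at all these jets, but perhaps not as polynomials, and are therefore cut off.
  refine ⟨b, r, ∑ i ∈ Finset.range (N + 1), Polynomial.monomial i (P.coeff i), ?_,
    fun x t hp => ?_⟩
  · have : (∑ i ∈ Finset.range (N + 1), Polynomial.monomial i (P.coeff i)).natDegree ≤ N :=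
      Polynomial.natDegree_sum_le_of_forall_le _ _ fun i hi =>
        (Polynomial.natDegree_monomial_le _).trans (Nat.lt_succ_iff.1 (Finset.mem_range.1 hi))
    push_cast
    omega
  · rw [h2 x t hp]
    have hlt : (P.map (MvPolynomial.eval (j t))).natDegree < N + 1 := by
      have := hdeg x t hp
      omega
    have e1 : polyAt j P x t = ∑ i ∈ Finset.range (N + 1),
        MvPolynomial.eval (j t) (P.coeff i) * x ^ i := by
      rw [polyAt, Polynomial.eval_eq_sum_range' hlt]
      simp
    rw [e1]
    simp [polyAt, Polynomial.map_sum, Polynomial.eval_finsetSum]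

end Good

/-! ### Primitives in `x` -/

/-- `F` has on `V` an odd primitive with respect to `x`. -/
def HasOddPrimitive (V : Set (ℂ × ℂ)) (j : ℂ → ℕ → ℂ) (h : ℂ → ℂ → ℂ) (F : ℂ → ℂ → ℂ) : Prop :=
  ∃ Θ, Good V j h 1 0 Θ ∧ ∀ x t, (x, t) ∈ V → HasDerivAt (fun s => Θ s t) (F x t) x

namespace HasOddPrimitive

variable {V : Set (ℂ × ℂ)} {j : ℂ → ℕ → ℂ} {h : ℂ → ℂ → ℂ}

theorem congr {F G : ℂ → ℂ → ℂ} (hF : HasOddPrimitive V j h F)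
    (hFG : ∀ x t, (x, t) ∈ V → G x t = F x t) : HasOddPrimitive V j h G := by
  obtain ⟨Θ, h1, h2⟩ := hF
  exact ⟨Θ, h1, fun x t hp => by rw [hFG x t hp]; exact h2 x t hp⟩

theorem mul_left {F : ℂ → ℂ → ℂ} {c : ℂ → ℂ} (hF : HasOddPrimitive V j h F)
    (hc : Good V j h 0 0 (fun _ t => c t)) : HasOddPrimitive V j h (fun x t => c t * F x t) := by
  obtain ⟨Θ, h1, h2⟩ := hF
  exact ⟨fun x t => c t * Θ x t, by simpa using hc.mul h1,
    fun x t hp => (h2 x t hp).const_mul _⟩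

variable (hV : CurveDomain V j h)
include hV

theorem add {F G : ℂ → ℂ → ℂ} (hF : HasOddPrimitive V j h F) (hG : HasOddPrimitive V j h G) :
    HasOddPrimitive V j h (fun x t => F x t + G x t) := by
  obtain ⟨Θ, h1, h2⟩ := hF
  obtain ⟨Θ', h1', h2'⟩ := hG
  exact ⟨_, h1.add hV h1', fun x t hp => (h2 x t hp).fun_add (h2' x t hp)⟩

theorem sum {ι : Type*} (s : Finset ι) {F : ι → ℂ → ℂ → ℂ}
    (hF : ∀ i ∈ s, HasOddPrimitive V j h (F i)) :
    HasOddPrimitive V j h (fun x t => ∑ i ∈ s, F i x t) := by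
  classical
  induction s using Finset.induction_on with
  | empty => exact ⟨fun _ _ => 0, Good.zero, fun x t _ => by simpa using hasDerivAt_const x 0⟩
  | insert a s ha ih =>
    exact ((hF a (Finset.mem_insert_self _ _)).add hV
      (ih fun i hi => hF i (Finset.mem_insert_of_mem hi))).congr
      fun x t _ => by rw [Finset.sum_insert ha]

/-- The derivative of `x^i h^{-(2b+1)}`. -/
theorem deriv_monomial {i b : ℕ} (hi : i ≤ 2 * b + 1) : HasOddPrimitive V j h
    (fun x t => i * x ^ (i - 1) * (h x t)⁻¹ ^ (2 * b + 1)
      + (2 * b + 1) * (x ^ (i + 1) * (h x t)⁻¹ ^ (2 * b + 3))) := by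
  refine ⟨fun x t => x ^ i * (h x t)⁻¹ ^ (2 * b + 1),
    ⟨b, 0, Polynomial.X ^ i, ?_, fun x t hp => ?_⟩, fun x t hp => ?_⟩
  · rw [Polynomial.natDegree_X_pow]; push_cast; omega
  · have := hV.h_ne hp
    simp [this]
  · have hh := hV.h_ne hp
    have := (hasDerivAt_pow i x).fun_mul
      (((hV.hasDerivAt_h_x hp).fun_inv hh).fun_pow (2 * b + 1))
    refine this.congr_deriv ?_
    rw [Nat.add_sub_cancel]
    push_cast
    ring

/-- With x² = j_0² - h², the derivative of x^{i+1} h^{-(2b+1)} is a combination of x^i h^{-(2b+3)}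
and x^{i+2} h^{-(2b+3)}, which reduces i by two. For i = 1 a power of h⁻¹ is a primitive, and for i
= 0 one descends in b. The excluded exponent i = 2b + 2 would produce a logarithm at infinity. -/
theorem monomial (b i : ℕ) (hi : i ≤ 2 * b + 1) :
    HasOddPrimitive V j h (fun x t => x ^ i * (h x t)⁻¹ ^ (2 * b + 3)) := by
  have hw : ∀ x t, (x, t) ∈ V → (h x t)⁻¹ ^ 2 * (j t 0 ^ 2 - x ^ 2) = 1 := fun x t hp => by
    rw [← hV.h_sq hp, ← mul_pow, inv_mul_cancel₀ (hV.h_ne hp), one_pow]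
  have hJ : ∀ x t, (x, t) ∈ V → (j t 0)⁻¹ * j t 0 = 1 := fun x t hp =>
    inv_mul_cancel₀ (hV.jet_ne hp)
  have hodd : ∀ b : ℕ, (2 * (b : ℂ) + 1) ≠ 0 := fun b => by
    have : ((2 * b + 1 : ℕ) : ℂ) ≠ 0 := Nat.cast_ne_zero.2 (by omega)
    push_cast at this; exact this
  have hJJ : Good V j h 0 0 (fun _ t => (j t 0)⁻¹ ^ 2) := by
    simpa [pow_two] using (Good.inv_jet hV).mul (Good.inv_jet hV)
  induction i using Nat.twoStepInduction with
  | zero =>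
    clear hi
    induction b with
    | zero =>
      refine ((deriv_monomial hV (i := 1) (b := 0) (by omega)).mul_left hJJ).congr
        fun x t hp => ?_
      simp only [Nat.cast_zero, Nat.cast_one, Nat.sub_self]
      linear_combination (-(h x t)⁻¹ ^ 3 * (1 + (j t 0)⁻¹ * j t 0)) * hJ x t hp
        + (j t 0)⁻¹ ^ 2 * (h x t)⁻¹ * hw x t hp
    | succ b ih =>
      have hc : Good V j h 0 0 (fun _ t => (2 * ((b : ℂ) + 1) + 1)⁻¹ * (j t 0)⁻¹ ^ 2) := by
        simpa using (Good.const (2 * ((b : ℂ) + 1) + 1)⁻¹).mul hJJ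
      refine (((deriv_monomial hV (i := 1) (b := b + 1) (by omega)).add hV
        (ih.mul_left (c := fun _ => 2 * ((b : ℂ) + 1)) (Good.const _))).mul_left hc).congr
        fun x t hp => ?_
      have hK : (2 * ((b : ℂ) + 1) + 1)⁻¹ * (2 * ((b : ℂ) + 1) + 1) = 1 :=
        inv_mul_cancel₀ (by simpa using hodd (b + 1))
      simp only [Nat.sub_self]
      push_cast
      generalize (2 * ((b : ℂ) + 1) + 1)⁻¹ = K at hK ⊢
      linear_combination (-(h x t)⁻¹ ^ (2 * b + 5) * (1 + (j t 0)⁻¹ * j t 0)) * hJ x t hp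
        + (j t 0)⁻¹ ^ 2 * (h x t)⁻¹ ^ (2 * b + 3) * hw x t hp
        - (j t 0)⁻¹ ^ 2 * (h x t)⁻¹ ^ (2 * b + 3) * (1 + x ^ 2 * (h x t)⁻¹ ^ 2) * hK
  | one =>
    refine ((deriv_monomial hV (i := 0) (b := b) (by omega)).mul_left
      (c := fun _ => (2 * (b : ℂ) + 1)⁻¹) (Good.const _)).congr fun x t hp => ?_
    have hK : (2 * (b : ℂ) + 1)⁻¹ * (2 * (b : ℂ) + 1) = 1 := inv_mul_cancel₀ (hodd b)
    simp only [Nat.cast_zero, zero_mul]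
    linear_combination -(x * (h x t)⁻¹ ^ (2 * b + 3)) * hK
  | more i ih _ =>
    -- This is the coefficient of x^{i+2} h^{-(2b+3)} in the derivative; it would vanish exactly at
    -- the excluded exponent i + 2 = 2b + 2.
    have hne : (2 * (b : ℂ) - i) ≠ 0 := by
      have : (2 * (b : ℂ) - i) = ((2 * b - i : ℕ) : ℂ) := by
        rw [Nat.cast_sub (by omega)]; push_cast; ring
      rw [this]
      exact Nat.cast_ne_zero.2 (by omega)
    have hc : Good V j h 0 0 (fun _ t => -(((i : ℂ) + 1) * (j t 0 * j t 0))) := by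
      have := ((Good.const ((i : ℂ) + 1)).mul ((Good.jet (V := V) (j := j) (h := h) 0).mul
        (Good.jet 0))).neg
      simpa using this
    refine (((deriv_monomial hV (i := i + 1) (b := b) (by omega)).add hV
      ((ih (by omega)).mul_left hc)).mul_left (c := fun _ => (2 * (b : ℂ) - i)⁻¹)
      (Good.const _)).congr fun x t hp => ?_
    have hK := inv_mul_cancel₀ hne
    simp only [Nat.add_sub_cancel]
    push_cast
    generalize (2 * (b : ℂ) - i)⁻¹ = K at hK ⊢
    linear_combination -(x ^ (i + 2) * (h x t)⁻¹ ^ (2 * b + 3)) * hK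
      + K * (i + 1) * x ^ i * (h x t)⁻¹ ^ (2 * b + 1) * hw x t hp

end HasOddPrimitive

/-- An odd function of degree at most `-2` has an odd primitive. -/
theorem Good.hasOddPrimitive {V : Set (ℂ × ℂ)} {j : ℂ → ℕ → ℂ} {h : ℂ → ℂ → ℂ}
    (hV : CurveDomain V j h) {F : ℂ → ℂ → ℂ} (hF : Good V j h 1 (-2) F) :
    HasOddPrimitive V j h F := by
  obtain ⟨b, r, P, h1, h2⟩ := hF
  push_cast at h1
  -- The bound deg P ≤ 2b - 1 forces b ≥ 1.
  obtain ⟨b, rfl⟩ : ∃ b', b = b' + 1 := ⟨b - 1, by omega⟩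
  have hr : Good V j h 0 0 (fun _ t => (j t 0)⁻¹ ^ r) :=
    ⟨0, r, 1, by simp, fun x t hp => by
      have := hV.jet_ne hp
      simp [polyAt, this]⟩
  refine (HasOddPrimitive.sum hV (Finset.range (P.natDegree + 1))
    (F := fun i x t => (MvPolynomial.eval (j t) (P.coeff i) * (j t 0)⁻¹ ^ r)
      * (x ^ i * (h x t)⁻¹ ^ (2 * b + 3))) fun i hi => ?_).congr fun x t hp => ?_
  · refine (HasOddPrimitive.monomial hV b i ?_).mul_left ?_
    · have := Finset.mem_range.1 hi
      push_cast at h1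
      omega
    · simpa using (Good.evalJet (P.coeff i)).mul hr
  · have hh := hV.h_ne hp
    have hj := hV.jet_ne hp
    rw [Good.eq_div hV hp (h2 x t hp), polyAt_eq_sum j x t P (Nat.lt_succ_self _),
      Finset.sum_div]
    refine Finset.sum_congr rfl fun i _ => ?_
    have e : 2 * (b + 1) + 1 = 2 * b + 3 := by ring
    rw [e, inv_pow, inv_pow]
    field_simp

end MinimalModel

end

/-! ### Formal series with coefficients in a class of functions -/

noncomputable section

namespace MinimalModel

/-- A class of functions on `V` that is closed under the ring operations. -/
structure IsFunAlgebra (V : Set (ℂ × ℂ)) (K : (ℂ → ℂ → ℂ) → Prop) : Prop where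
  congr : ∀ {F G : ℂ → ℂ → ℂ}, K F → (∀ x t, (x, t) ∈ V → G x t = F x t) → K G
  const : ∀ c : ℂ, K (fun _ _ => c)
  add : ∀ {F G : ℂ → ℂ → ℂ}, K F → K G → K (fun x t => F x t + G x t)
  mul : ∀ {F G : ℂ → ℂ → ℂ}, K F → K G → K (fun x t => F x t * G x t)

/-- All coefficients of the formal series `F` belong to the class `K`. -/
def SeriesIn (K : (ℂ → ℂ → ℂ) → Prop) (F : ℂ → ℂ → PowerSeries ℂ) : Prop :=
  ∀ k, K (fun x t => PowerSeries.coeff k (F x t))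

theorem coeff_mul_range (k : ℕ) (F G : PowerSeries ℂ) : PowerSeries.coeff k (F * G)
    = ∑ i ∈ Finset.range (k + 1), PowerSeries.coeff i F * PowerSeries.coeff (k - i) G := by
  rw [PowerSeries.coeff_mul, Finset.Nat.sum_antidiagonal_eq_sum_range_succ_mk]

namespace IsFunAlgebra

variable {V : Set (ℂ × ℂ)} {K : (ℂ → ℂ → ℂ) → Prop} (hK : IsFunAlgebra V K)
include hK

theorem neg {F : ℂ → ℂ → ℂ} (hF : K F) : K (fun x t => -F x t) :=
  hK.congr (hK.mul (hK.const (-1)) hF) fun x t _ => by ring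

theorem sub {F G : ℂ → ℂ → ℂ} (hF : K F) (hG : K G) : K (fun x t => F x t - G x t) :=
  hK.congr (hK.add hF (hK.neg hG)) fun x t _ => by ring

theorem sum {ι : Type*} (s : Finset ι) {F : ι → ℂ → ℂ → ℂ} (hF : ∀ i ∈ s, K (F i)) :
    K (fun x t => ∑ i ∈ s, F i x t) := by
  classical
  induction s using Finset.induction_on with
  | empty => simpa using hK.const 0
  | insert a s ha ih =>
    exact hK.congr (hK.add (hF a (Finset.mem_insert_self _ _))
      (ih fun i hi => hF i (Finset.mem_insert_of_mem hi)))
      fun x t _ => by rw [Finset.sum_insert ha]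

theorem seriesCongr {F G : ℂ → ℂ → PowerSeries ℂ} (hF : SeriesIn K F)
    (hFG : ∀ x t, (x, t) ∈ V → G x t = F x t) : SeriesIn K G := fun k =>
  hK.congr (hF k) fun x t hp => by rw [hFG x t hp]

theorem seriesAdd {F G : ℂ → ℂ → PowerSeries ℂ} (hF : SeriesIn K F) (hG : SeriesIn K G) :
    SeriesIn K (fun x t => F x t + G x t) := fun k =>
  hK.congr (hK.add (hF k) (hG k)) fun _ _ _ => map_add _ _ _

theorem seriesNeg {F : ℂ → ℂ → PowerSeries ℂ} (hF : SeriesIn K F) :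
    SeriesIn K (fun x t => -F x t) := fun k =>
  hK.congr (hK.neg (hF k)) fun _ _ _ => map_neg _ _

theorem seriesSub {F G : ℂ → ℂ → PowerSeries ℂ} (hF : SeriesIn K F) (hG : SeriesIn K G) :
    SeriesIn K (fun x t => F x t - G x t) := fun k =>
  hK.congr (hK.sub (hF k) (hG k)) fun _ _ _ => map_sub _ _ _

theorem seriesMul {F G : ℂ → ℂ → PowerSeries ℂ} (hF : SeriesIn K F) (hG : SeriesIn K G) :
    SeriesIn K (fun x t => F x t * G x t) := fun k =>
  hK.congr (hK.sum (Finset.range (k + 1)) fun i _ => hK.mul (hF i) (hG (k - i)))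
    fun _ _ _ => coeff_mul_range k _ _

theorem seriesC {f : ℂ → ℂ → ℂ} (hf : K f) : SeriesIn K (fun x t => PowerSeries.C (f x t)) := by
  intro k
  rcases k with _ | k
  · exact hK.congr hf fun x t _ => by simp
  · exact hK.congr (hK.const 0) fun x t _ => by simp

theorem seriesConst (F : PowerSeries ℂ) : SeriesIn K (fun _ _ => F) := fun k =>
  hK.const (PowerSeries.coeff k F)

/-- Division by a series with constant coefficient 1 is recursive and requires no inverse in the
class: the k-th coefficient of G is that of FG minus products involving lower coefficients of G. -/
theorem seriesOf_mul {F G : ℂ → ℂ → PowerSeries ℂ} (hF : SeriesIn K F)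
    (hFG : SeriesIn K (fun x t => F x t * G x t))
    (h1 : ∀ x t, (x, t) ∈ V → PowerSeries.constantCoeff (F x t) = 1) : SeriesIn K G := by
  intro k
  induction k using Nat.strong_induction_on with
  | _ k ih =>
    refine hK.congr (hK.sub (hFG k) (hK.sum (Finset.range k)
      (F := fun i x t => PowerSeries.coeff (i + 1) (F x t)
        * PowerSeries.coeff (k - (i + 1)) (G x t))
      fun i hi => hK.mul (hF (i + 1)) (ih _ ?_))) fun x t hp => ?_
    · have := Finset.mem_range.1 hi
      omega
    · rw [coeff_mul_range, Finset.sum_range_succ', PowerSeries.coeff_zero_eq_constantCoeff_apply,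
        h1 x t hp]
      simp

/-- The same recursion for square roots: normalized by its constant coefficient 1, the new
coefficient of F enters that of F² linearly with factor 2. -/
theorem seriesOf_sq {F : ℂ → ℂ → PowerSeries ℂ}
    (hFF : SeriesIn K (fun x t => F x t * F x t))
    (h1 : ∀ x t, (x, t) ∈ V → PowerSeries.constantCoeff (F x t) = 1) : SeriesIn K F := by
  intro k
  induction k using Nat.strong_induction_on with
  | _ k ih =>
    rcases k with _ | k
    · exact hK.congr (hK.const 1) fun x t hp => by simpa using h1 x t hp
    refine hK.congr (hK.mul (hK.const (1 / 2)) (hK.sub (hFF (k + 1)) (hK.sum (Finset.range k)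
      (F := fun i x t => PowerSeries.coeff (i + 1) (F x t)
        * PowerSeries.coeff (k + 1 - (i + 1)) (F x t))
      fun i hi => hK.mul (ih _ ?_) (ih _ ?_)))) fun x t hp => ?_
    · have := Finset.mem_range.1 hi
      omega
    · omega
    · rw [coeff_mul_range, Finset.sum_range_succ', Finset.sum_range_succ,
        PowerSeries.coeff_zero_eq_constantCoeff_apply]
      have e : PowerSeries.coeff (k + 1 - (k + 1)) (F x t) = 1 := by simp [h1 x t hp]
      rw [h1 x t hp, e]
      simp only [Nat.sub_zero]
      ring

end IsFunAlgebra

/-- Functions of `(x,t)` that are holomorphic on `V`. -/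
def Hol (V : Set (ℂ × ℂ)) (F : ℂ → ℂ → ℂ) : Prop :=
  DifferentiableOn ℂ (fun p : ℂ × ℂ => F p.1 p.2) V

theorem isFunAlgebra_hol (V : Set (ℂ × ℂ)) : IsFunAlgebra V (Hol V) where
  congr hF hFG := DifferentiableOn.congr hF fun p hp => hFG p.1 p.2 hp
  const _ := differentiableOn_const _
  add hF hG := DifferentiableOn.fun_add hF hG
  mul hF hG := DifferentiableOn.fun_mul hF hG

theorem CurveDomain.isFunAlgebra_good {V : Set (ℂ × ℂ)} {j : ℂ → ℕ → ℂ} {h : ℂ → ℂ → ℂ}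
    (hV : CurveDomain V j h) : IsFunAlgebra V (Good V j h 0 0) where
  congr hF hFG := hF.congr hFG
  const := Good.const
  add hF hG := hF.add hV hG
  mul hF hG := hF.mul hG

/-! ### Derivatives of formal series -/

/-- The coefficientwise derivative with respect to `x`. -/
def dX (F : ℂ → ℂ → PowerSeries ℂ) (x t : ℂ) : PowerSeries ℂ :=
  PowerSeries.mk fun k => deriv (fun s => PowerSeries.coeff k (F s t)) x

/-- The coefficientwise derivative with respect to `t`. -/
def dT (F : ℂ → ℂ → PowerSeries ℂ) (x t : ℂ) : PowerSeries ℂ :=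
  PowerSeries.mk fun k => deriv (fun s => PowerSeries.coeff k (F x s)) t

section derivatives

variable {V : Set (ℂ × ℂ)} (hVo : IsOpen V) {F G : ℂ → ℂ → PowerSeries ℂ} {x t : ℂ}
  (hp : (x, t) ∈ V)
include hVo hp

theorem SeriesIn.differentiableAt_x (hF : SeriesIn (Hol V) F) (k : ℕ) :
    DifferentiableAt ℂ (fun s => PowerSeries.coeff k (F s t)) x :=
  DifferentiableAt.comp (f := fun s : ℂ => (s, t))
    (g := fun p : ℂ × ℂ => PowerSeries.coeff k (F p.1 p.2)) x
    ((hF k).differentiableAt (hVo.mem_nhds hp)) (by fun_prop)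

theorem SeriesIn.differentiableAt_t (hF : SeriesIn (Hol V) F) (k : ℕ) :
    DifferentiableAt ℂ (fun s => PowerSeries.coeff k (F x s)) t :=
  DifferentiableAt.comp (f := fun s : ℂ => (x, s))
    (g := fun p : ℂ × ℂ => PowerSeries.coeff k (F p.1 p.2)) t
    ((hF k).differentiableAt (hVo.mem_nhds hp)) (by fun_prop)

theorem dX_congr (hFG : ∀ x t, (x, t) ∈ V → F x t = G x t) : dX F x t = dX G x t := by
  have := (Continuous.prodMk_left t).continuousAt.eventually (hVo.mem_nhds hp)
  ext k
  simp only [dX, PowerSeries.coeff_mk]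
  exact Filter.EventuallyEq.deriv_eq (this.mono fun s hs => by
    change (s, t) ∈ V at hs
    simp only [hFG s t hs])

theorem dT_congr (hFG : ∀ x t, (x, t) ∈ V → F x t = G x t) : dT F x t = dT G x t := by
  have := (Continuous.prodMk_right x).continuousAt.eventually (hVo.mem_nhds hp)
  ext k
  simp only [dT, PowerSeries.coeff_mk]
  exact Filter.EventuallyEq.deriv_eq (this.mono fun s hs => by
    change (x, s) ∈ V at hs
    simp only [hFG x s hs])

theorem dX_add (hF : SeriesIn (Hol V) F) (hG : SeriesIn (Hol V) G) :
    dX (fun x t => F x t + G x t) x t = dX F x t + dX G x t := by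
  ext k
  simp only [dX, PowerSeries.coeff_mk, map_add]
  exact deriv_fun_add (hF.differentiableAt_x hVo hp k) (hG.differentiableAt_x hVo hp k)

theorem dT_add (hF : SeriesIn (Hol V) F) (hG : SeriesIn (Hol V) G) :
    dT (fun x t => F x t + G x t) x t = dT F x t + dT G x t := by
  ext k
  simp only [dT, PowerSeries.coeff_mk, map_add]
  exact deriv_fun_add (hF.differentiableAt_t hVo hp k) (hG.differentiableAt_t hVo hp k)

theorem dX_mul (hF : SeriesIn (Hol V) F) (hG : SeriesIn (Hol V) G) :
    dX (fun x t => F x t * G x t) x t = dX F x t * G x t + F x t * dX G x t := by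
  ext k
  simp only [dX, PowerSeries.coeff_mk, map_add, coeff_mul_range]
  rw [deriv_fun_sum fun i _ => (hF.differentiableAt_x hVo hp i).fun_mul
    (hG.differentiableAt_x hVo hp (k - i)), ← Finset.sum_add_distrib]
  exact Finset.sum_congr rfl fun i _ => deriv_fun_mul (hF.differentiableAt_x hVo hp i)
    (hG.differentiableAt_x hVo hp (k - i))

theorem dT_mul (hF : SeriesIn (Hol V) F) (hG : SeriesIn (Hol V) G) :
    dT (fun x t => F x t * G x t) x t = dT F x t * G x t + F x t * dT G x t := by
  ext k
  simp only [dT, PowerSeries.coeff_mk, map_add, coeff_mul_range]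
  rw [deriv_fun_sum fun i _ => (hF.differentiableAt_t hVo hp i).fun_mul
    (hG.differentiableAt_t hVo hp (k - i)), ← Finset.sum_add_distrib]
  exact Finset.sum_congr rfl fun i _ => deriv_fun_mul (hF.differentiableAt_t hVo hp i)
    (hG.differentiableAt_t hVo hp (k - i))

end derivatives

theorem dT_const (F : PowerSeries ℂ) (x t : ℂ) : dT (fun _ _ => F) x t = 0 := by
  ext k; simp [dT]

theorem dX_neg (F : ℂ → ℂ → PowerSeries ℂ) (x t : ℂ) :
    dX (fun x t => -F x t) x t = -dX F x t := by
  ext k; simp [dX]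

theorem dT_neg (F : ℂ → ℂ → PowerSeries ℂ) (x t : ℂ) :
    dT (fun x t => -F x t) x t = -dT F x t := by
  ext k; simp [dT]

/-! ### Series with good coefficients -/

/-- Series all of whose coefficients are good of the same parity and degree. -/
abbrev GoodS (V : Set (ℂ × ℂ)) (j : ℂ → ℕ → ℂ) (h : ℂ → ℂ → ℂ) (e : ℕ) (d : ℤ)
    (F : ℂ → ℂ → PowerSeries ℂ) : Prop :=
  SeriesIn (Good V j h e d) F

theorem Good.deriv_t {V : Set (ℂ × ℂ)} {j : ℂ → ℕ → ℂ} {h : ℂ → ℂ → ℂ} (hV : CurveDomain V j h)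
    {e : ℕ} {d : ℤ} {F : ℂ → ℂ → ℂ} (hF : Good V j h e d F) :
    Good V j h e d (fun x t => deriv (fun s => F x s) t) := by
  obtain ⟨F', h1, h2⟩ := hF.hasDerivAt_t hV
  exact h1.congr fun x t hp => (h2 x t hp).deriv

theorem Good.deriv_x {V : Set (ℂ × ℂ)} {j : ℂ → ℕ → ℂ} {h : ℂ → ℂ → ℂ} (hV : CurveDomain V j h)
    {e : ℕ} {d : ℤ} {F : ℂ → ℂ → ℂ} (hF : Good V j h e d F) :
    Good V j h e (d - 1) (fun x t => deriv (fun s => F s t) x) := by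
  obtain ⟨F', h1, h2⟩ := hF.hasDerivAt_x hV
  exact h1.congr fun x t hp => (h2 x t hp).deriv

/-- Multiplication by a function of degree zero. -/
theorem Good.mul₀ {V : Set (ℂ × ℂ)} {j : ℂ → ℕ → ℂ} {h : ℂ → ℂ → ℂ} {e : ℕ} {d : ℤ}
    {F G : ℂ → ℂ → ℂ} (hF : Good V j h 0 0 F) (hG : Good V j h e d G) :
    Good V j h e d (fun x t => F x t * G x t) := by
  simpa using hF.mul hG

namespace GoodS

variable {V : Set (ℂ × ℂ)} {j : ℂ → ℕ → ℂ} {h : ℂ → ℂ → ℂ} {e e' : ℕ} {d d' : ℤ}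
  {F G : ℂ → ℂ → PowerSeries ℂ}

theorem congr (hF : GoodS V j h e d F) (hFG : ∀ x t, (x, t) ∈ V → G x t = F x t) :
    GoodS V j h e d G := fun k => (hF k).congr fun x t hp => by rw [hFG x t hp]

theorem mono (hF : GoodS V j h e d F) (hd : d ≤ d') : GoodS V j h e d' F := fun k =>
  (hF k).mono hd

theorem neg (hF : GoodS V j h e d F) : GoodS V j h e d (fun x t => -F x t) := fun k =>
  (hF k).neg.congr fun _ _ _ => map_neg _ _

theorem ofC {f : ℂ → ℂ → ℂ} (hf : Good V j h e d f) :
    GoodS V j h e d (fun x t => PowerSeries.C (f x t)) := by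
  intro k
  rcases k with _ | k
  · exact hf.congr fun x t _ => by simp
  · exact Good.zero.congr fun x t _ => by simp

theorem const (c : PowerSeries ℂ) : GoodS V j h 0 0 (fun _ _ => c) := fun _ => Good.const _

theorem cast_even (hF : GoodS V j h (e + 2) d F) : GoodS V j h e d F := fun k => (hF k).cast_even

variable (hV : CurveDomain V j h)
include hV

theorem hol (hF : GoodS V j h e d F) : SeriesIn (Hol V) F := fun k => (hF k).differentiableOn hV

theorem add (hF : GoodS V j h e d F) (hG : GoodS V j h e d G) :
    GoodS V j h e d (fun x t => F x t + G x t) := fun k =>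
  ((hF k).add hV (hG k)).congr fun _ _ _ => map_add _ _ _

theorem sub (hF : GoodS V j h e d F) (hG : GoodS V j h e d G) :
    GoodS V j h e d (fun x t => F x t - G x t) := fun k =>
  ((hF k).sub hV (hG k)).congr fun _ _ _ => map_sub _ _ _

theorem mul (hF : GoodS V j h e d F) (hG : GoodS V j h e' d' G) :
    GoodS V j h (e + e') (d + d') (fun x t => F x t * G x t) := fun k =>
  (Good.sum hV (Finset.range (k + 1)) fun i _ => (hF i).mul (hG (k - i))).congr
    fun _ _ _ => coeff_mul_range k _ _

theorem mul₀ (hF : GoodS V j h 0 0 F) (hG : GoodS V j h e d G) :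
    GoodS V j h e d (fun x t => F x t * G x t) := by
  simpa using GoodS.mul hV hF hG

theorem sum {ι : Type*} (s : Finset ι) {F : ι → ℂ → ℂ → PowerSeries ℂ}
    (hF : ∀ i ∈ s, GoodS V j h e d (F i)) : GoodS V j h e d (fun x t => ∑ i ∈ s, F i x t) :=
  fun k => (Good.sum hV s fun i hi => hF i hi k).congr fun _ _ _ => map_sum _ _ _

theorem dX (hF : GoodS V j h e d F) : GoodS V j h e (d - 1) (dX F) := fun k =>
  ((hF k).deriv_x hV).congr fun x t _ => by simp [MinimalModel.dX]

theorem dT (hF : GoodS V j h e d F) : GoodS V j h e d (dT F) := fun k =>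
  ((hF k).deriv_t hV).congr fun x t _ => by simp [MinimalModel.dT]

end GoodS

end MinimalModel

end

noncomputable section

namespace MinimalModel

/-! ### The domain of the Baker–Akhiezer function -/

section domain

variable {m : ℕ} {τ : ℕ → ℂ} {U : Set ℂ} {u : ℂ → PowerSeries ℂ} {V : Set (ℂ × ℂ)}
  {g : ℂ → ℂ → ℂ}

theorem jet_zero (u : ℂ → PowerSeries ℂ) (t : ℂ) : jet u t 0 = u0 u t := by
  simp [jet]

theorem differentiableOn_iteratedDeriv {f : ℂ → ℂ} (hU : IsOpen U) (hf : DifferentiableOn ℂ f U)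
    (i : ℕ) : DifferentiableOn ℂ (iteratedDeriv i f) U := by
  induction i with
  | zero => simpa using hf
  | succ i ih => rw [iteratedDeriv_succ]; exact ih.deriv hU

/-- The domain of a branch of `((u_0+x)/(u_0-x))^{1/4}`, with the square root of `u_0² - x²` defined
by it. -/
theorem curveDomain (hU : IsOpen U) (hu : IsStringSolution m τ U u) (hV : IsOpen V)
    (hVU : ∀ x t, (x, t) ∈ V → t ∈ U ∧ x ^ 2 ≠ u0 u t ^ 2)
    (hg : DifferentiableOn ℂ (fun p : ℂ × ℂ => g p.1 p.2) V)
    (hg4 : ∀ x t, (x, t) ∈ V → g x t ^ 4 = (u0 u t + x) / (u0 u t - x)) :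
    CurveDomain V (jet u) (rootH u g) := by
  have hne : ∀ x t, (x, t) ∈ V → u0 u t + x ≠ 0 ∧ u0 u t - x ≠ 0 ∧ g x t ≠ 0 := by
    intro x t hp
    have h1 := (hVU x t hp).2
    have a1 : u0 u t + x ≠ 0 := fun h => h1 (by linear_combination (x - u0 u t) * h)
    have a2 : u0 u t - x ≠ 0 := fun h => h1 (by linear_combination (-x - u0 u t) * h)
    refine ⟨a1, a2, fun h => ?_⟩
    have := hg4 x t hp
    rw [h, eq_div_iff a2] at this
    exact a1 (by simpa using this.symm)
  have hu0 : DifferentiableOn ℂ (u0 u) U := by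
    have := hu.differentiableOn 0
    simp only [PowerSeries.coeff_zero_eq_constantCoeff_apply] at this
    exact this
  have hj : ∀ x t, (x, t) ∈ V → ∀ i, HasDerivAt (fun s => jet u s i) (jet u t (i + 1)) t := by
    intro x t hp i
    have := ((differentiableOn_iteratedDeriv hU hu0 i).differentiableAt
      (hU.mem_nhds (hVU x t hp).1)).hasDerivAt
    simpa [jet, iteratedDeriv_succ] using this
  refine ⟨hV, fun {x t} hp => ?_, fun {x t} hp => ?_, fun {x t} hp => ?_, fun {x t} hp => hj x t hp, ?_⟩
  · rw [jet_zero]; exact hu.u0_ne_zero t (hVU x t hp).1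
  · obtain ⟨a1, a2, a3⟩ := hne x t hp
    simp [rootH, zVar, a1, a3]
  · obtain ⟨a1, a2, a3⟩ := hne x t hp
    have h4 := hg4 x t hp
    rw [eq_div_iff a2] at h4
    rw [jet_zero, rootH, zVar]
    field_simp
    linear_combination -(u0 u t + x) * h4
  · have h0 : DifferentiableOn ℂ (fun p : ℂ × ℂ => u0 u p.2) V := fun p hp =>
      (DifferentiableAt.comp (f := fun p : ℂ × ℂ => p.2) (g := u0 u) p
        (hu0.differentiableAt (hU.mem_nhds (hVU p.1 p.2 hp).1))
        differentiableAt_snd).differentiableWithinAt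
    simp only [rootH, zVar, one_div]
    refine DifferentiableOn.fun_mul (h0.fun_add differentiable_fst.differentiableOn)
      (DifferentiableOn.inv (hg.fun_pow 2) fun p hp => pow_ne_zero _ (hne p.1 p.2 hp).2.2)

end domain

/-! ### The coefficients of `u` -/

theorem iterate_dot_succ (u : ℂ → PowerSeries ℂ) (i : ℕ) (t : ℂ) :
    (dot^[i + 1] u) t = dot (dot^[i] u) t := by
  rw [Function.iterate_succ_apply']

theorem coeff_succ_dot (F : ℂ → PowerSeries ℂ) (k : ℕ) (t : ℂ) :
    PowerSeries.coeff (k + 1) (dot F t) = deriv (fun s => PowerSeries.coeff k (F s)) t := by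
  simp [dot, PowerSeries.coeff_succ_X_mul]

theorem constantCoeff_dot (F : ℂ → PowerSeries ℂ) (t : ℂ) :
    PowerSeries.constantCoeff (dot F t) = 0 := by
  simp [dot]

theorem dot_eq (F : ℂ → PowerSeries ℂ) (x t : ℂ) :
    dot F t = PowerSeries.X * dT (fun _ t => F t) x t := rfl

/-- The value of the differential polynomial `p` at the constant function `s`. -/
def leadVal (s : ℂ) (p : DiffPoly) : ℂ := MvPolynomial.aeval (fun i => if i = 0 then s else 0) p

theorem hasDerivAt_leadVal (p : DiffPoly) (s : ℂ) :
    HasDerivAt (fun s => leadVal s p) (leadVal s (MvPolynomial.pderiv 0 p)) s := by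
  induction p using MvPolynomial.induction_on with
  | C a => simpa [leadVal] using hasDerivAt_const s (a : ℂ)
  | add p q hp hq => simpa [leadVal] using hp.fun_add hq
  | mul_X p i hp =>
    have hX : HasDerivAt (fun s : ℂ => if i = 0 then s else 0) (if i = 0 then 1 else 0) s := by
      split_ifs
      · exact hasDerivAt_id' s
      · exact hasDerivAt_const s 0
    have := hp.fun_mul hX
    simp only [leadVal, map_mul, MvPolynomial.aeval_X, Derivation.leibniz, smul_eq_mul, map_add]
      at this ⊢
    refine this.congr_deriv ?_
    rw [MvPolynomial.pderiv_X]
    rcases eq_or_ne i 0 with rfl | hi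
    · simp; ring
    · simp [hi]

/-- Every `dot` carries a factor 1/N, so at leading order only undifferentiated u survives. -/
theorem constantCoeff_evalDiff (u : ℂ → PowerSeries ℂ) (p : DiffPoly) (t : ℂ) :
    PowerSeries.constantCoeff (evalDiff u p t) = leadVal (u0 u t) p := by
  induction p using MvPolynomial.induction_on with
  | C a =>
    simp only [evalDiff, leadVal, MvPolynomial.algHom_C]
    rw [IsScalarTower.algebraMap_apply ℚ ℂ (PowerSeries ℂ)]
    simp
  | add p q hp hq =>
    simp only [evalDiff, leadVal, map_add] at hp hq ⊢
    rw [hp, hq]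
  | mul_X p i hp =>
    simp only [evalDiff, leadVal, map_mul, MvPolynomial.aeval_X] at hp ⊢
    rw [hp]
    rcases i with _ | i
    · simp [u0]
    · rw [iterate_dot_succ, constantCoeff_dot]; simp

section coefficients

variable {V : Set (ℂ × ℂ)} {j : ℂ → ℕ → ℂ} {h : ℂ → ℂ → ℂ} (hV : CurveDomain V j h)
  (u : ℂ → PowerSeries ℂ)
include hV

/-- Each `dot` shifts the order by one. Hence the coefficient of order k of a proper derivative of u
involves only coefficients of u of order below k. -/
theorem good_coeff_iterate_dot {k : ℕ}
    (hu : ∀ i < k, Good V j h 0 0 (fun _ t => PowerSeries.coeff i (u t))) (n : ℕ) :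
    (∀ i < k, Good V j h 0 0 (fun _ t => PowerSeries.coeff i ((dot^[n] u) t))) ∧
    Good V j h 0 0 (fun _ t => PowerSeries.coeff k ((dot^[n + 1] u) t)) := by
  have step : ∀ n, (∀ i < k, Good V j h 0 0 (fun _ t => PowerSeries.coeff i ((dot^[n] u) t))) →
      ∀ i < k + 1, Good V j h 0 0 (fun _ t => PowerSeries.coeff i ((dot^[n + 1] u) t)) := by
    intro n hn i hi
    rcases i with _ | i
    · refine Good.zero.congr fun x t _ => ?_
      rw [iterate_dot_succ, PowerSeries.coeff_zero_eq_constantCoeff_apply, constantCoeff_dot]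
    · refine ((hn i (by omega)).deriv_t hV).congr fun x t _ => ?_
      rw [iterate_dot_succ, coeff_succ_dot]
  induction n with
  | zero => exact ⟨by simpa using hu, step 0 (by simpa using hu) k (by omega)⟩
  | succ n ih =>
    have h1 : ∀ i < k, Good V j h 0 0 (fun _ t => PowerSeries.coeff i ((dot^[n + 1] u) t)) :=
      fun i hi => step n ih.1 i (by omega)
    exact ⟨h1, step (n + 1) h1 k (by omega)⟩

theorem good_leadVal (p : DiffPoly) : Good V j h 0 0 (fun _ t => leadVal (j t 0) p) := by
  induction p using MvPolynomial.induction_on with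
  | C a => exact (Good.const (a : ℂ)).congr fun x t _ => by simp [leadVal]
  | add p q hp hq => exact (hp.add hV hq).congr fun x t _ => by simp [leadVal]
  | mul_X p i hp =>
    rcases i with _ | i
    · exact (hp.mul (Good.jet 0)).congr fun x t _ => by simp [leadVal]
    · exact Good.zero.congr fun x t _ => by simp [leadVal]

/-- The coefficient of order `k` of a differential polynomial in `u` depends linearly on `u_k`, up
to terms of lower order. -/
theorem good_coeff_evalDiff (hj : ∀ x t, (x, t) ∈ V → j t 0 = u0 u t) {k : ℕ}
    (hu : ∀ i < k + 1, Good V j h 0 0 (fun _ t => PowerSeries.coeff i (u t))) (p : DiffPoly) :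
    (∀ i < k + 1, Good V j h 0 0 (fun _ t => PowerSeries.coeff i (evalDiff u p t))) ∧
    Good V j h 0 0 (fun _ t => PowerSeries.coeff (k + 1) (evalDiff u p t)
      - leadVal (j t 0) (MvPolynomial.pderiv 0 p) * PowerSeries.coeff (k + 1) (u t)) := by
  induction p using MvPolynomial.induction_on with
  | C a =>
    have e : ∀ t, evalDiff u (MvPolynomial.C a) t = PowerSeries.C (a : ℂ) := fun t => by
      simp only [evalDiff, MvPolynomial.algHom_C]
      rw [IsScalarTower.algebraMap_apply ℚ ℂ (PowerSeries ℂ)]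
      rfl
    refine ⟨fun i _ => (Good.const (PowerSeries.coeff i (PowerSeries.C (a : ℂ)))).congr
      fun x t _ => by rw [e], Good.zero.congr fun x t _ => ?_⟩
    rw [e]; simp [leadVal]
  | add p q hp hq =>
    have e : ∀ t, evalDiff u (p + q) t = evalDiff u p t + evalDiff u q t := fun t => by
      simp [evalDiff]
    refine ⟨fun i hi => ((hp.1 i hi).add hV (hq.1 i hi)).congr fun x t _ => by rw [e, map_add],
      (hp.2.add hV hq.2).congr fun x t _ => ?_⟩
    rw [e, map_add, map_add]
    simp only [leadVal, map_add]
    ring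
  | mul_X p n hp =>
    have e : ∀ t, evalDiff u (p * MvPolynomial.X n) t = evalDiff u p t * (dot^[n] u) t := fun t => by
      simp [evalDiff]
    have hd := good_coeff_iterate_dot hV u hu
    refine ⟨fun i hi => (Good.sum hV (Finset.range (i + 1)) fun l hl =>
      (hp.1 l (by have := Finset.mem_range.1 hl; omega)).mul₀
        ((hd n).1 (i - l) (by omega))).congr fun x t _ => by rw [e, coeff_mul_range], ?_⟩
    have mid : Good V j h 0 0 (fun _ t => ∑ l ∈ Finset.range k,
        PowerSeries.coeff (l + 1) (evalDiff u p t)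
          * PowerSeries.coeff (k + 1 - (l + 1)) ((dot^[n] u) t)) := by
      refine Good.sum hV (Finset.range k) (F := fun l _ t =>
        PowerSeries.coeff (l + 1) (evalDiff u p t)
          * PowerSeries.coeff (k + 1 - (l + 1)) ((dot^[n] u) t)) fun l hl => ?_
      have := Finset.mem_range.1 hl
      simpa using (hp.1 (l + 1) (by omega)).mul ((hd n).1 (k + 1 - (l + 1)) (by omega))
    have hsum : ∀ t, PowerSeries.coeff (k + 1) (evalDiff u (p * MvPolynomial.X n) t)
        = (∑ l ∈ Finset.range k, PowerSeries.coeff (l + 1) (evalDiff u p t)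
          * PowerSeries.coeff (k + 1 - (l + 1)) ((dot^[n] u) t))
        + PowerSeries.coeff (k + 1) (evalDiff u p t)
          * PowerSeries.constantCoeff ((dot^[n] u) t)
        + leadVal (u0 u t) p * PowerSeries.coeff (k + 1) ((dot^[n] u) t) := fun t => by
      rw [e, coeff_mul_range, Finset.sum_range_succ', Finset.sum_range_succ]
      simp [constantCoeff_evalDiff]
    -- For n = 0 the coefficient u_{k+1} enters through both factors, which is the product rule for
    -- ∂/∂u. For n > 0 the derivative of u has no leading coefficient, and its coefficient of order
    -- k + 1 involves only lower coefficients of u.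
    rcases n with _ | n
    · refine (mid.add hV (hp.2.mul (Good.jet 0))).congr fun x t hp' => ?_
      rw [hsum, ← hj x t hp']
      have e0 : PowerSeries.constantCoeff ((dot^[0] u) t) = j t 0 := by
        rw [hj x t hp']; rfl
      have e1 : leadVal (j t 0) (MvPolynomial.pderiv 0 (p * MvPolynomial.X 0))
          = leadVal (j t 0) (MvPolynomial.pderiv 0 p) * j t 0 + leadVal (j t 0) p := by
        simp [leadVal, Derivation.leibniz]; ring
      rw [e0, e1]
      simp only [Function.iterate_zero, id_eq]
      ring
    · have h2 : Good V j h 0 0 (fun _ t => leadVal (j t 0) p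
          * PowerSeries.coeff (k + 1) ((dot^[n + 1] u) t)) := by
        simpa using (good_leadVal hV p).mul (hd n).2
      refine (mid.add hV h2).congr fun x t hp' => ?_
      rw [hsum, ← hj x t hp']
      have e0 : PowerSeries.constantCoeff ((dot^[n + 1] u) t) = 0 := by
        rw [iterate_dot_succ, constantCoeff_dot]
      have e1 : leadVal (j t 0) (MvPolynomial.pderiv 0 (p * MvPolynomial.X (n + 1))) = 0 := by
        simp [leadVal, Derivation.leibniz]
      rw [e0, e1]
      ring

end coefficients

section string

variable {m : ℕ} {τ : ℕ → ℂ} {U : Set ℂ} {u : ℂ → PowerSeries ℂ} {V : Set (ℂ × ℂ)}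
  {h : ℂ → ℂ → ℂ}

theorem IsStringSolution.leading (hu : IsStringSolution m τ U u) {t : ℂ} (ht : t ∈ U) :
    ∑ k ∈ Finset.range (m + 1), τ k * leadVal (u0 u t) (gdHat k) = -(t * u0 u t) := by
  have := congrArg PowerSeries.constantCoeff (hu.string_eq t ht)
  simpa [constantCoeff_evalDiff, u0] using this

variable (hV : CurveDomain V (jet u) h) (hu : IsStringSolution m τ U u) (hU : IsOpen U)
  (hVU : ∀ x t, (x, t) ∈ V → t ∈ U)
include hV hu hU hVU

/-- The t-derivative of the leading string equation. As u_0 ≠ 0, it shows that the factor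
multiplying the unknown coefficient in the higher-order equations is invertible, with inverse
-u_0'/u_0. -/
theorem IsStringSolution.deriv_leading {x t : ℂ} (hp : (x, t) ∈ V) :
    (∑ k ∈ Finset.range (m + 1), τ k * leadVal (u0 u t) (MvPolynomial.pderiv 0 (gdHat k)) + t)
      * jet u t 1 = -u0 u t := by
  have h0 : HasDerivAt (u0 u) (jet u t 1) t := by
    simpa [jet] using hV.jet_deriv hp 0
  have h1 : HasDerivAt
      (fun s => ∑ k ∈ Finset.range (m + 1), τ k * leadVal (u0 u s) (gdHat k)) _ t :=
    HasDerivAt.fun_sum fun k _ => ((hasDerivAt_leadVal (gdHat k) (u0 u t)).comp t h0).const_mul (τ k)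
  have h2 : HasDerivAt (fun s => -(s * u0 u s)) _ t := ((hasDerivAt_id' t).fun_mul h0).fun_neg
  have h3 := (h2.congr_of_eventuallyEq
    (f₁ := fun s => ∑ k ∈ Finset.range (m + 1), τ k * leadVal (u0 u s) (gdHat k))
    (Filter.eventually_of_mem (hU.mem_nhds (hVU x t hp)) fun s hs => hu.leading hs)).unique h1
  rw [add_mul, Finset.sum_mul]
  simp only [mul_assoc]
  linear_combination -h3

-- The leading string equation, solved for t: t is itself a rational function of u_0.
omit hU in
theorem IsStringSolution.good_t : Good V (jet u) h 0 0 (fun _ t => t) := by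
  have h1 : Good V (jet u) h 0 0 (fun _ t => -(∑ k ∈ Finset.range (m + 1),
      τ k * leadVal (jet u t 0) (gdHat k)) * (jet u t 0)⁻¹) := by
    exact (Good.neg (Good.sum hV _ (F := fun k _ t => τ k * leadVal (jet u t 0) (gdHat k))
      fun k _ => (Good.const (τ k)).mul₀ (good_leadVal hV (gdHat k)))).mul₀ (Good.inv_jet hV)
  refine h1.congr fun x t hp => ?_
  have h0 := hV.jet_ne hp
  rw [jet_zero] at h0
  rw [jet_zero, hu.leading (hVU x t hp)]
  field_simp

/-- The coefficients of `u` are rational in the jet of `u_0`. -/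
theorem IsStringSolution.good_u : GoodS V (jet u) h 0 0 (fun _ t => u t) := by
  have hj : ∀ x t, (x, t) ∈ V → jet u t 0 = u0 u t := fun _ t _ => jet_zero u t
  intro k
  induction k using Nat.strong_induction_on with
  | _ k ih =>
    rcases k with _ | k
    · exact (Good.jet 0).congr fun x t hp => by simp [jet_zero, u0]
    -- At order k + 1 the string equation says that (∑ t_n ∂R̂_n(u_0) + t) u_{k+1} is minus the sum
    -- of the lower-order terms. By `deriv_leading` the bracket has inverse -u_0'/u_0.
    have hG : Good V (jet u) h 0 0 (fun _ t => jet u t 1 * (jet u t 0)⁻¹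
        * ∑ n ∈ Finset.range (m + 1), τ n * (PowerSeries.coeff (k + 1) (evalDiff u (gdHat n) t)
          - leadVal (jet u t 0) (MvPolynomial.pderiv 0 (gdHat n))
            * PowerSeries.coeff (k + 1) (u t))) := by
      exact ((Good.jet 1).mul₀ (Good.inv_jet hV)).mul₀ (Good.sum hV _ (F := fun n _ t =>
        τ n * (PowerSeries.coeff (k + 1) (evalDiff u (gdHat n) t)
          - leadVal (jet u t 0) (MvPolynomial.pderiv 0 (gdHat n))
            * PowerSeries.coeff (k + 1) (u t))) fun n _ =>
        (Good.const (τ n)).mul₀ (good_coeff_evalDiff hV u hj ih (gdHat n)).2)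
    refine hG.congr fun x t hp => ?_
    have h0 := hV.jet_ne hp
    have e1 := congrArg (PowerSeries.coeff (k + 1)) (hu.string_eq t (hVU x t hp))
    have e2 := hu.deriv_leading hV hU hVU hp
    simp only [map_sum, PowerSeries.coeff_C_mul, map_neg] at e1
    rw [jet_zero] at h0 ⊢
    simp only [mul_sub, Finset.sum_sub_distrib]
    rw [e1]
    have e3 : ∑ n ∈ Finset.range (m + 1), τ n * (leadVal (u0 u t) (MvPolynomial.pderiv 0 (gdHat n))
        * PowerSeries.coeff (k + 1) (u t))
        = (∑ n ∈ Finset.range (m + 1), τ n * leadVal (u0 u t) (MvPolynomial.pderiv 0 (gdHat n)))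
          * PowerSeries.coeff (k + 1) (u t) := by
      rw [Finset.sum_mul]; exact Finset.sum_congr rfl fun n _ => by ring
    rw [e3]
    field_simp
    linear_combination PowerSeries.coeff (k + 1) (u t) * e2

theorem IsStringSolution.goodS_evalDiff (p : DiffPoly) :
    GoodS V (jet u) h 0 0 (fun _ t => evalDiff u p t) := by
  intro k
  exact (good_coeff_evalDiff hV u (fun _ t _ => jet_zero u t)
    (k := k) (fun i _ => hu.good_u hV hU hVU i) p).1 k (Nat.lt_succ_self k)

theorem IsStringSolution.goodS_dot_evalDiff (p : DiffPoly) :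
    GoodS V (jet u) h 0 0 (fun _ t => dot (evalDiff u p) t) :=
  ((GoodS.const PowerSeries.X).mul hV ((hu.goodS_evalDiff hV hU hVU p).dT hV)).congr
    fun _ _ _ => rfl

end string

end MinimalModel

end

/-! ### The wave matrix and its Lax equations -/

noncomputable section

namespace MinimalModel

/-- `Ψ` is the amplitude of a solution of the system `N⁻¹ ∂Ψ/∂x = D Ψ`, `N⁻¹ ∂Ψ/∂t = ℛ Ψ` of
determinant `1`, with exponential factors governed by `y` and `h`. -/
structure IsWave (V : Set (ℂ × ℂ)) (u : ℂ → PowerSeries ℂ) (h y : ℂ → ℂ → ℂ)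
    (D Ψ : FormalMatrix) : Prop where
  isOpen : IsOpen V
  hol : ∀ i j, SeriesIn (Hol V) (fun x t => Ψ x t i j)
  det : ∀ {x t}, (x, t) ∈ V → Ψ x t 0 0 * Ψ x t 1 1 - Ψ x t 0 1 * Ψ x t 1 0 = 1
  trace : ∀ {x t}, (x, t) ∈ V → D x t 1 1 = -D x t 0 0
  eqT00 : ∀ {x t}, (x, t) ∈ V → PowerSeries.X * dT (fun x t => Ψ x t 0 0) x t
    = (PowerSeries.C x + u t) * Ψ x t 1 0 - PowerSeries.C (h x t) * Ψ x t 0 0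
  eqT01 : ∀ {x t}, (x, t) ∈ V → PowerSeries.X * dT (fun x t => Ψ x t 0 1) x t
    = (PowerSeries.C x + u t) * Ψ x t 1 1 + PowerSeries.C (h x t) * Ψ x t 0 1
  eqT10 : ∀ {x t}, (x, t) ∈ V → PowerSeries.X * dT (fun x t => Ψ x t 1 0) x t
    = (u t - PowerSeries.C x) * Ψ x t 0 0 - PowerSeries.C (h x t) * Ψ x t 1 0
  eqT11 : ∀ {x t}, (x, t) ∈ V → PowerSeries.X * dT (fun x t => Ψ x t 1 1) x t
    = (u t - PowerSeries.C x) * Ψ x t 0 1 + PowerSeries.C (h x t) * Ψ x t 1 1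
  eqX0 : ∀ {x t} i, (x, t) ∈ V → PowerSeries.X * dX (fun x t => Ψ x t i 0) x t
    = D x t i 0 * Ψ x t 0 0 + D x t i 1 * Ψ x t 1 0 - PowerSeries.C (y x t) * Ψ x t i 0
  eqX1 : ∀ {x t} i, (x, t) ∈ V → PowerSeries.X * dX (fun x t => Ψ x t i 1) x t
    = D x t i 0 * Ψ x t 0 1 + D x t i 1 * Ψ x t 1 1 + PowerSeries.C (y x t) * Ψ x t i 1

theorem laxD_trace (m : ℕ) (τ : ℕ → ℂ) (u : ℂ → PowerSeries ℂ) (x t : ℂ) :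
    laxD m τ u x t 1 1 = -laxD m τ u x t 0 0 := by
  simp [laxD, laxDk, Matrix.sum_apply, add_comm]

theorem isWave_amplitude {m : ℕ} {τ : ℕ → ℂ} {u : ℂ → PowerSeries ℂ} {V : Set (ℂ × ℂ)}
    (hV : IsOpen V) {g : ℂ → ℂ → ℂ} {a : FormalMatrix} (hBA : IsBakerAkhiezer m τ u V g a)
    (hg : ∀ x t, (x, t) ∈ V → g x t ≠ 0) :
    IsWave V u (rootH u g) (yLax m τ u g) (laxD m τ u) (amplitude g a) := by
  have hGhol : Hol V g := hBA.g_differentiableOn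
  have hGinv : Hol V (fun x t => (g x t)⁻¹) :=
    DifferentiableOn.inv hGhol fun p hp => hg p.1 p.2 hp
  have H := isFunAlgebra_hol V
  have ha : ∀ i j, SeriesIn (Hol V) (fun x t => a x t i j) := hBA.differentiableOn
  have hT := fun {x t} (hp : (x, t) ∈ V) i j => congrFun (congrFun (hBA.eq_t x t hp) i) j
  have hX := fun {x t} (hp : (x, t) ∈ V) i j => congrFun (congrFun (hBA.eq_x x t hp) i) j
  simp only [waveT, waveX, Matrix.add_apply, Matrix.smul_apply, smul_eq_mul, Matrix.mul_apply,
    Fin.sum_univ_two] at hT hX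
  have hsT : ∀ x t i j, partialT (amplitude g a) x t i j
      = dT (fun x t => amplitude g a x t i j) x t := fun _ _ _ _ => rfl
  have hsX : ∀ x t i j, partialX (amplitude g a) x t i j
      = dX (fun x t => amplitude g a x t i j) x t := fun _ _ _ _ => rfl
  simp only [hsT, hsX] at hT hX
  have d00 : ∀ c, diagPM c 0 0 = PowerSeries.C c := fun _ => rfl
  have d01 : ∀ c, diagPM c 0 1 = 0 := fun _ => rfl
  have d10 : ∀ c, diagPM c 1 0 = 0 := fun _ => rfl
  have d11 : ∀ c, diagPM c 1 1 = -PowerSeries.C c := fun _ => rfl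
  have r00 : ∀ x t, laxR u x t 0 0 = 0 := fun _ _ => rfl
  have r01 : ∀ x t, laxR u x t 0 1 = PowerSeries.C x + u t := fun _ _ => rfl
  have r10 : ∀ x t, laxR u x t 1 0 = -PowerSeries.C x + u t := fun _ _ => rfl
  have r11 : ∀ x t, laxR u x t 1 1 = 0 := fun _ _ => rfl
  refine ⟨hV, fun i j => ?_, fun {x t} hp => ?_, fun {x t} _ => laxD_trace m τ u x t,
    fun {x t} hp => ?_, fun {x t} hp => ?_, fun {x t} hp => ?_, fun {x t} hp => ?_,
    fun {x t} i hp => ?_, fun {x t} i hp => ?_⟩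
  · fin_cases i <;> fin_cases j
    · exact H.seriesMul (H.seriesC (H.congr (H.mul hGhol (H.const ((√2 : ℝ) : ℂ)⁻¹))
        fun x t _ => div_eq_mul_inv _ _)) (ha 0 0)
    · exact H.seriesMul (H.seriesC (H.neg (H.congr (H.mul hGhol (H.const ((√2 : ℝ) : ℂ)⁻¹))
        fun x t _ => div_eq_mul_inv _ _))) (ha 0 1)
    · exact H.seriesMul (H.seriesC (H.congr (H.mul hGinv (H.const ((√2 : ℝ) : ℂ)⁻¹))
        fun x t _ => div_eq_mul_inv _ _)) (ha 1 0)
    · exact H.seriesMul (H.seriesC (H.congr (H.mul hGinv (H.const ((√2 : ℝ) : ℂ)⁻¹))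
        fun x t _ => div_eq_mul_inv _ _)) (ha 1 1)
  · have := hBA.det_eq_one x t hp
    rwa [Matrix.det_fin_two] at this
  · have := hT hp 0 0
    rw [d00, d10, r00, r01] at this
    linear_combination this
  · have := hT hp 0 1
    rw [d01, d11, r00, r01] at this
    linear_combination this
  · have := hT hp 1 0
    rw [d00, d10, r10, r11] at this
    linear_combination this
  · have := hT hp 1 1
    rw [d01, d11, r10, r11] at this
    linear_combination this
  · have := hX hp i 0
    rw [d00, d10] at this
    linear_combination this
  · have := hX hp i 1
    rw [d01, d11] at this
    linear_combination this

/-! ### The traceless matrix `S = Ψ diag(1,-1) Ψ⁻¹ = !![A, B + C; B - C, -A]` -/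

/-- The diagonal entry of `S`. -/
def sA (Ψ : FormalMatrix) (x t : ℂ) : PowerSeries ℂ := Ψ x t 0 0 * Ψ x t 1 1 + Ψ x t 0 1 * Ψ x t 1 0

/-- The symmetric off-diagonal part of `S`. -/
def sB (Ψ : FormalMatrix) (x t : ℂ) : PowerSeries ℂ := Ψ x t 1 0 * Ψ x t 1 1 - Ψ x t 0 0 * Ψ x t 0 1

/-- The antisymmetric off-diagonal part of `S`. -/
def sC (Ψ : FormalMatrix) (x t : ℂ) : PowerSeries ℂ :=
  -(Ψ x t 1 0 * Ψ x t 1 1) - Ψ x t 0 0 * Ψ x t 0 1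

namespace IsWave

variable {V : Set (ℂ × ℂ)} {u : ℂ → PowerSeries ℂ} {h y : ℂ → ℂ → ℂ}
    {D Ψ : FormalMatrix} (W : IsWave V u h y D Ψ)
include W

theorem hol_mul (i j k l : Fin 2) : SeriesIn (Hol V) (fun x t => Ψ x t i j * Ψ x t k l) :=
  (isFunAlgebra_hol V).seriesMul (W.hol i j) (W.hol k l)

variable {x t : ℂ} (hp : (x, t) ∈ V)
include hp

theorem dT_mul (i j k l : Fin 2) : dT (fun x t => Ψ x t i j * Ψ x t k l) x t
    = dT (fun x t => Ψ x t i j) x t * Ψ x t k l + Ψ x t i j * dT (fun x t => Ψ x t k l) x t :=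
  MinimalModel.dT_mul W.isOpen hp (W.hol i j) (W.hol k l)

theorem dX_mul (i j k l : Fin 2) : dX (fun x t => Ψ x t i j * Ψ x t k l) x t
    = dX (fun x t => Ψ x t i j) x t * Ψ x t k l + Ψ x t i j * dX (fun x t => Ψ x t k l) x t :=
  MinimalModel.dX_mul W.isOpen hp (W.hol i j) (W.hol k l)

theorem dT_sA_eq : dT (sA Ψ) x t = dT (fun x t => Ψ x t 0 0 * Ψ x t 1 1) x t
    + dT (fun x t => Ψ x t 0 1 * Ψ x t 1 0) x t :=
  dT_add W.isOpen hp (W.hol_mul 0 0 1 1) (W.hol_mul 0 1 1 0)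

theorem dX_sA_eq : dX (sA Ψ) x t = dX (fun x t => Ψ x t 0 0 * Ψ x t 1 1) x t
    + dX (fun x t => Ψ x t 0 1 * Ψ x t 1 0) x t :=
  dX_add W.isOpen hp (W.hol_mul 0 0 1 1) (W.hol_mul 0 1 1 0)

theorem dX_sB_eq : dX (sB Ψ) x t = dX (fun x t => Ψ x t 1 0 * Ψ x t 1 1) x t
    - dX (fun x t => Ψ x t 0 0 * Ψ x t 0 1) x t := by
  have := dX_add W.isOpen hp (W.hol_mul 1 0 1 1)
    ((isFunAlgebra_hol V).seriesNeg (W.hol_mul 0 0 0 1))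
  rw [dX_neg] at this
  rw [sub_eq_add_neg, ← this]
  congr 1

theorem dT_sC_eq : dT (sC Ψ) x t = -dT (fun x t => Ψ x t 1 0 * Ψ x t 1 1) x t
    - dT (fun x t => Ψ x t 0 0 * Ψ x t 0 1) x t := by
  have := dT_add W.isOpen hp ((isFunAlgebra_hol V).seriesNeg (W.hol_mul 1 0 1 1))
    ((isFunAlgebra_hol V).seriesNeg (W.hol_mul 0 0 0 1))
  rw [dT_neg, dT_neg] at this
  rw [sub_eq_add_neg, ← this]
  congr 1

theorem dX_sC_eq : dX (sC Ψ) x t = -dX (fun x t => Ψ x t 1 0 * Ψ x t 1 1) x t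
    - dX (fun x t => Ψ x t 0 0 * Ψ x t 0 1) x t := by
  have := dX_add W.isOpen hp ((isFunAlgebra_hol V).seriesNeg (W.hol_mul 1 0 1 1))
    ((isFunAlgebra_hol V).seriesNeg (W.hol_mul 0 0 0 1))
  rw [dX_neg, dX_neg] at this
  rw [sub_eq_add_neg, ← this]
  congr 1

/-- An entry of N⁻¹ ∂_t S = [ℛ, S]; `dT_sC` is another, and the `dX` statements are the entries of
N⁻¹ ∂_x S = [𝒟, S]. The exponential factors commute with diag(1,-1) and leave no trace. -/
theorem dT_sA : PowerSeries.X * dT (sA Ψ) x t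
    = 2 * (PowerSeries.C x * sB Ψ x t - u t * sC Ψ x t) := by
  rw [W.dT_sA_eq hp, W.dT_mul hp, W.dT_mul hp, sB, sC]
  linear_combination Ψ x t 1 1 * W.eqT00 hp + Ψ x t 0 0 * W.eqT11 hp + Ψ x t 1 0 * W.eqT01 hp
    + Ψ x t 0 1 * W.eqT10 hp

theorem dT_sC : PowerSeries.X * dT (sC Ψ) x t = -(2 * (u t * sA Ψ x t)) := by
  rw [W.dT_sC_eq hp, W.dT_mul hp, W.dT_mul hp, sA]
  linear_combination -Ψ x t 1 1 * W.eqT10 hp - Ψ x t 1 0 * W.eqT11 hp - Ψ x t 0 1 * W.eqT00 hp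
    - Ψ x t 0 0 * W.eqT01 hp

theorem dX_sA : PowerSeries.X * dX (sA Ψ) x t
    = D x t 0 1 * (sB Ψ x t - sC Ψ x t) - D x t 1 0 * (sB Ψ x t + sC Ψ x t) := by
  rw [W.dX_sA_eq hp, W.dX_mul hp, W.dX_mul hp, sB, sC]
  linear_combination Ψ x t 1 1 * W.eqX0 0 hp + Ψ x t 0 0 * W.eqX1 1 hp + Ψ x t 1 0 * W.eqX1 0 hp
    + Ψ x t 0 1 * W.eqX0 1 hp
    + (Ψ x t 0 0 * Ψ x t 1 1 + Ψ x t 0 1 * Ψ x t 1 0) * W.trace hp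

theorem dX_sB : PowerSeries.X * dX (sB Ψ) x t
    = 2 * (D x t 0 0 * sC Ψ x t) + (D x t 1 0 - D x t 0 1) * sA Ψ x t := by
  rw [W.dX_sB_eq hp, W.dX_mul hp, W.dX_mul hp, sA, sC]
  linear_combination Ψ x t 1 1 * W.eqX0 1 hp + Ψ x t 1 0 * W.eqX1 1 hp - Ψ x t 0 1 * W.eqX0 0 hp
    - Ψ x t 0 0 * W.eqX1 0 hp + 2 * (Ψ x t 1 0 * Ψ x t 1 1) * W.trace hp

theorem dX_sC : PowerSeries.X * dX (sC Ψ) x t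
    = 2 * (D x t 0 0 * sB Ψ x t) - (D x t 1 0 + D x t 0 1) * sA Ψ x t := by
  rw [W.dX_sC_eq hp, W.dX_mul hp, W.dX_mul hp, sA, sB]
  linear_combination -Ψ x t 1 1 * W.eqX0 1 hp - Ψ x t 1 0 * W.eqX1 1 hp - Ψ x t 0 1 * W.eqX0 0 hp
    - Ψ x t 0 0 * W.eqX1 0 hp - 2 * (Ψ x t 1 0 * Ψ x t 1 1) * W.trace hp

/-- This is S² = 1, which holds because diag(1,-1)² = 1. It is the algebraic relation that makes a
differential equation for B superfluous. -/
theorem sq_eq_one : sA Ψ x t * sA Ψ x t + sB Ψ x t * sB Ψ x t - sC Ψ x t * sC Ψ x t = 1 := by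
  rw [sA, sB, sC]
  linear_combination (Ψ x t 0 0 * Ψ x t 1 1 - Ψ x t 0 1 * Ψ x t 1 0 + 1) * W.det hp

end IsWave

/-! ### The coefficients of `S` -/

/-- The coefficients of `S` are odd, and bounded at infinity. -/
theorem IsWave.good_S {V : Set (ℂ × ℂ)} {u : ℂ → PowerSeries ℂ} {h y : ℂ → ℂ → ℂ}
    {D Ψ : FormalMatrix} (W : IsWave V u h y D Ψ) {j : ℂ → ℕ → ℂ} (hV : CurveDomain V j h)
    (hu : GoodS V j h 0 0 (fun _ t => u t))
    (hj : ∀ x t, (x, t) ∈ V → PowerSeries.constantCoeff (u t) = j t 0)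
    (hA : ∀ x t, (x, t) ∈ V → PowerSeries.constantCoeff (sA Ψ x t) = 0)
    (hB : ∀ x t, (x, t) ∈ V → PowerSeries.constantCoeff (sB Ψ x t) = j t 0 * (h x t)⁻¹)
    (hC : ∀ x t, (x, t) ∈ V → PowerSeries.constantCoeff (sC Ψ x t) = x * (h x t)⁻¹) (k : ℕ) :
    Good V j h 1 (-2) (fun x t => PowerSeries.coeff k (sA Ψ x t)) ∧
    Good V j h 1 (-1) (fun x t => PowerSeries.coeff k (sB Ψ x t)) ∧
    Good V j h 1 (if k = 0 then 0 else -2) (fun x t => PowerSeries.coeff k (sC Ψ x t)) := by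
  have hC0 : Good V j h 1 0 (fun x t => x * (h x t)⁻¹) := Good.x.mul (Good.inv_sqrt hV)
  induction k using Nat.strong_induction_on with
  | _ k ih =>
    rcases k with _ | k
    · refine ⟨Good.zero.congr fun x t hp => ?_,
        ((Good.jet 0).mul₀ (Good.inv_sqrt hV)).congr fun x t hp => ?_, ?_⟩
      · simpa using hA x t hp
      · simpa using hB x t hp
      · simp only [if_true]
        exact hC0.congr fun x t hp => by simpa using hC x t hp
    have ihC : ∀ i < k + 1, Good V j h 1 0 (fun x t => PowerSeries.coeff i (sC Ψ x t)) :=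
      fun i hi => (ih i hi).2.2.mono (by split_ifs <;> norm_num)
    -- the derivative of the preceding coefficient of `C`
    have dC : Good V j h 1 (-2)
        (fun x t => deriv (fun s => PowerSeries.coeff k (sC Ψ x s)) t) := by
      rcases k with _ | k
      -- The leading term x/h of C is merely bounded at infinity, but its limit there does not
      -- depend on t, so its t-derivative is of degree -2.
      · have : Good V j h 3 (-2) (fun x t => -(x * (j t 0 * (j t 1 * (h x t)⁻¹ ^ 3)))) :=
          Good.neg (Good.x.mul ((Good.jet 0).mul₀ ((Good.jet 1).mul₀ (Good.pow_inv_sqrt hV 3))))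
        refine (Good.cast_even (e := 1) this).congr fun x t hp => ?_
        have h1 : HasDerivAt (fun s => x * (h x s)⁻¹) _ t :=
          ((hV.hasDerivAt_h_t hp).fun_inv (hV.h_ne hp)).const_mul x
        have h2 := h1.congr_of_eventuallyEq (f₁ := fun s => PowerSeries.coeff 0 (sC Ψ x s))
          ((hV.eventually_t hp).mono fun s hs => by simpa using hC x s hs)
        rw [h2.deriv]
        have := hV.h_ne hp
        field_simp
      · have := (ih (k + 1) (by omega)).2.2.deriv_t hV
        simpa using this
    -- The relation N⁻¹∂_t C = -2uA is solved for the highest coefficient of A, whose factor u_0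
    -- does not vanish.
    have kA : Good V j h 1 (-2) (fun x t => PowerSeries.coeff (k + 1) (sA Ψ x t)) := by
      have s1 : Good V j h 1 (-2) (fun x t => ∑ i ∈ Finset.range (k + 1),
          PowerSeries.coeff (i + 1) (u t) * PowerSeries.coeff (k + 1 - (i + 1)) (sA Ψ x t)) :=
        Good.sum hV _ (F := fun i x t =>
          PowerSeries.coeff (i + 1) (u t) * PowerSeries.coeff (k + 1 - (i + 1)) (sA Ψ x t))
          fun i hi => (hu (i + 1)).mul₀ (ih _ (by omega)).1
      refine ((Good.inv_jet hV).mul₀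
        ((((Good.const (1 / 2)).mul₀ dC).add hV s1).neg)).congr fun x t hp => ?_
      have e := congrArg (PowerSeries.coeff (k + 1)) (W.dT_sC hp)
      have hj0 := hV.jet_ne hp
      have h2 : (2 : PowerSeries ℂ) = PowerSeries.C 2 := (map_ofNat _ 2).symm
      rw [PowerSeries.coeff_succ_X_mul, map_neg, h2, PowerSeries.coeff_C_mul, coeff_mul_range,
        Finset.sum_range_succ', PowerSeries.coeff_zero_eq_constantCoeff_apply, hj x t hp] at e
      simp only [dT, PowerSeries.coeff_mk, Nat.sub_zero] at e
      rw [e]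
      field_simp
      ring
    -- the first linear equation for the coefficients of `B` and `C`
    obtain ⟨e, he, hE⟩ : ∃ e, Good V j h 1 0 e ∧ ∀ x t, (x, t) ∈ V →
        x * PowerSeries.coeff (k + 1) (sB Ψ x t) - j t 0 * PowerSeries.coeff (k + 1) (sC Ψ x t)
          = e x t := by
      have s1 : Good V j h 1 0 (fun x t => ∑ i ∈ Finset.range (k + 1),
          PowerSeries.coeff (i + 1) (u t) * PowerSeries.coeff (k + 1 - (i + 1)) (sC Ψ x t)) :=
        Good.sum hV _ (F := fun i x t =>
          PowerSeries.coeff (i + 1) (u t) * PowerSeries.coeff (k + 1 - (i + 1)) (sC Ψ x t))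
          fun i hi => (hu (i + 1)).mul₀ (ihC _ (by omega))
      refine ⟨_, ((Good.const (1 / 2)).mul₀ (((ih k (by omega)).1.deriv_t hV).mono
        (by norm_num))).add hV s1, fun x t hp => ?_⟩
      have e := congrArg (PowerSeries.coeff (k + 1)) (W.dT_sA hp)
      have h2 : (2 : PowerSeries ℂ) = PowerSeries.C 2 := (map_ofNat _ 2).symm
      rw [PowerSeries.coeff_succ_X_mul, h2, PowerSeries.coeff_C_mul, map_sub,
        PowerSeries.coeff_C_mul, coeff_mul_range, Finset.sum_range_succ',
        PowerSeries.coeff_zero_eq_constantCoeff_apply, hj x t hp] at e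
      simp only [dT, PowerSeries.coeff_mk, Nat.sub_zero] at e
      rw [e]
      ring
    -- the second one
    obtain ⟨f, hf, hF⟩ : ∃ f, Good V j h 1 (-1) f ∧ ∀ x t, (x, t) ∈ V →
        j t 0 * PowerSeries.coeff (k + 1) (sB Ψ x t) - x * PowerSeries.coeff (k + 1) (sC Ψ x t)
          = f x t := by
      have s1 : Good V j h 0 (-2) (fun x t => ∑ i ∈ Finset.range k,
          (PowerSeries.coeff (i + 1) (sA Ψ x t) * PowerSeries.coeff (k + 1 - (i + 1)) (sA Ψ x t)
          + PowerSeries.coeff (i + 1) (sB Ψ x t) * PowerSeries.coeff (k + 1 - (i + 1)) (sB Ψ x t)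
          - PowerSeries.coeff (i + 1) (sC Ψ x t)
            * PowerSeries.coeff (k + 1 - (i + 1)) (sC Ψ x t))) := by
        refine Good.sum hV _ (F := fun i x t =>
          (PowerSeries.coeff (i + 1) (sA Ψ x t) * PowerSeries.coeff (k + 1 - (i + 1)) (sA Ψ x t)
          + PowerSeries.coeff (i + 1) (sB Ψ x t) * PowerSeries.coeff (k + 1 - (i + 1)) (sB Ψ x t)
          - PowerSeries.coeff (i + 1) (sC Ψ x t)
            * PowerSeries.coeff (k + 1 - (i + 1)) (sC Ψ x t))) fun i hi => ?_
        have hi' := Finset.mem_range.1 hi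
        have i1 := ih (i + 1) (by omega)
        have i2 := ih (k + 1 - (i + 1)) (by omega)
        rw [if_neg (by omega)] at i1 i2
        exact Good.cast_even (e := 0) (((((i1.1.mul i2.1).mono (by norm_num)).add hV
          ((i1.2.1.mul i2.2.1).mono (by norm_num))).sub hV ((i1.2.2.mul i2.2.2).mono (by norm_num))))
      -- The terms of S² = 1 that are linear in the new coefficients carry the leading values u_0/h
      -- of B and x/h of C; multiplication by h/2 frees them of denominators.
      refine ⟨_, (((Good.sqrt hV).mul ((Good.const (1 / 2)).mul₀ s1)).mono
        (by norm_num : (1 : ℤ) + -2 ≤ -1)).neg, fun x t hp => ?_⟩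
      have e := congrArg (PowerSeries.coeff (k + 1)) (W.sq_eq_one hp)
      rw [map_sub, map_add, coeff_mul_range, coeff_mul_range, coeff_mul_range,
        Finset.sum_range_succ', Finset.sum_range_succ, Finset.sum_range_succ',
        Finset.sum_range_succ, Finset.sum_range_succ', Finset.sum_range_succ] at e
      simp only [Nat.sub_self, PowerSeries.coeff_zero_eq_constantCoeff_apply, hA x t hp,
        hB x t hp, hC x t hp, Nat.sub_zero, PowerSeries.coeff_one, Nat.succ_ne_zero, if_false] at e
      simp only [Finset.sum_sub_distrib, Finset.sum_add_distrib]
      have hh := mul_inv_cancel₀ (hV.h_ne hp)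
      linear_combination (h x t / 2) * e
        - (j t 0 * PowerSeries.coeff (k + 1) (sB Ψ x t)
          - x * PowerSeries.coeff (k + 1) (sC Ψ x t)) * hh
    -- The system xB - u_0 C = e, u_0 B - xC = f has determinant h², whence h² B = u_0 f - x e and
    -- h² C = x f - u_0 e. Division by h² lowers the degrees by two.
    have h2 := Good.pow_inv_sqrt hV 2
    have hsq : ∀ x t, (x, t) ∈ V → (j t 0 ^ 2 - x ^ 2) * (h x t)⁻¹ ^ 2 = 1 := fun x t hp => by
      rw [← hV.h_sq hp, ← mul_pow, mul_inv_cancel₀ (hV.h_ne hp), one_pow]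
    refine ⟨kA, ?_, ?_⟩
    · have := ((((Good.jet 0).mul₀ hf).mono (by norm_num : (-1 : ℤ) ≤ 1)).sub hV
        ((Good.x.mul he).mono (by norm_num))).mul h2
      refine (Good.cast_even (e := 1) (d := -1) this).congr fun x t hp => ?_
      rw [← hE x t hp, ← hF x t hp]
      linear_combination -PowerSeries.coeff (k + 1) (sB Ψ x t) * hsq x t hp
    · rw [if_neg (Nat.succ_ne_zero k)]
      have := (((Good.x.mul hf).mono (by norm_num : (1 : ℤ) + -1 ≤ 0)).sub hV
        ((Good.jet 0).mul₀ he)).mul h2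
      refine (Good.cast_even (e := 1) (d := -2) this).congr fun x t hp => ?_
      rw [← hE x t hp, ← hF x t hp]
      linear_combination -PowerSeries.coeff (k + 1) (sC Ψ x t) * hsq x t hp

end MinimalModel

end

noncomputable section

namespace MinimalModel

/-! ### Truncated generating polynomials -/

section truncations

variable {Λ : Type*} [CommRing Λ]

/-- The polynomials `c X^k + r_0 X^{k-1} + ⋯ + r_{k-1}`. -/
def recPoly (c : Λ) (r : ℕ → Λ) : ℕ → Polynomial Λ
  | 0 => Polynomial.C c
  | k + 1 => Polynomial.X * recPoly c r k + Polynomial.C (r k)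

/-- The sequence `c, r_0, r_1, …`. -/
def consSeq (c : Λ) (r : ℕ → Λ) : ℕ → Λ
  | 0 => c
  | k + 1 => r k

theorem coeff_recPoly (c : Λ) (r : ℕ → Λ) (k i : ℕ) :
    (recPoly c r k).coeff i = if i ≤ k then consSeq c r (k - i) else 0 := by
  induction k generalizing i with
  | zero => rcases i with _ | i <;> simp [recPoly, consSeq, Polynomial.coeff_C]
  | succ k ih =>
    rcases i with _ | i
    · simp [recPoly, consSeq]
    · simp [recPoly, ih]

/-- Reversing the coefficients turns these polynomials into truncations of one power series
independent of k. High-degree coefficients of products thereby become low-order coefficients of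
products of full series. -/
theorem recPoly_eq_reflect (c : Λ) (r : ℕ → Λ) (k : ℕ) : recPoly c r k
    = Polynomial.reflect k (PowerSeries.trunc (k + 1) (PowerSeries.mk (consSeq c r))) := by
  ext i
  rw [coeff_recPoly, Polynomial.coeff_reflect, PowerSeries.coeff_trunc, PowerSeries.coeff_mk]
  split_ifs with h1 h2 h2
  · rw [Polynomial.revAt_le h1]
  · rw [Polynomial.revAt_le h1] at h2; omega
  · rw [Polynomial.revAt_eq_self_of_lt (by omega)] at h2; omega
  · rfl

theorem X_mul_recPoly_eq_reflect (r : ℕ → Λ) (k : ℕ) : Polynomial.X * recPoly 0 r k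
    = Polynomial.reflect k (PowerSeries.trunc k (PowerSeries.mk r)) := by
  ext i
  rw [Polynomial.coeff_reflect, PowerSeries.coeff_trunc, PowerSeries.coeff_mk]
  rcases i with _ | i
  · simp [Polynomial.revAt_le]
  · rw [Polynomial.coeff_X_mul, coeff_recPoly]
    split_ifs with h1 h2 h2
    · have h3 : i + 1 ≤ k := by
        by_contra h3
        rw [Polynomial.revAt_eq_self_of_lt (by omega)] at h2; omega
      rw [Polynomial.revAt_le h3]
      obtain ⟨s, hs⟩ : ∃ s, k - i = s + 1 := ⟨k - (i + 1), by omega⟩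
      rw [hs, consSeq]; congr 1; omega
    · by_cases h3 : i + 1 ≤ k
      · rw [Polynomial.revAt_le h3] at h2; omega
      · have : k - i = 0 := by omega
        rw [this, consSeq]
    · by_cases h3 : i + 1 ≤ k
      · omega
      · rw [Polynomial.revAt_eq_self_of_lt (by omega)] at h2; omega
    · rfl

theorem coeff_reflect_mul_reflect (P Q : Polynomial Λ) {k l n : ℕ} (hP : P.natDegree ≤ k)
    (hQ : Q.natDegree ≤ l) : (Polynomial.reflect k P * Polynomial.reflect l Q).coeff n
      = if n ≤ k + l then (P * Q).coeff (k + l - n) else 0 := by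
  rw [← Polynomial.reflect_mul P Q hP hQ, Polynomial.coeff_reflect]
  split_ifs with h
  · rw [Polynomial.revAt_le h]
  · rw [Polynomial.revAt_eq_self_of_lt (by omega)]
    exact Polynomial.coeff_eq_zero_of_natDegree_lt
      (lt_of_le_of_lt (Polynomial.natDegree_mul_le_of_le hP hQ) (by omega))

theorem coeff_trunc_mul_trunc (f g : PowerSeries Λ) {n a b : ℕ} (ha : n < a) (hb : n < b) :
    (PowerSeries.trunc a f * PowerSeries.trunc b g).coeff n = PowerSeries.coeff n (f * g) := by
  rw [PowerSeries.coeff_mul_eq_coeff_trunc_mul_trunc₂ f g ha hb, ← Polynomial.coe_mul,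
    Polynomial.coeff_coe]

theorem natDegree_trunc_le (f : PowerSeries Λ) (k : ℕ) :
    (PowerSeries.trunc k f).natDegree ≤ k :=
  Polynomial.natDegree_le_of_degree_le (PowerSeries.degree_trunc_lt f k).le

theorem natDegree_trunc_succ_le (f : PowerSeries Λ) (k : ℕ) :
    (PowerSeries.trunc (k + 1) f).natDegree ≤ k :=
  Nat.lt_succ_iff.1 (PowerSeries.natDegree_trunc_lt f k)

theorem mk_consSeq (c : Λ) (r : ℕ → Λ) : PowerSeries.mk (consSeq c r)
    = PowerSeries.C c + PowerSeries.X * PowerSeries.mk r := by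
  ext n
  rcases n with _ | n
  · simp [consSeq]
  · simp [consSeq, PowerSeries.coeff_succ_X_mul]

/-- The coefficients of high degree of the truncations of a solution of
`X α² + b² - X r² = 2 r`. -/
theorem coeff_recPoly_quadratic {α b r : ℕ → Λ}
    (H : PowerSeries.X * PowerSeries.mk α ^ 2 - 2 * PowerSeries.mk r + PowerSeries.mk b ^ 2
      - PowerSeries.X * PowerSeries.mk r ^ 2 = 0) {k l n : ℕ} (hk : k ≤ n) (hl : l ≤ n) :
    (recPoly 0 α k * recPoly 0 α l + Polynomial.X * recPoly 0 b k * recPoly 0 b l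
      - recPoly 1 r k * recPoly 1 r l + Polynomial.X ^ (k + l)).coeff n = 0 := by
  have hB : (Polynomial.X * recPoly 0 b k * recPoly 0 b l).coeff n
      = if n + 1 ≤ k + l then PowerSeries.coeff (k + l - (n + 1)) (PowerSeries.mk b ^ 2) else 0 := by
    rw [← Polynomial.coeff_X_mul]
    have : Polynomial.X * (Polynomial.X * recPoly 0 b k * recPoly 0 b l)
        = (Polynomial.X * recPoly 0 b k) * (Polynomial.X * recPoly 0 b l) := by ring
    rw [this, X_mul_recPoly_eq_reflect, X_mul_recPoly_eq_reflect,
      coeff_reflect_mul_reflect _ _ (natDegree_trunc_le _ _) (natDegree_trunc_le _ _)]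
    split_ifs with h
    · rw [coeff_trunc_mul_trunc _ _ (by omega) (by omega), pow_two]
    · rfl
  have hAC : ∀ (c : Λ) (f : ℕ → Λ), (recPoly c f k * recPoly c f l).coeff n
      = if n ≤ k + l then PowerSeries.coeff (k + l - n)
        ((PowerSeries.C c + PowerSeries.X * PowerSeries.mk f) ^ 2) else 0 := by
    intro c f
    rw [recPoly_eq_reflect, recPoly_eq_reflect, coeff_reflect_mul_reflect _ _
      (natDegree_trunc_succ_le _ _) (natDegree_trunc_succ_le _ _)]
    split_ifs with h
    · rw [coeff_trunc_mul_trunc _ _ (by omega) (by omega), pow_two, mk_consSeq]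
    · rfl
  -- The hypothesis times X, with the square of 1 + X r completed. For n ≥ k, l the reflected index
  -- k + l - n is within both truncations, so only these full series matter; the final 1 corresponds
  -- to X^{k+l}.
  have key : (PowerSeries.C (0 : Λ) + PowerSeries.X * PowerSeries.mk α) ^ 2
      + PowerSeries.X * PowerSeries.mk b ^ 2
      - (PowerSeries.C (1 : Λ) + PowerSeries.X * PowerSeries.mk r) ^ 2 + 1 = 0 := by
    rw [map_zero, map_one]
    linear_combination PowerSeries.X * H
  rw [Polynomial.coeff_add, Polynomial.coeff_sub, Polynomial.coeff_add, hB, hAC, hAC,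
    Polynomial.coeff_X_pow]
  by_cases hn : n ≤ k + l
  · rw [if_pos hn, if_pos hn]
    have e := congrArg (PowerSeries.coeff (k + l - n)) key
    rw [map_add, map_sub, map_add, (PowerSeries.coeff (k + l - n)).map_zero,
      PowerSeries.coeff_one] at e
    rcases Nat.eq_zero_or_pos (k + l - n) with h0 | h0
    · rw [if_neg (by omega), if_pos (by omega)]
      rw [h0] at e ⊢
      simpa using e
    · obtain ⟨s, hs⟩ := Nat.exists_eq_succ_of_ne_zero h0.ne'
      rw [if_pos (by omega), if_neg (by omega)]
      rw [if_neg (by omega), hs, PowerSeries.coeff_succ_X_mul] at e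
      have hs' : k + l - (n + 1) = s := by omega
      rw [hs', hs]
      exact e
  · rw [if_neg hn, if_neg hn, if_neg (by omega), if_neg (by omega)]
    ring

end truncations

/-! ### The derivation of differential polynomials -/

section dots

variable {m : ℕ} {τ : ℕ → ℂ} {U : Set ℂ} {u : ℂ → PowerSeries ℂ} {V : Set (ℂ × ℂ)}
  {h : ℂ → ℂ → ℂ} (hV : CurveDomain V (jet u) h) (hu : IsStringSolution m τ U u) (hU : IsOpen U)
  (hVU : ∀ x t, (x, t) ∈ V → t ∈ U)
include hV hu hU hVU

theorem IsStringSolution.evalDiff_dd (p : DiffPoly) {x t : ℂ} (hp : (x, t) ∈ V) :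
    evalDiff u (dd p) t = dot (evalDiff u p) t := by
  induction p using MvPolynomial.induction_on with
  | C a =>
    have e : evalDiff u (MvPolynomial.C a) = fun _ => algebraMap ℚ (PowerSeries ℂ) a := by
      funext t; simp only [evalDiff, MvPolynomial.algHom_C]
    rw [e, dot_eq _ x, dT_const]
    simp [dd, evalDiff]
  | add p q hp' hq' =>
    have e : evalDiff u (p + q) = fun t => evalDiff u p t + evalDiff u q t := by
      funext t; simp [evalDiff]
    rw [e, dot_eq _ x, dT_add hV.isOpen hp ((hu.goodS_evalDiff hV hU hVU p).hol hV)
      ((hu.goodS_evalDiff hV hU hVU q).hol hV), mul_add, ← dot_eq _ x, ← dot_eq _ x, ← hp', ← hq']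
    simp [evalDiff]
  | mul_X p i hp' =>
    have hX : dd (MvPolynomial.X i) = MvPolynomial.X (i + 1) := MvPolynomial.mkDerivation_X _ _ _
    have eX : ∀ i : ℕ, evalDiff u (MvPolynomial.X i : DiffPoly) = dot^[i] u := fun i => by
      funext t; simp [evalDiff]
    have e : evalDiff u (p * MvPolynomial.X i)
        = fun t => evalDiff u p t * evalDiff u (MvPolynomial.X i) t := by
      funext t; simp [evalDiff]
    have gX := hu.goodS_evalDiff hV hU hVU (MvPolynomial.X i : DiffPoly)
    rw [e, dot_eq _ x, dT_mul hV.isOpen hp ((hu.goodS_evalDiff hV hU hVU p).hol hV)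
      (gX.hol hV), Derivation.leibniz, hX]
    have e1 : evalDiff u (p • (MvPolynomial.X (i + 1) : DiffPoly)
          + (MvPolynomial.X i : DiffPoly) • dd p) t
        = evalDiff u p t * evalDiff u (MvPolynomial.X (i + 1) : DiffPoly) t
          + evalDiff u (MvPolynomial.X i : DiffPoly) t * evalDiff u (dd p) t := by
      simp [evalDiff]
    rw [e1, hp', dot_eq (evalDiff u p) x, eX (i + 1), iterate_dot_succ, ← eX i, dot_eq _ x]
    ring

/-- The quadratic relation between the Gelfand–Dikii polynomials, in terms of generating series. -/
theorem IsStringSolution.quadratic {x t : ℂ} (hp : (x, t) ∈ V) :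
    PowerSeries.X * PowerSeries.mk (fun k => PowerSeries.C (1 / 2) * dot (evalDiff u (gdHat k)) t) ^ 2
      - 2 * PowerSeries.mk (fun k => evalDiff u (gdCheck k) t)
      + PowerSeries.mk (fun k => evalDiff u (gdHat k) t) ^ 2
      - PowerSeries.X * PowerSeries.mk (fun k => evalDiff u (gdCheck k) t) ^ 2 = 0 := by
  have h2 : (2 : PowerSeries (PowerSeries ℂ)) = PowerSeries.C 2 := (map_ofNat _ 2).symm
  have hq : ∀ q : ℚ, evalDiff u (MvPolynomial.C q) t = PowerSeries.C (q : ℂ) := fun q => by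
    simp only [evalDiff, MvPolynomial.algHom_C]
    rw [IsScalarTower.algebraMap_apply ℚ ℂ (PowerSeries ℂ)]
    rfl
  have hmul : ∀ p q, evalDiff u (p * q) t = evalDiff u p t * evalDiff u q t := fun p q => by
    simp [evalDiff]
  have hsub : ∀ p q, evalDiff u (p - q) t = evalDiff u p t - evalDiff u q t := fun p q => by
    simp [evalDiff]
  have hadd : ∀ p q, evalDiff u (p + q) t = evalDiff u p t + evalDiff u q t := fun p q => by
    simp [evalDiff]
  have hsum : ∀ (s : Finset (ℕ × ℕ)) (f : ℕ × ℕ → DiffPoly), evalDiff u (∑ p ∈ s, f p) t = ∑ p ∈ s, evalDiff u (f p) t :=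
    fun s f => by simp [evalDiff]
  have hC4 : (PowerSeries.C ((1 / 4 : ℚ) : ℂ) : PowerSeries ℂ)
      = PowerSeries.C (1 / 2) * PowerSeries.C (1 / 2) := by
    rw [← map_mul]; norm_num
  have htwo : evalDiff u 2 t = 2 := by simp [evalDiff]
  ext1 n
  rw [map_sub, map_add, map_sub, map_zero, h2, PowerSeries.coeff_C_mul]
  rcases n with _ | n
  · simp only [PowerSeries.coeff_zero_eq_constantCoeff_apply, map_mul, PowerSeries.constantCoeff_X,
      zero_mul, PowerSeries.constantCoeff_mk, gdCheck_zero, gdHat_zero, hmul, hq,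
      pow_two]
    have : (2 : PowerSeries ℂ) * PowerSeries.C ((1 / 2 : ℚ) : ℂ) = 1 := by
      rw [← map_ofNat (PowerSeries.C (R := ℂ)) 2, ← map_mul]; norm_num
    linear_combination (-(evalDiff u (MvPolynomial.X 0) t) ^ 2) * this
  · have key := congrArg (fun p => evalDiff u p t) (gdCheck_quadratic n)
    simp only [hmul, hsub, hadd, hsum, htwo, hq, hu.evalDiff_dd hV hU hVU _ hp] at key
    simp only [PowerSeries.coeff_succ_X_mul, pow_two]
    rw [PowerSeries.coeff_mul, PowerSeries.coeff_mul, PowerSeries.coeff_mul]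
    simp only [PowerSeries.coeff_mk]
    rw [key, Finset.sum_sub_distrib]
    have e : ∑ p ∈ Finset.HasAntidiagonal.antidiagonal n,
        PowerSeries.C (1 / 2) * dot (evalDiff u (gdHat p.1)) t
          * (PowerSeries.C (1 / 2) * dot (evalDiff u (gdHat p.2)) t)
        = ∑ p ∈ Finset.HasAntidiagonal.antidiagonal n, PowerSeries.C ((1 / 4 : ℚ) : ℂ)
          * (dot (evalDiff u (gdHat p.1)) t * dot (evalDiff u (gdHat p.2)) t) :=
      Finset.sum_congr rfl fun p _ => by rw [hC4]; ring
    rw [e]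
    ring

end dots

end MinimalModel

end

/-! ### The one-point function and its order at infinity -/

noncomputable section

namespace MinimalModel

open Polynomial in
/-- Polynomials over formal series, depending on `t`, all of whose coefficients are rational in the
jet. -/
abbrev GoodPoly (V : Set (ℂ × ℂ)) (j : ℂ → ℕ → ℂ) (h : ℂ → ℂ → ℂ) (P : ℂ → (PowerSeries ℂ)[X]) :
    Prop :=
  ∀ n, GoodS V j h 0 0 (fun _ t => (P t).coeff n)

namespace GoodPoly

open Polynomial

variable {V : Set (ℂ × ℂ)} {j : ℂ → ℕ → ℂ} {h : ℂ → ℂ → ℂ} (hV : CurveDomain V j h)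
  {P Q : ℂ → (PowerSeries ℂ)[X]}

theorem const (p : (PowerSeries ℂ)[X]) : GoodPoly V j h (fun _ => p) := fun _ => GoodS.const _

theorem recPoly (c : PowerSeries ℂ) {r : ℂ → ℕ → PowerSeries ℂ}
    (hr : ∀ i, GoodS V j h 0 0 (fun _ t => r t i)) (k : ℕ) :
    GoodPoly V j h (fun t => recPoly c (r t) k) := by
  intro n
  by_cases hn : n ≤ k
  · rcases hs : k - n with _ | s
    · exact (GoodS.const c).congr fun x t _ => by rw [coeff_recPoly, if_pos hn, hs, consSeq]
    · exact (hr s).congr fun x t _ => by rw [coeff_recPoly, if_pos hn, hs, consSeq]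
  · exact (GoodS.const 0).congr fun x t _ => by rw [coeff_recPoly, if_neg hn]

include hV

theorem add (hP : GoodPoly V j h P) (hQ : GoodPoly V j h Q) :
    GoodPoly V j h (fun t => P t + Q t) := fun n =>
  ((hP n).add hV (hQ n)).congr fun _ _ _ => Polynomial.coeff_add _ _ _

theorem sub (hP : GoodPoly V j h P) (hQ : GoodPoly V j h Q) :
    GoodPoly V j h (fun t => P t - Q t) := fun n =>
  ((hP n).sub hV (hQ n)).congr fun _ _ _ => Polynomial.coeff_sub _ _ _

theorem mul (hP : GoodPoly V j h P) (hQ : GoodPoly V j h Q) :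
    GoodPoly V j h (fun t => P t * Q t) := fun n =>
  (GoodS.sum hV (Finset.HasAntidiagonal.antidiagonal n) (F := fun p _ t => (P t).coeff p.1 * (Q t).coeff p.2)
    fun p _ => (hP p.1).mul₀ hV (hQ p.2)).congr fun _ _ _ => Polynomial.coeff_mul _ _ _

theorem sum {ι : Type*} (s : Finset ι) {P : ι → ℂ → (PowerSeries ℂ)[X]}
    (hP : ∀ i ∈ s, GoodPoly V j h (P i)) : GoodPoly V j h (fun t => ∑ i ∈ s, P i t) := fun n =>
  (GoodS.sum hV s fun i hi => hP i hi n).congr fun _ _ _ => Polynomial.finsetSum_coeff _ _ _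

theorem C_mul {f : ℂ → ℂ} (hf : Good V j h 0 0 (fun _ t => f t)) (hP : GoodPoly V j h P) :
    GoodPoly V j h (fun t => C (PowerSeries.C (f t)) * P t) := fun n =>
  ((GoodS.ofC hf).mul₀ hV (hP n)).congr fun _ _ _ => Polynomial.coeff_C_mul _

theorem eval {d : ℕ} (hP : GoodPoly V j h P) (hd : ∀ n, d < n → ∀ x t, (x, t) ∈ V → (P t).coeff n = 0) :
    GoodS V j h 0 (2 * d) (fun x t => (P t).eval (PowerSeries.C (x ^ 2))) := by
  have h2 : ∀ i ∈ Finset.range (d + 1), GoodS V j h 0 (2 * d)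
      (fun x t => (P t).coeff i * PowerSeries.C (x ^ (2 * i))) := fun i hi => by
    have hi' := Finset.mem_range.1 hi
    refine GoodS.mul₀ hV (hP i) (GoodS.mono (GoodS.ofC ?_) (d := 2 * i) (by norm_cast; omega))
    exact ((Good.ofPolyAt (X ^ (2 * i)) (d := 2 * i) (by rw [natDegree_X_pow]; push_cast; rfl)).congr
      fun x t _ => by simp)
  refine (GoodS.sum hV _ h2).congr fun x t hp => ?_
  rw [Polynomial.eval_eq_sum_range' (n := d + 1)]
  · exact Finset.sum_congr rfl fun i _ => by rw [← map_pow, ← pow_mul]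
  · exact Nat.lt_succ_iff.2 (Polynomial.natDegree_le_iff_coeff_eq_zero.2 fun n hn => hd n hn x t hp)

end GoodPoly

/-- The function `Tr(D S) / 2`. -/
def waveTau (D Ψ : FormalMatrix) (x t : ℂ) : PowerSeries ℂ :=
  D x t 0 0 * sA Ψ x t + D x t 0 1 * (Ψ x t 1 0 * Ψ x t 1 1) - D x t 1 0 * (Ψ x t 0 0 * Ψ x t 0 1)

theorem waveTau_eq (D Ψ : FormalMatrix) (x t : ℂ) : waveTau D Ψ x t = D x t 0 0 * sA Ψ x t
    + PowerSeries.C (1 / 2) * (D x t 0 1 * (sB Ψ x t - sC Ψ x t)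
      + D x t 1 0 * (sB Ψ x t + sC Ψ x t)) := by
  have h2 : PowerSeries.C (1 / 2 : ℂ) * (2 : PowerSeries ℂ) = 1 := by
    rw [← map_ofNat (PowerSeries.C (R := ℂ)) 2, ← map_mul]; norm_num
  rw [waveTau, sB, sC]
  linear_combination (-(D x t 0 1 * (Ψ x t 1 0 * Ψ x t 1 1)) + D x t 1 0 * (Ψ x t 0 0 * Ψ x t 0 1)) * h2

namespace IsWave

variable {V : Set (ℂ × ℂ)} {u : ℂ → PowerSeries ℂ} {h y : ℂ → ℂ → ℂ}
    {D Ψ : FormalMatrix} (W : IsWave V u h y D Ψ) {x t : ℂ} (hp : (x, t) ∈ V)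
include W hp

/-- Multiply the x-equation for the first column by the first row of Ψ⁻¹; the exponent contributes
y, as det Ψ = 1. The right-hand side is divisible by X, hence y is the leading coefficient of
`waveTau`. -/
theorem waveTau_sub : waveTau D Ψ x t - PowerSeries.C (y x t)
    = PowerSeries.X * (dX (fun x t => Ψ x t 0 0) x t * Ψ x t 1 1
      - dX (fun x t => Ψ x t 1 0) x t * Ψ x t 0 1) := by
  rw [waveTau, sA]
  linear_combination -Ψ x t 1 1 * W.eqX0 0 hp + Ψ x t 0 1 * W.eqX0 1 hp
    + Ψ x t 1 0 * Ψ x t 0 1 * W.trace hp + PowerSeries.C (y x t) * W.det hp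

theorem constantCoeff_waveTau : PowerSeries.constantCoeff (waveTau D Ψ x t) = y x t := by
  have := congrArg PowerSeries.constantCoeff (W.waveTau_sub hp)
  simpa [sub_eq_zero] using this

/-- Lagrange's identity |a·b|² = |a|²|b|² - |a × b|² in the three-dimensional space of traceless
matrices: S is a unit vector, -det D is the norm of D, and the cross product is [D, S], which is N⁻¹
∂_x S. The signs are those of this quadratic form. -/
theorem waveTau_sq : 4 * (waveTau D Ψ x t * waveTau D Ψ x t)
    = 4 * (D x t 0 0 * D x t 0 0 + D x t 0 1 * D x t 1 0)
      + (PowerSeries.X * dX (sA Ψ) x t) * (PowerSeries.X * dX (sA Ψ) x t)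
      + (PowerSeries.X * dX (sB Ψ) x t) * (PowerSeries.X * dX (sB Ψ) x t)
      - (PowerSeries.X * dX (sC Ψ) x t) * (PowerSeries.X * dX (sC Ψ) x t) := by
  have h2 : (2 : PowerSeries ℂ) * waveTau D Ψ x t = 2 * (D x t 0 0 * sA Ψ x t)
      + (D x t 0 1 * (sB Ψ x t - sC Ψ x t) + D x t 1 0 * (sB Ψ x t + sC Ψ x t)) := by
    rw [waveTau, sB, sC]; ring
  rw [W.dX_sA hp, W.dX_sB hp, W.dX_sC hp]
  linear_combination (2 * waveTau D Ψ x t + 2 * (D x t 0 0 * sA Ψ x t)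
      + (D x t 0 1 * (sB Ψ x t - sC Ψ x t) + D x t 1 0 * (sB Ψ x t + sC Ψ x t))) * h2
    + 4 * (D x t 0 0 * D x t 0 0 + D x t 0 1 * D x t 1 0) * W.sq_eq_one hp

end IsWave

/-! ### The entries of `𝒟` -/

section entries

open Polynomial

variable {m : ℕ} {τ : ℕ → ℂ} {U : Set ℂ} {u : ℂ → PowerSeries ℂ} {V : Set (ℂ × ℂ)}
  {h : ℂ → ℂ → ℂ}

/-- The times of the string equation, `t` being absorbed into the first one. -/
def times (τ : ℕ → ℂ) (t : ℂ) (k : ℕ) : ℂ := τ k + if k = 0 then t else 0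

/-- The generating polynomial of the `A_k`. -/
def polyA (u : ℂ → PowerSeries ℂ) (k : ℕ) (t : ℂ) : (PowerSeries ℂ)[X] :=
  recPoly 0 (fun k => PowerSeries.C (1 / 2) * dot (evalDiff u (gdHat k)) t) k

/-- The generating polynomial of the `B_k`. -/
def polyB (u : ℂ → PowerSeries ℂ) (k : ℕ) (t : ℂ) : (PowerSeries ℂ)[X] :=
  recPoly 0 (fun k => evalDiff u (gdHat k) t) k

/-- The generating polynomial of the `C_k`. -/
def polyC (u : ℂ → PowerSeries ℂ) (k : ℕ) (t : ℂ) : (PowerSeries ℂ)[X] :=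
  recPoly 1 (fun k => evalDiff u (gdCheck k) t) k

theorem laxA_eq (u : ℂ → PowerSeries ℂ) (x t : ℂ) (k : ℕ) :
    laxA u x t k = (polyA u k t).eval (PowerSeries.C (x ^ 2)) := by
  induction k with
  | zero => simp [laxA, polyA, recPoly]
  | succ k ih => rw [laxA, ih]; simp [polyA, recPoly]

theorem laxB_eq (u : ℂ → PowerSeries ℂ) (x t : ℂ) (k : ℕ) :
    laxB u x t k = (polyB u k t).eval (PowerSeries.C (x ^ 2)) := by
  induction k with
  | zero => simp [laxB, polyB, recPoly]
  | succ k ih => rw [laxB, ih]; simp [polyB, recPoly]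

theorem laxC_eq (u : ℂ → PowerSeries ℂ) (x t : ℂ) (k : ℕ) :
    laxC u x t k = (polyC u k t).eval (PowerSeries.C (x ^ 2)) := by
  induction k with
  | zero => simp [laxC, polyC, recPoly]
  | succ k ih => rw [laxC, ih]; simp [polyC, recPoly]

/-- A combination of polynomials with the times as coefficients. -/
def timesSum (τ : ℕ → ℂ) (μ : ℕ) (P : ℕ → ℂ → (PowerSeries ℂ)[X]) (t : ℂ) : (PowerSeries ℂ)[X] :=
  ∑ k ∈ Finset.range (μ + 1), C (PowerSeries.C (times τ t k)) * P k t

theorem laxD_eq (x t : ℂ) {μ : ℕ} (hμ : μ ≤ m) (hτ : ∀ k, μ < k → k ≤ m → τ k = 0) :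
    laxD m τ u x t = ∑ k ∈ Finset.range (μ + 1), (PowerSeries.C (times τ t k) : PowerSeries ℂ) • laxDk u k x t := by
  have h1 : laxD m τ u x t = ∑ k ∈ Finset.range (m + 1),
      (PowerSeries.C (times τ t k) : PowerSeries ℂ) • laxDk u k x t := by
    rw [laxD, Finset.sum_range_succ', Finset.sum_range_succ' _ m]
    simp only [times, Nat.succ_ne_zero, if_false, add_zero, if_true, map_add, add_smul]
    abel
  rw [h1]
  symm
  refine Finset.sum_subset (Finset.range_subset_range.2 (by omega)) fun k hk hk' => ?_
  have h1 := Finset.mem_range.1 hk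
  have h2 : ¬ k < μ + 1 := fun h => hk' (Finset.mem_range.2 h)
  rw [times, hτ k (by omega) (by omega), if_neg (by omega)]
  simp

theorem laxD_entries (x t : ℂ) {μ : ℕ} (hμ : μ ≤ m) (hτ : ∀ k, μ < k → k ≤ m → τ k = 0) :
    laxD m τ u x t 0 0 = -(timesSum τ μ (polyA u) t).eval (PowerSeries.C (x ^ 2)) ∧
    laxD m τ u x t 0 1 = PowerSeries.C x * (timesSum τ μ (polyB u) t).eval (PowerSeries.C (x ^ 2))
      + (timesSum τ μ (polyC u) t).eval (PowerSeries.C (x ^ 2)) ∧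
    laxD m τ u x t 1 0 = PowerSeries.C x * (timesSum τ μ (polyB u) t).eval (PowerSeries.C (x ^ 2))
      - (timesSum τ μ (polyC u) t).eval (PowerSeries.C (x ^ 2)) := by
  simp only [laxD_eq x t hμ hτ, Matrix.sum_apply, Matrix.smul_apply, smul_eq_mul, timesSum,
    eval_finsetSum, eval_mul, eval_C, ← laxA_eq, ← laxB_eq, ← laxC_eq, Finset.mul_sum]
  refine ⟨?_, ?_, ?_⟩
  · rw [← Finset.sum_neg_distrib]
    exact Finset.sum_congr rfl fun k _ => mul_neg _ _
  · rw [← Finset.sum_add_distrib]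
    refine Finset.sum_congr rfl fun k _ => ?_
    change _ * (PowerSeries.C x * laxB u x t k + laxC u x t k) = _
    ring
  · rw [← Finset.sum_sub_distrib]
    refine Finset.sum_congr rfl fun k _ => ?_
    change _ * (PowerSeries.C x * laxB u x t k - laxC u x t k) = _
    ring

/-- The polynomial in `x²` equal to `-det 𝒟 + T²`, where `T` is the part of `𝒟` of highest degree. -/
def detPoly (τ : ℕ → ℂ) (u : ℂ → PowerSeries ℂ) (μ : ℕ) (t : ℂ) : (PowerSeries ℂ)[X] :=
  timesSum τ μ (polyA u) t * timesSum τ μ (polyA u) t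
    + X * timesSum τ μ (polyB u) t * timesSum τ μ (polyB u) t
    - timesSum τ μ (polyC u) t * timesSum τ μ (polyC u) t
    + timesSum τ μ (fun k _ => X ^ k) t * timesSum τ μ (fun k _ => X ^ k) t

variable (hV : CurveDomain V (jet u) h) (hu : IsStringSolution m τ U u) (hU : IsOpen U)
  (hVU : ∀ x t, (x, t) ∈ V → t ∈ U)
include hV hu hU hVU

/-- `detPoly` is bilinear in the times, and each pair (k, l) has k, l ≤ μ ≤ n, so the quadratic
relation of the Gelfand–Dikii polynomials annihilates every term. -/
theorem IsStringSolution.coeff_detPoly {x t : ℂ} (hp : (x, t) ∈ V) {μ n : ℕ} (hn : μ ≤ n) :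
    (detPoly τ u μ t).coeff n = 0 := by
  have e : detPoly τ u μ t = ∑ k ∈ Finset.range (μ + 1), ∑ l ∈ Finset.range (μ + 1),
      C (PowerSeries.C (times τ t k) * PowerSeries.C (times τ t l)) *
        (polyA u k t * polyA u l t + X * polyB u k t * polyB u l t - polyC u k t * polyC u l t
          + X ^ (k + l)) := by
    rw [detPoly, mul_assoc]
    simp only [timesSum, Finset.sum_mul_sum]
    simp only [Finset.mul_sum, ← Finset.sum_add_distrib, ← Finset.sum_sub_distrib]
    refine Finset.sum_congr rfl fun k _ => Finset.sum_congr rfl fun l _ => ?_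
    rw [map_mul]
    ring
  rw [e, finsetSum_coeff]
  refine Finset.sum_eq_zero fun k hk => ?_
  rw [finsetSum_coeff]
  refine Finset.sum_eq_zero fun l hl => ?_
  have hk' := Finset.mem_range.1 hk
  have hl' := Finset.mem_range.1 hl
  rw [coeff_C_mul]
  exact mul_eq_zero_of_right _ (coeff_recPoly_quadratic (hu.quadratic hV hU hVU hp) (by omega)
    (by omega))

omit hU in
theorem IsStringSolution.goodPoly_timesSum (μ : ℕ) {P : ℕ → ℂ → (PowerSeries ℂ)[X]}
    (hP : ∀ k, GoodPoly V (jet u) h (P k)) : GoodPoly V (jet u) h (timesSum τ μ P) := by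
  refine GoodPoly.sum hV _ fun k _ => GoodPoly.C_mul hV ?_ (hP k)
  refine (Good.const (τ k)).add hV ?_
  split_ifs
  · exact hu.good_t hV hVU
  · exact Good.const 0

theorem IsStringSolution.goodPoly_polyA (k : ℕ) : GoodPoly V (jet u) h (polyA u k) :=
  GoodPoly.recPoly 0 (r := fun t k => PowerSeries.C (1 / 2) * dot (evalDiff u (gdHat k)) t)
    (fun i => (GoodS.const _).mul₀ hV (hu.goodS_dot_evalDiff hV hU hVU (gdHat i))) k

theorem IsStringSolution.goodPoly_polyB (k : ℕ) : GoodPoly V (jet u) h (polyB u k) :=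
  GoodPoly.recPoly 0 (r := fun t k => evalDiff u (gdHat k) t)
    (fun i => hu.goodS_evalDiff hV hU hVU (gdHat i)) k

theorem IsStringSolution.goodPoly_polyC (k : ℕ) : GoodPoly V (jet u) h (polyC u k) :=
  GoodPoly.recPoly 1 (r := fun t k => evalDiff u (gdCheck k) t)
    (fun i => hu.goodS_evalDiff hV hU hVU (gdCheck i)) k

theorem IsStringSolution.goodPoly_detPoly (μ : ℕ) : GoodPoly V (jet u) h (detPoly τ u μ) := by
  have a := hu.goodPoly_timesSum hV hVU μ (hu.goodPoly_polyA hV hU hVU)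
  have b := hu.goodPoly_timesSum hV hVU μ (hu.goodPoly_polyB hV hU hVU)
  have c := hu.goodPoly_timesSum hV hVU μ (hu.goodPoly_polyC hV hU hVU)
  have d := hu.goodPoly_timesSum hV hVU μ (P := fun k _ => X ^ k) (fun k => GoodPoly.const _)
  exact GoodPoly.add hV (GoodPoly.sub hV (GoodPoly.add hV (GoodPoly.mul hV a a)
    (GoodPoly.mul hV (GoodPoly.mul hV (GoodPoly.const X) b) b)) (GoodPoly.mul hV c c))
    (GoodPoly.mul hV d d)

omit hV in
/-- A highest time that does not vanish. -/
theorem IsStringSolution.exists_top {x t : ℂ} (hp : (x, t) ∈ V) :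
    ∃ μ, 1 ≤ μ ∧ μ ≤ m ∧ τ μ ≠ 0 ∧ ∀ k, μ < k → k ≤ m → τ k = 0 := by
  classical
  have hex : ∃ k ∈ Finset.Icc 1 m, τ k ≠ 0 := by
    by_contra hcon
    push Not at hcon
    -- Without higher times the leading string equation reads (s + t_0) u_0 = 0, which confines the
    -- nonempty open set U to one point.
    have h1 : ∀ s ∈ U, s = -τ 0 := by
      intro s hs
      have := hu.leading hs
      rw [Finset.sum_range_succ', Finset.sum_eq_zero] at this
      · have h0 := hu.u0_ne_zero s hs
        have e : leadVal (u0 u s) (gdHat 0) = u0 u s := by simp [leadVal, gdHat_zero]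
        rw [e] at this
        have : (s + τ 0) * u0 u s = 0 := by linear_combination this
        rcases mul_eq_zero.1 this with h | h
        · linear_combination h
        · exact absurd h h0
      · intro k hk
        have := Finset.mem_range.1 hk
        rw [hcon (k + 1) (Finset.mem_Icc.2 ⟨by omega, by omega⟩), zero_mul]
    have hinf : U.Infinite := infinite_of_mem_nhds t (hU.mem_nhds (hVU x t hp))
    exact hinf ((Set.finite_singleton (-τ 0)).subset fun s hs => h1 s hs)
  set s := (Finset.Icc 1 m).filter (fun k => τ k ≠ 0) with hs
  have hne : s.Nonempty := by
    obtain ⟨k, hk, hk'⟩ := hex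
    exact ⟨k, Finset.mem_filter.2 ⟨hk, hk'⟩⟩
  have hmem := s.max'_mem hne
  obtain ⟨h1, h2⟩ := Finset.mem_filter.1 hmem
  obtain ⟨h3, h4⟩ := Finset.mem_Icc.1 h1
  refine ⟨s.max' hne, h3, h4, h2, fun k hk hkm => ?_⟩
  by_contra hk0
  have := s.le_max' k (Finset.mem_filter.2 ⟨Finset.mem_Icc.2 ⟨by omega, hkm⟩, hk0⟩)
  omega

omit hV hU hVU hu in
theorem coeff_timesSum_eq_zero {μ n : ℕ} {P : ℕ → ℂ → (PowerSeries ℂ)[X]} {t : ℂ}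
    (hP : ∀ k, (P k t).natDegree ≤ k) (hn : μ < n) : (timesSum τ μ P t).coeff n = 0 := by
  rw [timesSum, finsetSum_coeff]
  refine Finset.sum_eq_zero fun k hk => ?_
  have := Finset.mem_range.1 hk
  rw [coeff_C_mul, coeff_eq_zero_of_natDegree_lt ((hP k).trans_lt (by omega)), mul_zero]

omit hV hU hVU hu in
theorem natDegree_recPoly_le {Λ : Type*} [CommRing Λ] (c : Λ) (r : ℕ → Λ) (k : ℕ) :
    (recPoly c r k).natDegree ≤ k :=
  natDegree_le_iff_coeff_eq_zero.2 fun n hn => by rw [coeff_recPoly, if_neg (by omega)]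

/-- The entries of `𝒟` are polynomials in `x` with coefficients rational in the jet. -/
theorem IsStringSolution.good_laxD {μ : ℕ} (hμ : μ ≤ m) (hτ : ∀ k, μ < k → k ≤ m → τ k = 0) :
    GoodS V (jet u) h 0 (2 * μ + 1) (fun x t => laxD m τ u x t 0 0) ∧
    GoodS V (jet u) h 0 (2 * μ + 1) (fun x t => laxD m τ u x t 0 1) ∧
    GoodS V (jet u) h 0 (2 * μ + 1) (fun x t => laxD m τ u x t 1 0) := by
  have a := GoodPoly.eval hV (hu.goodPoly_timesSum hV hVU μ (hu.goodPoly_polyA hV hU hVU))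
    (d := μ) fun n hn x t _ => coeff_timesSum_eq_zero (fun k => natDegree_recPoly_le _ _ _) hn
  have b := GoodPoly.eval hV (hu.goodPoly_timesSum hV hVU μ (hu.goodPoly_polyB hV hU hVU))
    (d := μ) fun n hn x t _ => coeff_timesSum_eq_zero (fun k => natDegree_recPoly_le _ _ _) hn
  have c := GoodPoly.eval hV (hu.goodPoly_timesSum hV hVU μ (hu.goodPoly_polyC hV hU hVU))
    (d := μ) fun n hn x t _ => coeff_timesSum_eq_zero (fun k => natDegree_recPoly_le _ _ _) hn
  have xb := ((GoodS.ofC (V := V) (j := jet u) (h := h) Good.x).mul hV b).mono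
    (by omega : (1 : ℤ) + 2 * μ ≤ 2 * μ + 1)
  have c' := c.mono (by omega : (2 : ℤ) * μ ≤ 2 * μ + 1)
  refine ⟨((a.mono (by omega : (2 : ℤ) * μ ≤ 2 * μ + 1)).neg).congr fun x t _ => ?_,
    (xb.add hV c').congr fun x t _ => ?_, (xb.sub hV c').congr fun x t _ => ?_⟩
  · exact (laxD_entries x t hμ hτ).1
  · exact (laxD_entries x t hμ hτ).2.1
  · exact (laxD_entries x t hμ hτ).2.2

/-- The coefficients of `S` are odd and bounded at infinity. -/
structure GoodTriple (V : Set (ℂ × ℂ)) (j : ℂ → ℕ → ℂ) (h : ℂ → ℂ → ℂ) (Ψ : FormalMatrix) :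
    Prop where
  A : GoodS V j h 1 (-2) (sA Ψ)
  B : GoodS V j h 1 (-1) (sB Ψ)
  C : GoodS V j h 1 0 (sC Ψ)

theorem IsStringSolution.goodS_waveTau {Ψ : FormalMatrix} (hS : GoodTriple V (jet u) h Ψ)
    {μ : ℕ} (hμ : μ ≤ m) (hτ : ∀ k, μ < k → k ≤ m → τ k = 0) :
    GoodS V (jet u) h 1 (2 * μ + 1) (waveTau (laxD m τ u) Ψ) := by
  obtain ⟨d0, d1, d2⟩ := hu.good_laxD hV hU hVU hμ hτ
  have b0 := hS.B.mono (by norm_num : (-1 : ℤ) ≤ 0)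
  have r := (((d0.mul hV hS.A).mono (by omega)).add hV (GoodS.mul₀ hV (GoodS.const (PowerSeries.C (1 / 2)))
    ((d1.mul hV (b0.sub hV hS.C)).add hV (d2.mul hV (b0.add hV hS.C)))))
  exact (r.mono (by omega)).congr fun x t _ => waveTau_eq _ _ _ _

/-- In `waveTau_sq` the determinant is, up to the square T of its N-independent top part, of degree
2(μ - 1) in x, and the squares of the derivatives of S are smaller still. As T is a constant series
in X, it affects the leading order only. -/
theorem IsStringSolution.goodS_waveTau_sq {y : ℂ → ℂ → ℂ} {Ψ : FormalMatrix}
    (W : IsWave V u h y (laxD m τ u) Ψ) (hS : GoodTriple V (jet u) h Ψ)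
    {μ : ℕ} (h1 : 1 ≤ μ) (hμ : μ ≤ m) (hτ : ∀ k, μ < k → k ≤ m → τ k = 0) :
    ∃ T : ℂ → ℂ → ℂ, GoodS V (jet u) h 0 (2 * μ - 2) (fun x t =>
      waveTau (laxD m τ u) Ψ x t * waveTau (laxD m τ u) Ψ x t + PowerSeries.C (T x t)) := by
  have hd := GoodPoly.eval hV (hu.goodPoly_detPoly hV hU hVU μ) (d := μ - 1) fun n hn x t hp =>
    hu.coeff_detPoly hV hU hVU hp (by omega)
  have hX : GoodS V (jet u) h 0 0 (fun _ _ => PowerSeries.X) := GoodS.const _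
  have a := hX.mul₀ hV (hS.A.dX hV)
  have b := hX.mul₀ hV (hS.B.dX hV)
  have c := hX.mul₀ hV (hS.C.dX hV)
  have sq : ∀ {d : ℤ} {F : ℂ → ℂ → PowerSeries ℂ}, GoodS V (jet u) h 1 d F →
      d + d ≤ 2 * (μ - 1 : ℕ) → GoodS V (jet u) h 0 (2 * (μ - 1 : ℕ)) (fun x t => F x t * F x t) :=
    fun hF hd => GoodS.mono (GoodS.cast_even (e := 0) (GoodS.mul (e := 1) (e' := 1) hV hF hF)) hd
  have a2 := sq a (by omega)
  have b2 := sq b (by omega)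
  have c2 := sq c (by omega)
  have r := hd.add hV (GoodS.mul₀ hV (GoodS.const (PowerSeries.C (1 / 4)))
    ((a2.add hV b2).sub hV c2))
  refine ⟨fun x t => (∑ k ∈ Finset.range (μ + 1), times τ t k * (x ^ 2) ^ k) ^ 2,
    (r.mono (by omega)).congr fun x t hp => ?_⟩
  obtain ⟨e0, e1, e2⟩ := laxD_entries (u := u) x t hμ hτ
  have key := W.waveTau_sq hp
  rw [e0, e1, e2] at key
  have h4 : (4 : PowerSeries ℂ) * PowerSeries.C (1 / 4) = 1 := by
    rw [← map_ofNat (PowerSeries.C (R := ℂ)) 4, ← map_mul]; norm_num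
  have hT : PowerSeries.C (∑ k ∈ Finset.range (μ + 1), times τ t k * (x ^ 2) ^ k)
      = (timesSum τ μ (fun k _ => X ^ k) t).eval (PowerSeries.C (x ^ 2)) := by
    simp [timesSum, eval_finsetSum]
  rw [map_pow, hT, detPoly]
  simp only [eval_add, eval_sub, eval_mul, eval_X]
  have hx : PowerSeries.C (x ^ 2) = PowerSeries.C x * PowerSeries.C x := by rw [pow_two, map_mul]
  rw [hx] at key ⊢
  linear_combination PowerSeries.C (1 / 4) * key
    + ((timesSum τ μ (polyA u) t).eval (PowerSeries.C x * PowerSeries.C x) ^ 2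
      + (PowerSeries.C x * (timesSum τ μ (polyB u) t).eval (PowerSeries.C x * PowerSeries.C x)) ^ 2
      - (timesSum τ μ (polyC u) t).eval (PowerSeries.C x * PowerSeries.C x) ^ 2
      - waveTau (laxD m τ u) Ψ x t * waveTau (laxD m τ u) Ψ x t) * h4

/-- The coefficients of positive order of `N⁻¹ W_1` are odd and of order `x⁻²` at infinity. -/
theorem IsStringSolution.good_waveTau {y : ℂ → ℂ → ℂ} {Ψ : FormalMatrix}
    (W : IsWave V u h y (laxD m τ u) Ψ) (hS : GoodTriple V (jet u) h Ψ)
    {μ : ℕ} (h1 : 1 ≤ μ) (hμ : μ ≤ m) (hτ : ∀ k, μ < k → k ≤ m → τ k = 0)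
    (Q : ℂ → ℂ[X]) (hQ : ∀ x t, (x, t) ∈ V → y x t = h x t * (Q t).eval x)
    (hQ' : ∀ x t, (x, t) ∈ V → Q t ≠ 0 ∧ (Q t).natDegree = 2 * μ - 1) (n : ℕ) :
    Good V (jet u) h 1 (-2) (fun x t => PowerSeries.coeff (n + 1) (waveTau (laxD m τ u) Ψ x t)) := by
  obtain ⟨T, hT⟩ := hu.goodS_waveTau_sq hV hU hVU W hS h1 hμ hτ
  induction n using Nat.strong_induction_on with
  | _ n ih =>
    have hs : Good V (jet u) h 0 (2 * μ - 2) (fun x t => ∑ i ∈ Finset.range n,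
        PowerSeries.coeff (i + 1) (waveTau (laxD m τ u) Ψ x t)
          * PowerSeries.coeff (n + 1 - (i + 1)) (waveTau (laxD m τ u) Ψ x t)) := by
      refine Good.sum hV _ (F := fun i x t => PowerSeries.coeff (i + 1) (waveTau (laxD m τ u) Ψ x t)
          * PowerSeries.coeff (n + 1 - (i + 1)) (waveTau (laxD m τ u) Ψ x t)) fun i hi => ?_
      have hi' := Finset.mem_range.1 hi
      have i2 := ih (n + 1 - (i + 1) - 1) (by omega)
      rw [show n + 1 - (i + 1) - 1 + 1 = n + 1 - (i + 1) by omega] at i2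
      exact (Good.cast_even (e := 0) ((ih i hi').mul i2)).mono (by omega)
    -- At order n + 1 the square is 2 y times the new coefficient plus products of earlier ones,
    -- which are of degree -4.
    have hy : Good V (jet u) h 0 (2 * μ - 2)
        (fun x t => y x t * PowerSeries.coeff (n + 1) (waveTau (laxD m τ u) Ψ x t)) := by
      have := ((Good.const (1 / 2)).mul₀ ((hT (n + 1)).sub hV hs))
      refine this.congr fun x t hp => ?_
      rw [map_add, PowerSeries.coeff_C, if_neg (Nat.succ_ne_zero n), coeff_mul_range,
        Finset.sum_range_succ', Finset.sum_range_succ, PowerSeries.coeff_zero_eq_constantCoeff_apply,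
        W.constantCoeff_waveTau hp]
      simp only [Nat.sub_self, Nat.sub_zero, PowerSeries.coeff_zero_eq_constantCoeff_apply,
        W.constantCoeff_waveTau hp]
      ring
    -- Division by y = h Q with deg Q = 2μ - 1 leaves the degree (2μ - 2) - (2μ - 1) - 1 = -2.
    exact (Good.of_mul hV (hu.goodS_waveTau hV hU hVU hS hμ hτ (n + 1)) Q hQ hQ' hy).mono
      (by omega)

end entries

/-! ### The spectral curve -/

section curve

open Polynomial

/-- The polynomial `y / √(u_0² - x²)` in `x`. -/
def curvePoly (m : ℕ) (τ : ℕ → ℂ) (s : ℂ) : ℂ[X] :=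
  ∑ j ∈ Finset.Icc 1 m, ∑ k ∈ Finset.range j,
    C (τ j * ((2 * k).factorial / (2 ^ (2 * k) * (k.factorial : ℂ) ^ 2)) * s ^ (2 * k))
      * X ^ (2 * (j - k) - 1)

theorem yLax_eq (m : ℕ) (τ : ℕ → ℂ) (u : ℂ → PowerSeries ℂ) (g : ℂ → ℂ → ℂ) (x t : ℂ) :
    yLax m τ u g x t = rootH u g x t * (curvePoly m τ (u0 u t)).eval x := by
  rw [yLax, curvePoly]
  simp only [eval_finsetSum, Finset.mul_sum, eval_mul, eval_C, eval_pow, eval_X]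
  exact Finset.sum_congr rfl fun j _ => Finset.sum_congr rfl fun k _ => by ring

/-- The exponent 2(j - k) - 1 attains 2μ - 1 only at j = μ, k = 0 among the nonzero terms, with
coefficient t_μ. The degree is thus the same for all values of u_0. -/
theorem natDegree_curvePoly {m μ : ℕ} {τ : ℕ → ℂ} (h1 : 1 ≤ μ) (hμ : μ ≤ m) (h0 : τ μ ≠ 0)
    (hτ : ∀ k, μ < k → k ≤ m → τ k = 0) (s : ℂ) :
    curvePoly m τ s ≠ 0 ∧ (curvePoly m τ s).natDegree = 2 * μ - 1 := by
  have hc : (curvePoly m τ s).coeff (2 * μ - 1) = τ μ := by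
    rw [curvePoly, finsetSum_coeff, Finset.sum_eq_single μ]
    · rw [finsetSum_coeff, Finset.sum_eq_single 0]
      · simp
      · intro k hk hk0
        have := Finset.mem_range.1 hk
        rw [coeff_C_mul, coeff_X_pow, if_neg (by omega), mul_zero]
      · intro h; exact absurd (Finset.mem_range.2 (by omega)) h
    · intro j hj hjμ
      have := Finset.mem_Icc.1 hj
      rw [finsetSum_coeff]
      refine Finset.sum_eq_zero fun k hk => ?_
      have := Finset.mem_range.1 hk
      rcases lt_or_gt_of_ne hjμ with h | h
      · rw [coeff_C_mul, coeff_X_pow, if_neg (by omega), mul_zero]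
      · rw [hτ j h (by omega)]; simp
    · intro h; exact absurd (Finset.mem_Icc.2 ⟨h1, hμ⟩) h
  have hc0 : (curvePoly m τ s).coeff (2 * μ - 1) ≠ 0 := by rwa [hc]
  refine ⟨fun h => hc0 (by rw [h, coeff_zero]), natDegree_eq_of_le_of_coeff_ne_zero ?_ hc0⟩
  refine natDegree_sum_le_of_forall_le _ _ fun j hj => natDegree_sum_le_of_forall_le _ _ fun k hk => ?_
  have := Finset.mem_Icc.1 hj
  have := Finset.mem_range.1 hk
  by_cases h : μ < j
  · rw [hτ j h (by omega)]; simp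
  · exact (natDegree_C_mul_X_pow_le _ _).trans (by omega)

end curve

end MinimalModel

end

noncomputable section

namespace MinimalModel

/-! ### The Euler derivation -/

/-- The derivation `X d/dX` of formal series. -/
def eulerD (F : PowerSeries ℂ) : PowerSeries ℂ := PowerSeries.mk fun k => k * PowerSeries.coeff k F

@[simp] theorem coeff_eulerD (F : PowerSeries ℂ) (k : ℕ) :
    PowerSeries.coeff k (eulerD F) = k * PowerSeries.coeff k F := by
  simp [eulerD]

theorem eulerD_mul (F G : PowerSeries ℂ) : eulerD (F * G) = eulerD F * G + F * eulerD G := by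
  ext k
  simp only [coeff_eulerD, map_add, PowerSeries.coeff_mul, Finset.mul_sum, ← Finset.sum_add_distrib]
  refine Finset.sum_congr rfl fun p hp => ?_
  rw [← Finset.HasAntidiagonal.mem_antidiagonal.1 hp]
  push_cast
  ring

theorem dX_eulerD {F : ℂ → ℂ → PowerSeries ℂ} (x t : ℂ) :
    dX (fun x t => eulerD (F x t)) x t = eulerD (dX F x t) := by
  ext k; simp [dX]

theorem dT_eulerD {F : ℂ → ℂ → PowerSeries ℂ} (x t : ℂ) :
    dT (fun x t => eulerD (F x t)) x t = eulerD (dT F x t) := by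
  ext k; simp [dT]

/-! ### Rational functions of `z` -/

/-- Rational functions of `z` with coefficients rational in the jet `j`, and poles only at
`0, ±i, ∞`. -/
def RatZ (V : Set (ℂ × ℂ)) (j : ℂ → ℕ → ℂ) (z F : ℂ → ℂ → ℂ) : Prop :=
  ∃ (α β r : ℕ) (P : Polynomial (MvPolynomial ℕ ℂ)), ∀ x t, (x, t) ∈ V →
    F x t * (j t 0 ^ r * z x t ^ α * (z x t ^ 2 + 1) ^ β) = polyAt j P (z x t) t

theorem isFunAlgebra_ratZ (V : Set (ℂ × ℂ)) (j : ℂ → ℕ → ℂ) (z : ℂ → ℂ → ℂ) :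
    IsFunAlgebra V (RatZ V j z) where
  congr := fun ⟨α, β, r, P, h⟩ hFG => ⟨α, β, r, P, fun x t hp => by rw [hFG x t hp, h x t hp]⟩
  const c := ⟨0, 0, 0, Polynomial.C (MvPolynomial.C c), fun x t _ => by simp⟩
  add := by
    rintro F G ⟨α, β, r, P, h⟩ ⟨α', β', r', P', h'⟩
    refine ⟨α + α', β + β', r + r', P * (Polynomial.C (MvPolynomial.X 0 ^ r') * Polynomial.X ^ α'
      * (Polynomial.X ^ 2 + 1) ^ β') + P' * (Polynomial.C (MvPolynomial.X 0 ^ r) * Polynomial.X ^ α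
      * (Polynomial.X ^ 2 + 1) ^ β), fun x t hp => ?_⟩
    have h1 : ∀ z, polyAt j 1 z t = 1 := fun z => by simp [polyAt]
    simp only [polyAt_add, polyAt_mul, polyAt_pow, polyAt_C, polyAt_X, map_pow, MvPolynomial.eval_X,
      ← h x t hp, ← h' x t hp, h1]
    ring
  mul := by
    rintro F G ⟨α, β, r, P, h⟩ ⟨α', β', r', P', h'⟩
    refine ⟨α + α', β + β', r + r', P * P', fun x t hp => ?_⟩
    rw [polyAt_mul, ← h x t hp, ← h' x t hp]
    ring

theorem IsFunAlgebra.pow {V : Set (ℂ × ℂ)} {K : (ℂ → ℂ → ℂ) → Prop} (hK : IsFunAlgebra V K)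
    {F : ℂ → ℂ → ℂ} (hF : K F) (n : ℕ) : K (fun x t => F x t ^ n) := by
  induction n with
  | zero => simpa using hK.const 1
  | succ n ih => simpa only [pow_succ] using hK.mul ih hF

/-- `z` is a square root of `(j_0 - x) / (j_0 + x)`, and `h = (j_0 + x) z`. -/
structure IsUniformizer (V : Set (ℂ × ℂ)) (j : ℂ → ℕ → ℂ) (h z : ℂ → ℂ → ℂ) : Prop where
  add_ne : ∀ {x t}, (x, t) ∈ V → j t 0 + x ≠ 0
  z_ne : ∀ {x t}, (x, t) ∈ V → z x t ≠ 0
  z_sq : ∀ {x t}, (x, t) ∈ V → z x t ^ 2 * (j t 0 + x) = j t 0 - x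
  h_eq : ∀ {x t}, (x, t) ∈ V → h x t = (j t 0 + x) * z x t

namespace IsUniformizer

variable {V : Set (ℂ × ℂ)} {j : ℂ → ℕ → ℂ} {h z : ℂ → ℂ → ℂ} (hz : IsUniformizer V j h z)
  (hV : CurveDomain V j h)
include hz hV

theorem sq_add_one_ne {x t : ℂ} (hp : (x, t) ∈ V) : z x t ^ 2 + 1 ≠ 0 := by
  intro h0
  have h1 := hz.z_sq hp
  have h2 := hV.jet_ne hp
  apply h2
  linear_combination (j t 0 + x) / 2 * h0 - h1 / 2

omit hz hV in
theorem ratZ_z : RatZ V j z z := ⟨0, 0, 0, Polynomial.X, fun x t _ => by simp⟩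

omit hV in
theorem ratZ_inv_z : RatZ V j z (fun x t => (z x t)⁻¹) :=
  ⟨1, 0, 0, 1, fun x t hp => by simp [polyAt, hz.z_ne hp]⟩

/-- The curve is rational: x = u_0 (1 - z²)/(1 + z²) and h = 2 u_0 z/(1 + z²), whose zeros and poles
are at 0, ∞ and ±i, ±1; only x vanishes at ±1, and x is never inverted. -/
theorem ratZ_good {e : ℕ} {d : ℤ} {F : ℂ → ℂ → ℂ} (hF : Good V j h e d F) : RatZ V j z F := by
  have K := isFunAlgebra_ratZ V j z
  obtain ⟨b, r, P, h1, h2⟩ := hF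
  have hx : RatZ V j z (fun x _ => x) :=
    ⟨0, 1, 0, Polynomial.C (MvPolynomial.X 0) * (1 - Polynomial.X ^ 2), fun x t hp => by
      have := hz.z_sq hp
      simp [polyAt]
      linear_combination this⟩
  have hj : RatZ V j z (fun _ t => (j t 0)⁻¹) :=
    ⟨0, 0, 1, 1, fun x t hp => by simp [polyAt, hV.jet_ne hp]⟩
  have hh : RatZ V j z (fun x t => (h x t)⁻¹) := by
    refine ⟨1, 0, 1, Polynomial.C (MvPolynomial.C (1 / 2)) * (1 + Polynomial.X ^ 2),
      fun x t hp => ?_⟩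
    have h1 := hz.z_sq hp
    have h2 := hz.z_ne hp
    have h3 := hz.add_ne hp
    simp only [hz.h_eq hp, polyAt_mul, polyAt_add, polyAt_pow, polyAt_C, polyAt_X, pow_one, pow_zero,
      MvPolynomial.eval_C]
    have : polyAt j 1 (z x t) t = 1 := by simp [polyAt]
    rw [this]
    field_simp
    linear_combination -h1
  have hE : ∀ p : MvPolynomial ℕ ℂ, RatZ V j z (fun _ t => MvPolynomial.eval (j t) p) := fun p =>
    ⟨0, 0, 0, Polynomial.C p, fun x t _ => by simp⟩
  refine K.congr (K.mul (K.mul (K.pow hj r) (K.pow hh (2 * b + e))) (K.sum (Finset.range (P.natDegree + 1))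
    (F := fun i x t => MvPolynomial.eval (j t) (P.coeff i) * x ^ i)
    fun i _ => K.mul (hE (P.coeff i)) (K.pow hx i))) fun x t hp => ?_
  rw [← polyAt_eq_sum j x t P (Nat.lt_succ_self _), ← h2 x t hp]
  have h1 := hV.jet_ne hp
  have h3 := hV.h_ne hp
  simp only [inv_pow]
  field_simp

end IsUniformizer

/-! ### Holomorphic series with an odd logarithmic derivative -/

/-- A formal series with constant coefficient `1` whose logarithmic derivatives are odd is rational
in `z`. -/
theorem ratZ_of_logDeriv {V : Set (ℂ × ℂ)} {j : ℂ → ℕ → ℂ} {h z : ℂ → ℂ → ℂ}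
    (hz : IsUniformizer V j h z) (hV : CurveDomain V j h) (hc : IsPreconnected V)
    {E f k : ℂ → ℂ → PowerSeries ℂ} (hE : SeriesIn (Hol V) E)
    (hE0 : ∀ x t, (x, t) ∈ V → PowerSeries.constantCoeff (E x t) = 1)
    (hf : GoodS V j h 1 (-2) f) {d : ℤ} (hk : GoodS V j h 1 d k)
    (hEx : ∀ x t, (x, t) ∈ V → dX E x t = E x t * f x t)
    (hEt : ∀ x t, (x, t) ∈ V → dT E x t = E x t * k x t) :
    SeriesIn (RatZ V j z) E := by
  have K := isFunAlgebra_ratZ V j z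
  have H := isFunAlgebra_hol V
  have hEne : ∀ x t, (x, t) ∈ V → E x t ≠ 0 := fun x t hp h0 => by
    have := hE0 x t hp
    rw [h0, map_zero] at this
    exact zero_ne_one this
  have hEE : ∀ x t, (x, t) ∈ V → E x t * (E x t)⁻¹ = 1 := fun x t hp =>
    PowerSeries.mul_inv_cancel _ (by rw [hE0 x t hp]; exact one_ne_zero)
  have hinv : SeriesIn (Hol V) (fun x t => (E x t)⁻¹) := by
    refine H.seriesOf_mul hE ?_ hE0
    exact H.seriesCongr (H.seriesConst 1) hEE
  have hEu : SeriesIn (Hol V) (fun x t => eulerD (E x t)) := fun n =>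
    H.congr (H.mul (H.const n) (hE n)) fun x t _ => coeff_eulerD _ _
  -- θ = X d/dX log E stands in for log E: its x- and t-derivatives are the Euler derivatives of the
  -- logarithmic derivatives f and k, and E is recovered from it recursively.
  set θ : ℂ → ℂ → PowerSeries ℂ := fun x t => eulerD (E x t) * (E x t)⁻¹ with hθdef
  have hθ : SeriesIn (Hol V) θ := H.seriesMul hEu hinv
  have hθE : ∀ x t, (x, t) ∈ V → θ x t * E x t = eulerD (E x t) := fun x t hp => by
    rw [hθdef]
    linear_combination eulerD (E x t) * hEE x t hp
  have hθx : ∀ x t, (x, t) ∈ V → dX θ x t = eulerD (f x t) := fun x t hp => by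
    have e1 := dX_congr hV.isOpen hp hθE
    rw [dX_mul hV.isOpen hp hθ hE, dX_eulerD, hEx x t hp, eulerD_mul, ← hθE x t hp] at e1
    exact mul_left_cancel₀ (hEne x t hp) (by linear_combination e1)
  have hθt : ∀ x t, (x, t) ∈ V → dT θ x t = eulerD (k x t) := fun x t hp => by
    have e1 := dT_congr hV.isOpen hp hθE
    rw [dT_mul hV.isOpen hp hθ hE, dT_eulerD, hEt x t hp, eulerD_mul, ← hθE x t hp] at e1
    exact mul_left_cancel₀ (hEne x t hp) (by linear_combination e1)
  have hθR : SeriesIn (RatZ V j z) θ := by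
    intro n
    obtain ⟨Θ, hΘ, hΘx⟩ := (hf n).hasOddPrimitive hV
    obtain ⟨Θt, hΘt, hΘt'⟩ := hΘ.hasDerivAt_t hV
    -- The n-th coefficient of θ and n times the odd primitive of f_n have the same x-derivative.
    -- Their difference has an odd t-derivative, so on the connected set V it is a constant.
    obtain ⟨c, hc'⟩ := Good.exists_eq_const hV hc
      (F := fun x t => PowerSeries.coeff n (θ x t) - n * Θ x t)
      (G := fun x t => n * PowerSeries.coeff n (k x t) - n * Θt x t) (d := max d 0)
      (DifferentiableOn.sub (hθ n) (DifferentiableOn.mul (differentiableOn_const _)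
        (hΘ.differentiableOn hV)))
      (fun x t hp => by
        have h1 := (hθ.differentiableAt_x hV.isOpen hp n).hasDerivAt
        have h2 := congrArg (PowerSeries.coeff n) (hθx x t hp)
        rw [coeff_eulerD] at h2
        simp only [dX, PowerSeries.coeff_mk] at h2
        rw [h2] at h1
        simpa using h1.fun_sub ((hΘx x t hp).const_mul (n : ℂ)))
      (fun x t hp => by
        have h1 := (hθ.differentiableAt_t hV.isOpen hp n).hasDerivAt
        have h2 := congrArg (PowerSeries.coeff n) (hθt x t hp)
        rw [coeff_eulerD] at h2
        simp only [dT, PowerSeries.coeff_mk] at h2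
        rw [h2] at h1
        exact h1.fun_sub ((hΘt' x t hp).const_mul (n : ℂ)))
      (Good.sub hV ((Good.mul₀ (Good.const n) (hk n)).mono (le_max_left _ _))
        ((Good.mul₀ (Good.const n) hΘt).mono (le_max_right _ _)))
    refine K.congr (K.add (K.const c) (K.mul (K.const n) (hz.ratZ_good hV hΘ))) fun x t hp => ?_
    have := hc' x t hp
    linear_combination this
  intro n
  induction n using Nat.strong_induction_on with
  | _ n ih =>
    rcases n with _ | n
    · exact K.congr (K.const 1) fun x t hp => by simpa using hE0 x t hp
    -- From θ E = X dE/dX: since θ has no constant term, (n + 1) E_{n+1} involves only earlier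
    -- coefficients of E.
    refine K.congr (K.mul (K.const (1 / ((n : ℂ) + 1))) (K.sum (Finset.range (n + 1))
      (F := fun i x t => PowerSeries.coeff (i + 1) (θ x t)
        * PowerSeries.coeff (n + 1 - (i + 1)) (E x t))
      fun i hi => K.mul (hθR (i + 1)) (ih _ ?_))) fun x t hp => ?_
    · have := Finset.mem_range.1 hi
      omega
    · have e := congrArg (PowerSeries.coeff (n + 1)) (hθE x t hp)
      have hn : (n : ℂ) + 1 ≠ 0 := by exact_mod_cast Nat.succ_ne_zero n
      have h0 : PowerSeries.coeff 0 (θ x t) = 0 := by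
        rw [hθdef, PowerSeries.coeff_zero_eq_constantCoeff_apply, map_mul,
          ← PowerSeries.coeff_zero_eq_constantCoeff_apply, coeff_eulerD]
        simp
      rw [coeff_mul_range, Finset.sum_range_succ', h0, coeff_eulerD, zero_mul, add_zero] at e
      rw [e]
      push_cast
      field_simp

/-- In X dE/E = X(da/a + dc/c - db/b - dd'/d) the diagonal entries cancel, and ad - bc = 1 turns the
rest into D10/(cd) - D01/(ab) - 4y. The factor 1 - A² = -4abcd clears these denominators. The
statement keeps the factor bd in place of dividing by it. -/
theorem ratio_aux {Λ : Type*} [CommRing Λ] {X E dE y D00 D01 D10 D11 a b c d da db dc dd' : Λ}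
    (hdet : a * d - b * c = 1) (hE : E * (b * d) = -(a * c))
    (h1 : dE * (b * d) + E * (db * d + b * dd') = -(da * c + a * dc))
    (ha : X * da = D00 * a + D01 * c - y * a) (hb : X * db = D00 * b + D01 * d + y * b)
    (hc : X * dc = D10 * a + D11 * c - y * c) (hd : X * dd' = D10 * b + D11 * d + y * d) :
    X * (dE * (1 - (a * d + b * c) * (a * d + b * c))) * (b * d)
      = E * (4 * (D01 * (c * d) - D10 * (a * b)) - 4 * (y * (1 - (a * d + b * c) * (a * d + b * c))))
        * (b * d) := by
  have hk : 1 - (a * d + b * c) * (a * d + b * c) = -4 * ((a * c) * (b * d)) := by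
    linear_combination -(a * d - b * c + 1) * hdet
  have s1 : X * dE * (b * d) = -(D01 * c ^ 2 + D10 * a ^ 2) - E * (D01 * d ^ 2 + D10 * b ^ 2)
      - 4 * (y * (E * (b * d))) := by
    linear_combination X * h1 - E * (d * hb + b * hd) - c * ha - a * hc + (2 * y - D00 - D11) * hE
  linear_combination (1 - (a * d + b * c) * (a * d + b * c)) * s1
    + (-(D01 * c ^ 2 + D10 * a ^ 2) - E * (D01 * d ^ 2 + D10 * b ^ 2)) * hk
    + 4 * (b * d) * (D01 * c ^ 2 + D10 * a ^ 2) * hE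
    + 4 * E * (b * d) * (D01 * (c * d) - D10 * (a * b)) * hdet

namespace IsWave

variable {V : Set (ℂ × ℂ)} {u : ℂ → PowerSeries ℂ} {h y : ℂ → ℂ → ℂ}
    {D Ψ : FormalMatrix} (W : IsWave V u h y D Ψ)
include W

/-- The logarithmic `x`-derivative of the ratio of the products of the entries of the columns. -/
theorem dX_ratio {E : ℂ → ℂ → PowerSeries ℂ} (hE : SeriesIn (Hol V) E)
    (hEP : ∀ x t, (x, t) ∈ V → E x t * (Ψ x t 0 1 * Ψ x t 1 1) = -(Ψ x t 0 0 * Ψ x t 1 0))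
    {x t : ℂ} (hp : (x, t) ∈ V) (hR : Ψ x t 0 1 * Ψ x t 1 1 ≠ 0) :
    PowerSeries.X * (dX E x t * (1 - sA Ψ x t * sA Ψ x t))
      = E x t * (4 * ((waveTau D Ψ x t - PowerSeries.C (y x t)) * (1 - sA Ψ x t * sA Ψ x t))
        + PowerSeries.X * (2 * (sA Ψ x t * (dX (sB Ψ) x t * sC Ψ x t
          - dX (sC Ψ) x t * sB Ψ x t)))) := by
  have e1 := dX_congr W.isOpen hp hEP
  rw [MinimalModel.dX_mul W.isOpen hp hE (W.hol_mul 0 1 1 1), dX_neg, W.dX_mul hp, W.dX_mul hp] at e1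
  refine mul_right_cancel₀ hR ?_
  have key := ratio_aux (W.det hp) (hEP x t hp) e1 (W.eqX0 0 hp) (W.eqX1 0 hp) (W.eqX0 1 hp)
    (W.eqX1 1 hp)
  rw [← sA] at key
  have h4 : 4 * waveTau D Ψ x t = 4 * (D x t 0 0 * sA Ψ x t)
      + 2 * (D x t 0 1 * (sB Ψ x t - sC Ψ x t) + D x t 1 0 * (sB Ψ x t + sC Ψ x t)) := by
    rw [waveTau, sB, sC]; ring
  have h5 : 2 * (D x t 0 1 * (sB Ψ x t - sC Ψ x t) + D x t 1 0 * (sB Ψ x t + sC Ψ x t))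
      = 4 * (D x t 0 1 * (Ψ x t 1 0 * Ψ x t 1 1) - D x t 1 0 * (Ψ x t 0 0 * Ψ x t 0 1)) := by
    rw [sB, sC]; ring
  -- The entries of D grow at infinity; the x-equations for B and C trade them for `waveTau` and
  -- derivatives of S, whose orders are under control.
  have h6 : 4 * (waveTau D Ψ x t * (1 - sA Ψ x t * sA Ψ x t))
      + PowerSeries.X * (2 * (sA Ψ x t * (dX (sB Ψ) x t * sC Ψ x t - dX (sC Ψ) x t * sB Ψ x t)))
      = 2 * (D x t 0 1 * (sB Ψ x t - sC Ψ x t) + D x t 1 0 * (sB Ψ x t + sC Ψ x t)) := by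
    linear_combination (1 - sA Ψ x t * sA Ψ x t) * h4
      + 2 * sA Ψ x t * (sC Ψ x t * W.dX_sB hp - sB Ψ x t * W.dX_sC hp)
      - 4 * (D x t 0 0 * sA Ψ x t) * W.sq_eq_one hp
  linear_combination key - E x t * (Ψ x t 0 1 * Ψ x t 1 1) * (h5 + h6)

/-- The logarithmic `t`-derivative of the ratio of the products of the entries of the columns. -/
theorem dT_ratio {E : ℂ → ℂ → PowerSeries ℂ} (hE : SeriesIn (Hol V) E)
    (hEP : ∀ x t, (x, t) ∈ V → E x t * (Ψ x t 0 1 * Ψ x t 1 1) = -(Ψ x t 0 0 * Ψ x t 1 0))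
    {x t : ℂ} (hp : (x, t) ∈ V) (hR : Ψ x t 0 1 * Ψ x t 1 1 ≠ 0) :
    PowerSeries.X * (dT E x t * (1 - sA Ψ x t * sA Ψ x t))
      = E x t * (2 * ((PowerSeries.C x + u t) * (sB Ψ x t - sC Ψ x t)
          + (u t - PowerSeries.C x) * (sB Ψ x t + sC Ψ x t))
        - 4 * (PowerSeries.C (h x t) * (1 - sA Ψ x t * sA Ψ x t))) := by
  have e1 := dT_congr W.isOpen hp hEP
  rw [MinimalModel.dT_mul W.isOpen hp hE (W.hol_mul 0 1 1 1), dT_neg, W.dT_mul hp, W.dT_mul hp] at e1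
  refine mul_right_cancel₀ hR ?_
  have key := ratio_aux (X := PowerSeries.X) (y := PowerSeries.C (h x t)) (D00 := 0) (D11 := 0)
    (D01 := PowerSeries.C x + u t) (D10 := u t - PowerSeries.C x) (W.det hp) (hEP x t hp) e1
    (by linear_combination W.eqT00 hp) (by linear_combination W.eqT01 hp)
    (by linear_combination W.eqT10 hp) (by linear_combination W.eqT11 hp)
  rw [← sA] at key
  have h5 : 2 * ((PowerSeries.C x + u t) * (sB Ψ x t - sC Ψ x t)
      + (u t - PowerSeries.C x) * (sB Ψ x t + sC Ψ x t))
      = 4 * ((PowerSeries.C x + u t) * (Ψ x t 1 0 * Ψ x t 1 1)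
        - (u t - PowerSeries.C x) * (Ψ x t 0 0 * Ψ x t 0 1)) := by
    rw [sB, sC]; ring
  linear_combination key - E x t * (Ψ x t 0 1 * Ψ x t 1 1) * h5

/-- The ratio of the products of the entries of the columns is rational in `z`. -/
theorem ratZ_ratio {j : ℂ → ℕ → ℂ} {z : ℂ → ℂ → ℂ}
    (hz : IsUniformizer V j h z) (hV : CurveDomain V j h) (hc : IsPreconnected V)
    (hu : GoodS V j h 0 0 (fun _ t => u t)) (hS : GoodTriple V j h Ψ)
    (hA0 : ∀ x t, (x, t) ∈ V → PowerSeries.constantCoeff (sA Ψ x t) = 0)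
    (hτ : ∀ n, Good V j h 1 (-2) (fun x t => PowerSeries.coeff (n + 1) (waveTau D Ψ x t)))
    {E : ℂ → ℂ → PowerSeries ℂ} (hE : SeriesIn (Hol V) E)
    (hE0 : ∀ x t, (x, t) ∈ V → PowerSeries.constantCoeff (E x t) = 1)
    (hEP : ∀ x t, (x, t) ∈ V → E x t * (Ψ x t 0 1 * Ψ x t 1 1) = -(Ψ x t 0 0 * Ψ x t 1 0))
    (hR : ∀ x t, (x, t) ∈ V → Ψ x t 0 1 * Ψ x t 1 1 ≠ 0) :
    SeriesIn (RatZ V j z) E := by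
  have HG := hV.isFunAlgebra_good
  have hk0 : ∀ x t, (x, t) ∈ V →
      PowerSeries.constantCoeff (1 - sA Ψ x t * sA Ψ x t) = 1 := fun x t hp => by
    simp [hA0 x t hp]
  have hkk : ∀ x t, (x, t) ∈ V →
      (1 - sA Ψ x t * sA Ψ x t) * (1 - sA Ψ x t * sA Ψ x t)⁻¹ = 1 := fun x t hp =>
    PowerSeries.mul_inv_cancel _ (by rw [hk0 x t hp]; exact one_ne_zero)
  have hinv : GoodS V j h 0 0 (fun x t => (1 - sA Ψ x t * sA Ψ x t)⁻¹) := by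
    refine HG.seriesOf_mul (F := fun x t => 1 - sA Ψ x t * sA Ψ x t) ?_ ?_ hk0
    · exact GoodS.sub hV (GoodS.const 1)
        (GoodS.mono (GoodS.cast_even (e := 0) (GoodS.mul hV (e := 1) (e' := 1) hS.A hS.A)) (by norm_num))
    · exact HG.seriesCongr (GoodS.const 1) hkk
  have hB := hS.B.mono (by norm_num : (-1 : ℤ) ≤ 0)
  have h2 : ∀ {e : ℕ} {d : ℤ} {F : ℂ → ℂ → PowerSeries ℂ}, GoodS V j h e d F →
      GoodS V j h e d (fun x t => 2 * F x t) := fun hF => GoodS.mul₀ hV (GoodS.const 2) hF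
  have h4 : ∀ {e : ℕ} {d : ℤ} {F : ℂ → ℂ → PowerSeries ℂ}, GoodS V j h e d F →
      GoodS V j h e d (fun x t => 4 * F x t) := fun hF => GoodS.mul₀ hV (GoodS.const 4) hF
  have hsh : GoodS V j h 1 (-2)
      (fun x t => PowerSeries.mk fun n => PowerSeries.coeff (n + 1) (waveTau D Ψ x t)) :=
    fun n => (hτ n).congr fun x t _ => PowerSeries.coeff_mk _ _
  have hq : GoodS V j h 1 (-2) (fun x t => 2 * (sA Ψ x t * (dX (sB Ψ) x t * sC Ψ x t
      - dX (sC Ψ) x t * sB Ψ x t))) := by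
    have := GoodS.mul hV hS.A (((hS.B.dX hV).mul hV hS.C).sub hV
      (((hS.C.dX hV).mul hV hS.B).mono (by norm_num)))
    exact h2 (GoodS.mono (GoodS.cast_even (e := 1) this) (by norm_num))
  have hXu : GoodS V j h 0 1 (fun x t => PowerSeries.C x + u t) :=
    GoodS.add hV (GoodS.ofC Good.x) (hu.mono (by norm_num))
  have huX : GoodS V j h 0 1 (fun x t => u t - PowerSeries.C x) :=
    GoodS.sub hV (hu.mono (by norm_num)) (GoodS.ofC Good.x)
  have hT : GoodS V j h 1 1 (fun x t => 2 * ((PowerSeries.C x + u t) * (sB Ψ x t - sC Ψ x t)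
      + (u t - PowerSeries.C x) * (sB Ψ x t + sC Ψ x t)) * (1 - sA Ψ x t * sA Ψ x t)⁻¹
      - 4 * PowerSeries.C (h x t)) := by
    have a1 := h2 ((hXu.mul hV (hB.sub hV hS.C)).add hV (huX.mul hV (hB.add hV hS.C)))
    have a2 := GoodS.mul hV (e := 1) (e' := 0) (GoodS.mono (e := 1) a1 (by norm_num : _ ≤ (1 : ℤ))) hinv
    exact GoodS.sub hV a2 (h4 (GoodS.ofC (Good.sqrt hV)))
  have hEne : ∀ x t, (x, t) ∈ V → E x t ≠ 0 := fun x t hp h0 => by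
    have := hE0 x t hp
    rw [h0, map_zero] at this
    exact zero_ne_one this
  have hT0 : ∀ x t, (x, t) ∈ V → PowerSeries.X * dT E x t = E x t
      * (2 * ((PowerSeries.C x + u t) * (sB Ψ x t - sC Ψ x t)
      + (u t - PowerSeries.C x) * (sB Ψ x t + sC Ψ x t)) * (1 - sA Ψ x t * sA Ψ x t)⁻¹
      - 4 * PowerSeries.C (h x t)) := fun x t hp => by
    linear_combination (1 - sA Ψ x t * sA Ψ x t)⁻¹ * W.dT_ratio hE hEP hp (hR x t hp)
      - (PowerSeries.X * dT E x t + 4 * E x t * PowerSeries.C (h x t)) * hkk x t hp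
  refine ratZ_of_logDeriv hz hV hc hE hE0 (d := 1)
    (GoodS.add hV (h4 hsh) (GoodS.mul hV (e := 1) (e' := 0) hq hinv))
    (k := fun x t => PowerSeries.mk fun n => PowerSeries.coeff (n + 1)
      (2 * ((PowerSeries.C x + u t) * (sB Ψ x t - sC Ψ x t)
      + (u t - PowerSeries.C x) * (sB Ψ x t + sC Ψ x t)) * (1 - sA Ψ x t * sA Ψ x t)⁻¹
      - 4 * PowerSeries.C (h x t)))
    (fun n => (hT (n + 1)).congr fun x t _ => PowerSeries.coeff_mk _ _) ?_ ?_
  · intro x t hp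
    have e1 := W.dX_ratio hE hEP hp (hR x t hp)
    have e2 : waveTau D Ψ x t - PowerSeries.C (y x t) = PowerSeries.X *
        PowerSeries.mk fun n => PowerSeries.coeff (n + 1) (waveTau D Ψ x t) := by
      have := PowerSeries.eq_X_mul_shift_add_const (waveTau D Ψ x t)
      rw [W.constantCoeff_waveTau hp] at this
      linear_combination this
    rw [e2] at e1
    refine mul_left_cancel₀ PowerSeries.X_ne_zero ?_
    linear_combination (1 - sA Ψ x t * sA Ψ x t)⁻¹ * e1
      - (PowerSeries.X * dX E x t - E x t * (4 * (PowerSeries.X *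
        PowerSeries.mk fun n => PowerSeries.coeff (n + 1) (waveTau D Ψ x t)))) * hkk x t hp
  · intro x t hp
    set G := 2 * ((PowerSeries.C x + u t) * (sB Ψ x t - sC Ψ x t)
      + (u t - PowerSeries.C x) * (sB Ψ x t + sC Ψ x t)) * (1 - sA Ψ x t * sA Ψ x t)⁻¹
      - 4 * PowerSeries.C (h x t) with hG
    have e1 := hT0 x t hp
    rw [← hG] at e1
    -- X times the derivative of E is divisible by X while E is a unit, so G is divisible by X and
    -- can be shifted.
    have h0 : PowerSeries.constantCoeff G = 0 := by
      have := congrArg PowerSeries.constantCoeff e1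
      rw [map_mul, map_mul, hE0 x t hp, PowerSeries.constantCoeff_X, zero_mul, one_mul] at this
      exact this.symm
    have e2 := PowerSeries.eq_X_mul_shift_add_const G
    rw [h0, map_zero, add_zero] at e2
    refine mul_left_cancel₀ PowerSeries.X_ne_zero ?_
    linear_combination e1 + E x t * e2

end IsWave

end MinimalModel

end

/-! ### The WKB coefficients as rational functions of z -/

noncomputable section

namespace MinimalModel

section amplitude

variable {m : ℕ} {τ : ℕ → ℂ} {U : Set ℂ} {u : ℂ → PowerSeries ℂ} {V : Set (ℂ × ℂ)}
  {g : ℂ → ℂ → ℂ} {a : FormalMatrix}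

theorem inv_sqrt_two_sq : ((√2 : ℝ) : ℂ)⁻¹ * ((√2 : ℝ) : ℂ)⁻¹ = 1 / 2 := by
  rw [← mul_inv, ← Complex.ofReal_mul, Real.mul_self_sqrt (by norm_num)]
  norm_num

theorem amplitude_mul (x t : ℂ) (hg : g x t ≠ 0) :
    amplitude g a x t 0 0 * amplitude g a x t 0 1
      = -(PowerSeries.C (1 / 2 * g x t ^ 2) * (a x t 0 0 * a x t 0 1)) ∧
    amplitude g a x t 0 0 * amplitude g a x t 1 1
      = PowerSeries.C (1 / 2) * (a x t 0 0 * a x t 1 1) ∧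
    amplitude g a x t 0 0 * amplitude g a x t 1 0
      = PowerSeries.C (1 / 2) * (a x t 0 0 * a x t 1 0) ∧
    amplitude g a x t 0 1 * amplitude g a x t 1 0
      = -(PowerSeries.C (1 / 2) * (a x t 0 1 * a x t 1 0)) ∧
    amplitude g a x t 0 1 * amplitude g a x t 1 1
      = -(PowerSeries.C (1 / 2) * (a x t 0 1 * a x t 1 1)) ∧
    amplitude g a x t 1 0 * amplitude g a x t 1 1
      = PowerSeries.C (1 / 2 * (g x t)⁻¹ ^ 2) * (a x t 1 0 * a x t 1 1) := by
  have h2 := inv_sqrt_two_sq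
  have e1 : (g x t / ((√2 : ℝ) : ℂ)) * ((g x t)⁻¹ / ((√2 : ℝ) : ℂ)) = 1 / 2 := by
    rw [← h2]; field_simp
  have e2 : (g x t / ((√2 : ℝ) : ℂ)) * (g x t / ((√2 : ℝ) : ℂ)) = 1 / 2 * g x t ^ 2 := by
    rw [← h2]; ring
  have e3 : ((g x t)⁻¹ / ((√2 : ℝ) : ℂ)) * ((g x t)⁻¹ / ((√2 : ℝ) : ℂ)) = 1 / 2 * (g x t)⁻¹ ^ 2 := by
    rw [← h2]; ring
  have c1 := congrArg (PowerSeries.C (R := ℂ)) e1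
  have c2 := congrArg (PowerSeries.C (R := ℂ)) e2
  have c3 := congrArg (PowerSeries.C (R := ℂ)) e3
  rw [map_mul] at c1 c2 c3
  have a00 : amplitude g a x t 0 0 = PowerSeries.C (g x t / (√2 : ℝ)) * a x t 0 0 := rfl
  have a01 : amplitude g a x t 0 1 = -(PowerSeries.C (g x t / (√2 : ℝ)) * a x t 0 1) := by
    rw [← neg_mul, ← map_neg]; rfl
  have a10 : amplitude g a x t 1 0 = PowerSeries.C ((g x t)⁻¹ / (√2 : ℝ)) * a x t 1 0 := rfl
  have a11 : amplitude g a x t 1 1 = PowerSeries.C ((g x t)⁻¹ / (√2 : ℝ)) * a x t 1 1 := rfl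
  rw [a00, a01, a10, a11]
  refine ⟨?_, ?_, ?_, ?_, ?_, ?_⟩
  · linear_combination -(a x t 0 0 * a x t 0 1) * c2
  · linear_combination (a x t 0 0 * a x t 1 1) * c1
  · linear_combination (a x t 0 0 * a x t 1 0) * c1
  · linear_combination -(a x t 0 1 * a x t 1 0) * c1
  · linear_combination -(a x t 0 1 * a x t 1 1) * c1
  · linear_combination (a x t 1 0 * a x t 1 1) * c3

variable (hU : IsOpen U) (hu : IsStringSolution m τ U u) (hV : IsOpen V)
  (hVU : ∀ x t, (x, t) ∈ V → t ∈ U ∧ x ^ 2 ≠ u0 u t ^ 2)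

section uniformizer

variable (hVU : ∀ x t, (x, t) ∈ V → t ∈ U ∧ x ^ 2 ≠ u0 u t ^ 2)
    (hg4 : ∀ x t, (x, t) ∈ V → g x t ^ 4 = (u0 u t + x) / (u0 u t - x))
include hVU hg4

theorem branch_ne {x t : ℂ} (hp : (x, t) ∈ V) :
    u0 u t + x ≠ 0 ∧ u0 u t - x ≠ 0 ∧ g x t ≠ 0 := by
  have h1 := (hVU x t hp).2
  have a1 : u0 u t + x ≠ 0 := fun h => h1 (by linear_combination (x - u0 u t) * h)
  have a2 : u0 u t - x ≠ 0 := fun h => h1 (by linear_combination (-x - u0 u t) * h)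
  refine ⟨a1, a2, fun h => ?_⟩
  have := hg4 x t hp
  rw [h, eq_div_iff a2] at this
  exact a1 (by linear_combination -this)

theorem isUniformizer : IsUniformizer V (jet u) (rootH u g) (zVar g) where
  add_ne hp := by rw [jet_zero]; exact (branch_ne hVU hg4 hp).1
  z_ne hp := by
    have := (branch_ne hVU hg4 hp).2.2
    simp [zVar, this]
  z_sq {x t} hp := by
    obtain ⟨h1, h2, h3⟩ := branch_ne hVU hg4 hp
    have := hg4 x t hp
    rw [eq_div_iff h2] at this
    rw [jet_zero, zVar]
    field_simp
    linear_combination -this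
  h_eq hp := by rw [jet_zero, rootH]

end uniformizer

variable (hBA : IsBakerAkhiezer m τ u V g a)
include hU hu hV hVU hBA

theorem curveDomain_amplitude : CurveDomain V (jet u) (rootH u g) :=
  curveDomain hU hu hV hVU hBA.g_differentiableOn hBA.g_pow

omit hU hu in
theorem wave_amplitude : IsWave V u (rootH u g) (yLax m τ u g) (laxD m τ u) (amplitude g a) :=
  isWave_amplitude hV hBA fun _ _ hp => (branch_ne hVU hBA.g_pow hp).2.2

-- At leading order the amplitudes are the powers of the branch g, and g² = 1/z: thus B_0 = (z⁻¹ +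
-- z)/2 = u_0/h and C_0 = (z⁻¹ - z)/2 = x/h.
omit hU hu hV in
theorem constantCoeff_S {x t : ℂ} (hp : (x, t) ∈ V) :
    PowerSeries.constantCoeff (sA (amplitude g a) x t) = 0 ∧
    PowerSeries.constantCoeff (sB (amplitude g a) x t) = jet u t 0 * (rootH u g x t)⁻¹ ∧
    PowerSeries.constantCoeff (sC (amplitude g a) x t) = x * (rootH u g x t)⁻¹ := by
  obtain ⟨h1, h2, h3⟩ := branch_ne hVU hBA.g_pow hp
  obtain ⟨e1, e2, -, e4, -, e6⟩ := amplitude_mul (a := a) x t h3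
  have hl := fun i j => hBA.leading i j x t hp
  have h4 := hBA.g_pow x t hp
  rw [eq_div_iff h2] at h4
  simp only [sA, sB, sC, e1, e2, e4, e6, map_add, map_sub, map_neg, map_mul, hl,
    PowerSeries.constantCoeff_C]
  refine ⟨by ring, ?_, ?_⟩
  · rw [jet_zero, rootH, zVar]
    field_simp
    linear_combination -h4
  · rw [rootH, zVar]
    field_simp
    linear_combination h4

theorem goodTriple_amplitude : GoodTriple V (jet u) (rootH u g) (amplitude g a) := by
  have hC := curveDomain_amplitude hU hu hV hVU hBA
  have W := wave_amplitude hV hVU hBA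
  have hS := W.good_S hC (hu.good_u hC hU fun x t hp => (hVU x t hp).1)
    (fun x t _ => by rw [jet_zero, u0])
    (fun x t hp => (constantCoeff_S hVU hBA hp).1)
    (fun x t hp => (constantCoeff_S hVU hBA hp).2.1)
    (fun x t hp => (constantCoeff_S hVU hBA hp).2.2)
  exact ⟨fun k => (hS k).1, fun k => (hS k).2.1,
    fun k => (hS k).2.2.mono (by split_ifs <;> norm_num)⟩

theorem good_waveTau_amplitude (n : ℕ) : Good V (jet u) (rootH u g) 1 (-2)
    (fun x t => PowerSeries.coeff (n + 1) (waveTau (laxD m τ u) (amplitude g a) x t)) := by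
  have hC := curveDomain_amplitude hU hu hV hVU hBA
  have hVU' : ∀ x t, (x, t) ∈ V → t ∈ U := fun x t hp => (hVU x t hp).1
  rcases V.eq_empty_or_nonempty with hE | ⟨⟨x, t⟩, hp⟩
  · exact Good.zero.congr fun x t hp => by rw [hE] at hp; exact absurd hp (Set.notMem_empty _)
  · obtain ⟨μ, h1, h2, h3, h4⟩ := hu.exists_top hU hVU' hp
    exact hu.good_waveTau hC hU hVU' (wave_amplitude hV hVU hBA)
      (goodTriple_amplitude hU hu hV hVU hBA) h1 h2 h4 (fun t => curvePoly m τ (u0 u t))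
      (fun x t _ => yLax_eq m τ u g x t) (fun x t _ => natDegree_curvePoly h1 h2 h3 h4 _) n

/-- The coefficients of the Baker–Akhiezer function are rational in `z`. -/
theorem ratZ_coefficients (hVc : IsPreconnected V) (i j : Fin 2) :
    SeriesIn (RatZ V (jet u) (zVar g)) (fun x t => a x t i j) := by
  have hC := curveDomain_amplitude hU hu hV hVU hBA
  have W := wave_amplitude hV hVU hBA
  have hz := isUniformizer hVU hBA.g_pow
  have hS := goodTriple_amplitude hU hu hV hVU hBA
  have K := isFunAlgebra_ratZ V (jet u) (zVar g)
  have H := isFunAlgebra_hol V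
  have ha : ∀ i j, SeriesIn (Hol V) (fun x t => a x t i j) := hBA.differentiableOn
  have hl := hBA.leading
  have hne : ∀ x t, (x, t) ∈ V → g x t ≠ 0 := fun x t hp => (branch_ne hVU hBA.g_pow hp).2.2
  -- The sum and the difference of det Ψ = 1 and A isolate the two diagonal products.
  have hdet : ∀ x t, (x, t) ∈ V → a x t 0 0 * a x t 1 1 = 1 + sA (amplitude g a) x t ∧
      a x t 0 1 * a x t 1 0 = 1 - sA (amplitude g a) x t := fun x t hp => by
    obtain ⟨-, e2, -, e4, -, -⟩ := amplitude_mul (a := a) x t (hne x t hp)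
    have h2 : PowerSeries.C (1 / 2 : ℂ) * (2 : PowerSeries ℂ) = 1 := by
      rw [← map_ofNat (PowerSeries.C (R := ℂ)) 2, ← map_mul]; norm_num
    have hd := W.det hp
    constructor
    · rw [sA]
      linear_combination -2 * e2 + hd - a x t 0 0 * a x t 1 1 * h2
    · rw [sA]
      linear_combination 2 * e4 + hd - a x t 0 1 * a x t 1 0 * h2
  have hK : ∀ {e d F}, GoodS V (jet u) (rootH u g) e d F → SeriesIn (RatZ V (jet u) (zVar g)) F :=
    fun hF k => hz.ratZ_good hC (hF k)
  have hb := K.seriesAdd (hK hS.B) (hK hS.C)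
  have hc := K.seriesSub (hK hS.B) (hK hS.C)
  have p01 : SeriesIn (RatZ V (jet u) (zVar g)) (fun x t => a x t 0 0 * a x t 0 1) := by
    refine K.seriesCongr (K.seriesMul (K.seriesC (IsUniformizer.ratZ_z)) hb) fun x t hp => ?_
    obtain ⟨e1, -⟩ := amplitude_mul (a := a) x t (hne x t hp)
    have h2 : PowerSeries.C (zVar g x t) * PowerSeries.C (1 / 2 * g x t ^ 2) * 2 = 1 := by
      have := hne x t hp
      rw [← map_ofNat (PowerSeries.C (R := ℂ)) 2, ← map_mul, ← map_mul, zVar,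
        ← map_one (PowerSeries.C (R := ℂ))]
      congr 1
      field_simp
    rw [sB, sC]
    linear_combination 2 * PowerSeries.C (zVar g x t) * e1 - a x t 0 0 * a x t 0 1 * h2
  have p11 : SeriesIn (RatZ V (jet u) (zVar g)) (fun x t => a x t 1 0 * a x t 1 1) := by
    refine K.seriesCongr (K.seriesMul (K.seriesC (hz.ratZ_inv_z)) hc) fun x t hp => ?_
    obtain ⟨-, -, -, -, -, e6⟩ := amplitude_mul (a := a) x t (hne x t hp)
    have h2 : PowerSeries.C (zVar g x t)⁻¹ * PowerSeries.C (1 / 2 * (g x t)⁻¹ ^ 2) * 2 = 1 := by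
      have := hne x t hp
      rw [← map_ofNat (PowerSeries.C (R := ℂ)) 2, ← map_mul, ← map_mul, zVar,
        ← map_one (PowerSeries.C (R := ℂ))]
      congr 1
      field_simp
    rw [sB, sC]
    linear_combination -2 * PowerSeries.C (zVar g x t)⁻¹ * e6 - a x t 1 0 * a x t 1 1 * h2
  have q : SeriesIn (RatZ V (jet u) (zVar g)) (fun x t => a x t 0 0 * a x t 1 1) :=
    K.seriesCongr (K.seriesAdd (K.seriesConst 1) (hK hS.A)) fun x t hp => (hdet x t hp).1
  have s : SeriesIn (RatZ V (jet u) (zVar g)) (fun x t => a x t 0 1 * a x t 1 0) :=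
    K.seriesCongr (K.seriesSub (K.seriesConst 1) (hK hS.A)) fun x t hp => (hdet x t hp).2
  -- the ratio of the products of the entries of the columns
  have hR0 : ∀ x t, (x, t) ∈ V → PowerSeries.constantCoeff (a x t 0 1 * a x t 1 1) = 1 :=
    fun x t hp => by rw [map_mul, hl _ _ x t hp, hl _ _ x t hp, one_mul]
  have hRR : ∀ x t, (x, t) ∈ V → (a x t 0 1 * a x t 1 1) * (a x t 0 1 * a x t 1 1)⁻¹ = 1 :=
    fun x t hp => PowerSeries.mul_inv_cancel _ (by rw [hR0 x t hp]; exact one_ne_zero)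
  have hinv : SeriesIn (Hol V) (fun x t => (a x t 0 1 * a x t 1 1)⁻¹) :=
    H.seriesOf_mul (H.seriesMul (ha 0 1) (ha 1 1)) (H.seriesCongr (H.seriesConst 1) hRR) hR0
  have hEP : ∀ x t, (x, t) ∈ V → a x t 0 0 * a x t 1 0 * (a x t 0 1 * a x t 1 1)⁻¹
      * (a x t 0 1 * a x t 1 1) = a x t 0 0 * a x t 1 0 := fun x t hp => by
    linear_combination a x t 0 0 * a x t 1 0 * hRR x t hp
  have hE : SeriesIn (RatZ V (jet u) (zVar g))
      (fun x t => a x t 0 0 * a x t 1 0 * (a x t 0 1 * a x t 1 1)⁻¹) := by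
    refine W.ratZ_ratio hz hC hVc (hu.good_u hC hU fun x t hp => (hVU x t hp).1) hS
      (fun x t hp => (constantCoeff_S hVU hBA hp).1)
      (good_waveTau_amplitude hU hu hV hVU hBA)
      (H.seriesMul (H.seriesMul (ha 0 0) (ha 1 0)) hinv) (fun x t hp => ?_) (fun x t hp => ?_)
      (fun x t hp h0 => ?_)
    · have := congrArg PowerSeries.constantCoeff (hEP x t hp)
      rw [map_mul, hR0 x t hp, mul_one] at this
      rw [this, map_mul, hl _ _ x t hp, hl _ _ x t hp, one_mul]
    · obtain ⟨-, -, e3, -, e5, -⟩ := amplitude_mul (a := a) x t (hne x t hp)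
      rw [e3, e5]
      linear_combination -PowerSeries.C (1 / 2) * hEP x t hp
    · obtain ⟨-, -, -, -, e5, -⟩ := amplitude_mul (a := a) x t (hne x t hp)
      have := congrArg PowerSeries.constantCoeff (e5.symm.trans h0)
      rw [map_neg, map_mul, hR0 x t hp] at this
      norm_num at this
  -- The four products and the ratio E determine a_00 through a_00⁴ · (a_10 a_11) = (a_00 a_01)(a_00
  -- a_11)² E. The constant coefficient 1 selects the fourth root, and the other entries follow by
  -- division.
  have h4 : SeriesIn (RatZ V (jet u) (zVar g))
      (fun x t => (a x t 0 0 * a x t 0 0) * (a x t 0 0 * a x t 0 0)) := by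
    refine K.seriesOf_mul p11 (K.seriesCongr (K.seriesMul p01 (K.seriesMul (K.seriesMul q q) hE))
      fun x t hp => ?_) fun x t hp => by rw [map_mul, hl _ _ x t hp, hl _ _ x t hp, one_mul]
    linear_combination -(a x t 0 0 ^ 3 * a x t 1 1) * hEP x t hp
  have a00 := K.seriesOf_sq (K.seriesOf_sq h4 fun x t hp => by
    rw [map_mul, hl _ _ x t hp, one_mul]) (hl 0 0)
  have a01 := K.seriesOf_mul a00 p01 (hl 0 0)
  have a11 := K.seriesOf_mul a00 q (hl 0 0)
  have a10 := K.seriesOf_mul a01 s (hl 0 1)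
  fin_cases i <;> fin_cases j
  exacts [a00, a01, a10, a11]

/-- The coefficients of the Baker–Akhiezer function as fractions in `z`. -/
theorem coefficients_eq_div (hVc : IsPreconnected V) (i j : Fin 2) (k : ℕ) :
    ∃ (α β : ℕ) (P : Polynomial (MvPolynomial ℕ ℂ)) (q : MvPolynomial ℕ ℂ),
      ∀ x t, (x, t) ∈ V →
        MvPolynomial.eval (jet u t) q ≠ 0 ∧
        PowerSeries.coeff k (a x t i j) =
          (P.map (MvPolynomial.eval (jet u t))).eval (zVar g x t) /
            (MvPolynomial.eval (jet u t) q * zVar g x t ^ α * (zVar g x t ^ 2 + 1) ^ β) := by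
  have hC := curveDomain_amplitude hU hu hV hVU hBA
  have hz := isUniformizer hVU hBA.g_pow
  obtain ⟨α, β, r, P, h⟩ := ratZ_coefficients hU hu hV hVU hBA hVc i j k
  refine ⟨α, β, P, MvPolynomial.X 0 ^ r, fun x t hp => ?_⟩
  have h1 : jet u t 0 ^ r ≠ 0 := pow_ne_zero _ (hC.jet_ne hp)
  have h2 : MvPolynomial.eval (jet u t) (MvPolynomial.X 0 ^ r) = jet u t 0 ^ r := by simp
  rw [h2]
  refine ⟨h1, ?_⟩
  rw [eq_div_iff (mul_ne_zero (mul_ne_zero h1 (pow_ne_zero _ (hz.z_ne hp)))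
    (pow_ne_zero _ (hz.sq_add_one_ne hC hp)))]
  exact h x t hp

end amplitude

end MinimalModel

end

noncomputable section

namespace MinimalModel

/-! ### Cyclic traces -/

section cycles

variable {n : ℕ} {A : Type*} [CommRing A]

/-- The product of the traces of the products of the matrices `M i` along the cycles of `σ`. -/
def cycleTrace (σ : Equiv.Perm (Fin n)) (M : Fin n → Matrix (Fin 2) (Fin 2) A) : A :=
  ∑ s : Fin n → Fin 2, ∏ i, M (σ i) (s (σ i)) (s i)

theorem cycleTrace_conj (σ π : Equiv.Perm (Fin n)) (M : Fin n → Matrix (Fin 2) (Fin 2) A) :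
    cycleTrace (π * σ * π⁻¹) M = cycleTrace σ (fun i => M (π i)) := by
  rw [cycleTrace, cycleTrace]
  refine Fintype.sum_equiv (Equiv.arrowCongr π (Equiv.refl _)).symm _ _ fun s => ?_
  rw [← Equiv.prod_comp π]
  refine Finset.prod_congr rfl fun i _ => ?_
  simp [Equiv.arrowCongr]

theorem cycleTrace_map {B : Type*} [CommRing B] (f : A →+* B) (σ : Equiv.Perm (Fin n))
    (M : Fin n → Matrix (Fin 2) (Fin 2) A) :
    f (cycleTrace σ M) = cycleTrace σ (fun i => (M i).map f) := by
  simp [cycleTrace, map_sum, map_prod]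

/-- Adjacent commuting matrices can be exchanged. -/
theorem cycleTrace_swap {σ : Equiv.Perm (Fin n)} {p q : Fin n} (hpq : p ≠ q) (hσ : σ p = q)
    {M : Fin n → Matrix (Fin 2) (Fin 2) A} (hM : M p * M q = M q * M p) :
    cycleTrace σ (fun i => M (Equiv.swap p q i)) = cycleTrace σ M := by
  classical
  -- Isolate the summation index s(p). Only the factors at p and at σ⁻¹(p) contain it, and summing
  -- over it forms the matrix product M q * M p.
  rw [cycleTrace, cycleTrace, ← (Equiv.funSplitAt p (Fin 2)).symm.sum_comp,
    ← (Equiv.funSplitAt p (Fin 2)).symm.sum_comp, Fintype.sum_prod_type_right,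
    Fintype.sum_prod_type_right]
  refine Finset.sum_congr rfl fun s _ => ?_
  set r := σ⁻¹ p with hr
  have hσr : σ r = p := by simp [hr]
  have hrp : r ≠ p := fun h => hpq (by
    have h' := hσr
    rw [h, hσ] at h'
    exact h'.symm)
  have hrq : ∀ i, i ≠ r → i ≠ p → σ i ≠ p ∧ σ i ≠ q := fun i h1 h2 =>
    ⟨fun h => h1 (σ.injective (by rw [h, hσr])), fun h => h2 (σ.injective (by rw [h, hσ]))⟩
  -- The value 0 for the index at p in the remaining product is arbitrary, as no remaining factor
  -- depends on it.
  have key : ∀ (M : Fin n → Matrix (Fin 2) (Fin 2) A) (c : Fin 2),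
      ∏ i, M (σ i) ((Equiv.funSplitAt p (Fin 2)).symm (c, s) (σ i))
        ((Equiv.funSplitAt p (Fin 2)).symm (c, s) i)
      = (M q (s ⟨q, hpq.symm⟩) c * M p c (s ⟨r, hrp⟩))
        * ∏ i ∈ (Finset.univ.erase p).erase r, M (σ i) ((Equiv.funSplitAt p (Fin 2)).symm (0, s) (σ i))
        ((Equiv.funSplitAt p (Fin 2)).symm (0, s) i) := by
    intro M c
    rw [← Finset.mul_prod_erase _ _ (Finset.mem_univ p),
      ← Finset.mul_prod_erase _ _ (Finset.mem_erase.2 ⟨hrp, Finset.mem_univ r⟩), ← mul_assoc]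
    congr 1
    · simp [Equiv.funSplitAt_symm_apply, hσ, hσr, hpq.symm, hrp]
    · refine Finset.prod_congr rfl fun i hi => ?_
      obtain ⟨h1, h2⟩ := Finset.mem_erase.1 hi
      have h3 := Finset.ne_of_mem_erase h2
      have h4 := (hrq i h1 h3).1
      simp [Equiv.funSplitAt_symm_apply, h3, h4]
  refine (Finset.sum_congr rfl fun c _ => key (fun i => M (Equiv.swap p q i)) c).trans
    (Eq.trans ?_ (Finset.sum_congr rfl fun c _ => key M c).symm)
  simp only [← Finset.sum_mul]
  congr 1
  · rw [Equiv.swap_apply_right, Equiv.swap_apply_left, ← Matrix.mul_apply, hM, Matrix.mul_apply]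
  · refine Finset.prod_congr rfl fun i hi => ?_
    obtain ⟨h1, h2⟩ := Finset.mem_erase.1 hi
    have h3 := Finset.ne_of_mem_erase h2
    rw [Equiv.swap_apply_of_ne_of_ne (hrq i h1 h3).1 (hrq i h1 h3).2]

/-! ### Products over pairs -/

/-- The pairs `(i,j)` with `i < j`. -/
def ltPairs (n : ℕ) : Finset (Fin n × Fin n) := Finset.univ.filter fun p => p.1 < p.2

theorem prod_ltPairs (f : Fin n → Fin n → A) :
    ∏ p ∈ ltPairs n, f p.1 p.2 = ∏ j, ∏ i ∈ Finset.Iio j, f i j := by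
  rw [ltPairs, Finset.prod_filter, ← Finset.univ_product_univ, Finset.prod_product_right]
  refine Finset.prod_congr rfl fun j _ => ?_
  rw [← Finset.prod_filter]
  congr 1
  ext i; simp

/-- The permutation `σ` has neither fixed points nor cycles of length `2`. -/
def NoShortCycle (σ : Equiv.Perm (Fin n)) : Prop := ∀ i, σ i ≠ i ∧ σ (σ i) ≠ i

/-- The factor of `∏_{i<j} (d i j)` complementary to `∏_i d i (σ i)`. -/
def cofactor (σ : Equiv.Perm (Fin n)) (d : Fin n → Fin n → A) (i j : Fin n) : A :=
  if σ i = j then 1 else if σ j = i then -1 else d i j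

theorem cofactor_antisymm {σ : Equiv.Perm (Fin n)} (hσ : NoShortCycle σ) {d : Fin n → Fin n → A}
    (hd : ∀ i j, d i j = -d j i) (i j : Fin n) : cofactor σ d i j = -cofactor σ d j i := by
  unfold cofactor
  by_cases h1 : σ i = j
  · have h2 : σ j ≠ i := fun h => (hσ i).2 (by rw [h1, h])
    simp [h1, h2]
  · by_cases h2 : σ j = i
    · simp [h1, h2]
    · simp [h1, h2, hd i j]

/-- Without fixed points and 2-cycles each unordered pair {i, σ i} occurs exactly once, so ∏ d i (σ
i) is a subproduct of the product over pairs, up to the signs recorded in `cofactor`. -/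
theorem prod_cofactor_mul {σ : Equiv.Perm (Fin n)} (hσ : NoShortCycle σ) {d : Fin n → Fin n → A}
    (hd : ∀ i j, d i j = -d j i) :
    (∏ p ∈ ltPairs n, cofactor σ d p.1 p.2) * ∏ i, d i (σ i) = ∏ p ∈ ltPairs n, d p.1 p.2 := by
  have e : ∏ i, d i (σ i) = ∏ p ∈ ltPairs n, ((if σ p.1 = p.2 then d p.1 p.2 else 1)
      * (if σ p.2 = p.1 then d p.2 p.1 else 1)) := by
    have e1 : ∏ i, d i (σ i) = ∏ p : Fin n × Fin n, if σ p.1 = p.2 then d p.1 p.2 else 1 := by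
      rw [Fintype.prod_prod_type]
      refine Finset.prod_congr rfl fun i _ => ?_
      simp
    rw [e1, Finset.prod_mul_distrib, ← Finset.prod_filter_mul_prod_filter_not Finset.univ
      (fun p : Fin n × Fin n => p.1 < p.2)]
    congr 1
    symm
    refine Finset.prod_bij_ne_one (fun p _ _ => p.swap) (fun p hp _ => ?_)
      (fun p _ _ q _ _ h => Prod.swap_injective h) (fun p hp h1 => ?_) (fun p _ _ => rfl)
    · have := (Finset.mem_filter.1 hp).2
      exact Finset.mem_filter.2 ⟨Finset.mem_univ _, not_lt.2 this.le⟩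
    · have h2 := not_lt.1 (Finset.mem_filter.1 hp).2
      refine ⟨p.swap, ?_, h1, Prod.swap_swap p⟩
      refine Finset.mem_filter.2 ⟨Finset.mem_univ _, lt_of_le_of_ne h2 fun h => ?_⟩
      rw [if_neg] at h1
      · exact h1 rfl
      · have h' : p.2 = p.1 := h
        rw [h']; exact (hσ p.1).1
  rw [e, ← Finset.prod_mul_distrib]
  refine Finset.prod_congr rfl fun p _ => ?_
  unfold cofactor
  by_cases h1 : σ p.1 = p.2
  · have h2 : σ p.2 ≠ p.1 := fun h => (hσ p.1).2 (by rw [h1, h])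
    simp [h1, h2]
  · by_cases h2 : σ p.2 = p.1
    · simp [h1, h2, hd p.1 p.2]
    · simp [h1, h2]

/-- The cofactor is antisymmetric, so permuting the indices of its product over pairs yields the
sign of π, as for a Vandermonde product. -/
theorem prod_cofactor_conj {σ : Equiv.Perm (Fin n)} (hσ : NoShortCycle σ) (π : Equiv.Perm (Fin n))
    {d : Fin n → Fin n → A} (hd : ∀ i j, d i j = -d j i) :
    ∏ p ∈ ltPairs n, cofactor σ (fun i j => d (π i) (π j)) p.1 p.2
      = (π.sign : ℤ) * ∏ p ∈ ltPairs n, cofactor (π * σ * π⁻¹) d p.1 p.2 := by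
  have hσ' : NoShortCycle (π * σ * π⁻¹) := fun i => by
    obtain ⟨k, rfl⟩ := π.surjective i
    simpa using hσ k
  rw [prod_ltPairs, prod_ltPairs, ← Equiv.Perm.prod_Iio_comp_eq_sign_mul_prod π
    (f := cofactor (π * σ * π⁻¹) d) (cofactor_antisymm hσ' hd)]
  refine Finset.prod_congr rfl fun j _ => Finset.prod_congr rfl fun i _ => ?_
  simp [cofactor]

end cycles

/-! ### Divisibility by differences of variables -/

section divisibility

open MvPolynomial

variable {n : ℕ} {Λ : Type*} [CommRing Λ]

/-- Modulo X_p - X_q, the substitution X_q ↦ X_p is the identity. -/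
theorem X_sub_X_dvd_of_rename {p q : Fin n} {f : MvPolynomial (Fin n) Λ}
    (hf : rename (Function.update id q p) f = 0) : X p - X q ∣ f := by
  rw [← Ideal.mem_span_singleton, ← Ideal.Quotient.eq_zero_iff_mem]
  have h : ((Ideal.Quotient.mkₐ Λ (Ideal.span {(X p - X q : MvPolynomial (Fin n) Λ)})).comp
      (rename (Function.update id q p))) = Ideal.Quotient.mkₐ Λ _ := by
    refine MvPolynomial.algHom_ext fun i => ?_
    by_cases hi : i = q
    · subst hi
      simp only [AlgHom.comp_apply, rename_X, Function.update_self, Ideal.Quotient.mkₐ_eq_mk]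
      exact Ideal.Quotient.eq.2 (Ideal.mem_span_singleton_self _)
    · simp [Function.update_of_ne hi]
  have h2 := DFunLike.congr_fun h f
  rw [AlgHom.comp_apply, hf, map_zero] at h2
  exact h2.symm

theorem rename_X_sub_X_ne_zero [Nontrivial Λ] {p q i j : Fin n} (hij : i < j) (hpq : p < q)
    (h : (i, j) ≠ (p, q)) :
    rename (Function.update id q p) (X i - X j : MvPolynomial (Fin n) Λ) ≠ 0 := by
  rw [map_sub, rename_X, rename_X, sub_ne_zero]
  refine fun e => ?_
  have e2 := X_injective e
  by_cases h1 : i = q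
  · have h2 : j ≠ q := fun h => by rw [h1, h] at hij; exact lt_irrefl _ hij
    rw [h1, Function.update_self, Function.update_of_ne h2] at e2
    have e3 : p = j := e2
    rw [h1, ← e3] at hij
    exact absurd (hij.trans hpq) (lt_irrefl _)
  · rw [Function.update_of_ne h1] at e2
    by_cases h2 : j = q
    · rw [h2, Function.update_self] at e2
      exact h (Prod.ext e2 h2)
    · rw [Function.update_of_ne h2] at e2
      exact absurd e2 hij.ne

/-- Divide out the differences one at a time: the factors already removed stay nonzero after the
next substitution, so over a domain the quotient must vanish there. -/
theorem prod_X_sub_X_dvd [IsDomain Λ] {f : MvPolynomial (Fin n) Λ}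
    (hf : ∀ p q : Fin n, p < q → rename (Function.update id q p) f = 0) :
    ∏ p ∈ ltPairs n, (X p.1 - X p.2) ∣ f := by
  have key : ∀ s : Finset (Fin n × Fin n), s ⊆ ltPairs n →
      ∏ p ∈ s, (X p.1 - X p.2 : MvPolynomial (Fin n) Λ) ∣ f := by
    intro s
    induction s using Finset.induction_on with
    | empty => intro _; simp
    | insert p s hps ih =>
      intro hs
      obtain ⟨w, hw⟩ := ih ((Finset.subset_insert _ _).trans hs)
      have hp := (Finset.mem_filter.1 (hs (Finset.mem_insert_self p s))).2
      have h0 := hf p.1 p.2 hp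
      rw [hw, map_mul, map_prod] at h0
      have h1 : rename (Function.update id p.2 p.1) w = 0 := by
        refine (mul_eq_zero.1 h0).resolve_left (Finset.prod_ne_zero_iff.2 fun r hr => ?_)
        have hr' := (Finset.mem_filter.1 (hs (Finset.mem_insert_of_mem hr))).2
        exact rename_X_sub_X_ne_zero hr' hp fun h => hps (by
          have : r = p := h
          rwa [← this])
      obtain ⟨v, hv⟩ := X_sub_X_dvd_of_rename h1
      exact ⟨v, by rw [Finset.prod_insert hps, hw, hv]; ring⟩
  exact key _ (Finset.Subset.refl _)

/-- The matrix of polynomials in the variable `X_i` obtained from a matrix of polynomials in one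
variable. -/
def inVar (Q : Matrix (Fin 2) (Fin 2) (Polynomial Λ)) (i : Fin n) :
    Matrix (Fin 2) (Fin 2) (MvPolynomial (Fin n) Λ) :=
  Q.map (Polynomial.aeval (X i))

open Classical in
/-- The permutations of `Fin n` with a single cycle. -/
def fullCycles (n : ℕ) : Finset (Equiv.Perm (Fin n)) :=
  Finset.univ.filter fun σ => σ.IsCycleOn Set.univ

theorem mem_fullCycles {σ : Equiv.Perm (Fin n)} : σ ∈ fullCycles n ↔ σ.IsCycleOn Set.univ := by
  simp [fullCycles]

theorem conj_mem_fullCycles {σ : Equiv.Perm (Fin n)} (hσ : σ ∈ fullCycles n)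
    (π : Equiv.Perm (Fin n)) : π * σ * π⁻¹ ∈ fullCycles n := by
  rw [mem_fullCycles] at hσ ⊢
  have := hσ.conj (g := π)
  rwa [Set.image_univ_of_surjective π.surjective] at this

theorem noShortCycle {σ : Equiv.Perm (Fin n)} (hσ : σ ∈ fullCycles n) (hn : 3 ≤ n) :
    NoShortCycle σ := by
  rw [mem_fullCycles, ← Finset.coe_univ] at hσ
  refine fun i => ⟨fun h => ?_, fun h => ?_⟩
  · have := (hσ.pow_apply_eq (Finset.mem_univ i) (n := 1)).1 (by simpa using h)
    rw [Finset.card_univ, Fintype.card_fin] at this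
    have := Nat.le_of_dvd (by norm_num) this
    omega
  · have := (hσ.pow_apply_eq (Finset.mem_univ i) (n := 2)).1 (by simpa [pow_two] using h)
    rw [Finset.card_univ, Fintype.card_fin] at this
    have := Nat.le_of_dvd (by norm_num) this
    omega

/-- The common numerator of the sum of cyclic traces. -/
def cycleNumer (Q : Fin n → Matrix (Fin 2) (Fin 2) (Polynomial Λ)) : MvPolynomial (Fin n) Λ :=
  ∑ σ ∈ fullCycles n, cycleTrace σ (fun i => inVar (Q i) i)
    * ∏ p ∈ ltPairs n, cofactor σ (fun i j => X i - X j) p.1 p.2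

theorem map_cofactor {A B : Type*} [CommRing A] [CommRing B] (f : A →+* B)
    (σ : Equiv.Perm (Fin n)) (d : Fin n → Fin n → A) (i j : Fin n) :
    f (cofactor σ d i j) = cofactor σ (fun i j => f (d i j)) i j := by
  unfold cofactor
  split_ifs <;> simp

/-- After X_q ↦ X_p a cycle contributes only if p and q are adjacent in it; otherwise its cofactor
still contains X_p - X_q. The cycles with σ p = q and those with σ q = p are exchanged by
conjugation with the transposition of p and q. The traces agree, since the matrices at p and q now
commute, while the cofactor changes sign. -/
theorem rename_cycleNumer (hn : 3 ≤ n) {Q : Fin n → Matrix (Fin 2) (Fin 2) (Polynomial Λ)}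
    (hQ : ∀ i j, Q i * Q j = Q j * Q i) {p q : Fin n} (hpq : p < q) :
    rename (Function.update id q p) (cycleNumer Q) = 0 := by
  classical
  set φ : MvPolynomial (Fin n) Λ →+* MvPolynomial (Fin n) Λ :=
    (rename (Function.update id q p) : MvPolynomial (Fin n) Λ →ₐ[Λ] _).toRingHom with hφ
  set R : Fin n → Matrix (Fin 2) (Fin 2) (MvPolynomial (Fin n) Λ) :=
    fun i => (inVar (Q i) i).map φ with hR
  set d : Fin n → Fin n → MvPolynomial (Fin n) Λ := fun i j => φ (X i - X j) with hd
  set T : Equiv.Perm (Fin n) → MvPolynomial (Fin n) Λ := fun σ =>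
    cycleTrace σ R * ∏ p ∈ ltPairs n, cofactor σ d p.1 p.2 with hT
  have hda : ∀ i j, d i j = -d j i := fun i j => by rw [hd]; simp [map_sub]
  have e : rename (Function.update id q p) (cycleNumer Q) = ∑ σ ∈ fullCycles n, T σ := by
    change φ (cycleNumer Q) = _
    rw [cycleNumer, map_sum]
    refine Finset.sum_congr rfl fun σ _ => ?_
    rw [map_mul, map_prod, cycleTrace_map]
    simp only [map_cofactor, hT, hR, hd]
  have hφX : ∀ i, φ (X i) = X (Function.update id q p i) := fun i => rename_X _ _
  have hdswap : (fun i j => d (Equiv.swap p q i) (Equiv.swap p q j)) = d := by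
    have : ∀ i, φ (X (Equiv.swap p q i)) = φ (X i) := fun i => by
      rw [hφX, hφX]
      rcases eq_or_ne i p with rfl | h1
      · rw [Equiv.swap_apply_left, Function.update_self, Function.update_of_ne hpq.ne, id]
      · rcases eq_or_ne i q with rfl | h2
        · rw [Equiv.swap_apply_right, Function.update_self, Function.update_of_ne hpq.ne, id]
        · rw [Equiv.swap_apply_of_ne_of_ne h1 h2]
    funext i j
    simp only [hd, map_sub, this]
  have hRpq : R p * R q = R q * R p := by
    have h1 : ∀ i, φ (X i) = X p → R i = (Q i).map (Polynomial.aeval (X p : MvPolynomial (Fin n) Λ)) := by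
      intro i hi
      refine Matrix.ext fun a b => ?_
      simp only [hR, inVar, Matrix.map_apply]
      rw [← hi]
      exact (Polynomial.aeval_algHom_apply (rename (Function.update id q p)) (X i) (Q i a b)).symm
    rw [h1 p (by rw [hφX, Function.update_of_ne hpq.ne, id]),
      h1 q (by rw [hφX, Function.update_self])]
    have h2 := congrArg (fun M : Matrix (Fin 2) (Fin 2) (Polynomial Λ) =>
      M.map (Polynomial.aeval (X p : MvPolynomial (Fin n) Λ))) (hQ p q)
    simpa only [Matrix.map_mul] using h2
  have hne : p ≠ q := hpq.ne
  -- the contributions that do not vanish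
  have hvan : ∀ σ : Equiv.Perm (Fin n), σ p ≠ q → σ q ≠ p → T σ = 0 := by
    intro σ h1 h2
    simp only [hT]
    refine mul_eq_zero_of_right _ (Finset.prod_eq_zero (i := (p, q))
      (Finset.mem_filter.2 ⟨Finset.mem_univ _, hpq⟩) ?_)
    rw [cofactor, if_neg h1, if_neg h2]
    simp [hd, map_sub, hφX, Function.update_of_ne hne]
  have hsw : (Equiv.swap p q)⁻¹ = Equiv.swap p q := Equiv.swap_inv p q
  have hpair : ∀ σ ∈ fullCycles n, σ p = q → T (Equiv.swap p q * σ * (Equiv.swap p q)⁻¹) = -T σ := by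
    intro σ hσ h1
    simp only [hT]
    rw [cycleTrace_conj, cycleTrace_swap hne h1 hRpq]
    have := prod_cofactor_conj (noShortCycle hσ hn) (Equiv.swap p q) hda
    rw [hdswap, Equiv.Perm.sign_swap hne] at this
    rw [this]
    simp
  rw [e]
  have hsplit : ∑ σ ∈ fullCycles n, T σ = ∑ σ ∈ (fullCycles n).filter (fun σ => σ p = q), T σ
      + ∑ σ ∈ (fullCycles n).filter (fun σ => σ q = p), T σ := by
    rw [← Finset.sum_filter_add_sum_filter_not (fullCycles n) (fun σ => σ p = q)]
    congr 1
    symm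
    refine Finset.sum_subset (fun σ hσ => ?_) (fun σ hσ hσ' => ?_)
    · obtain ⟨h1, h2⟩ := Finset.mem_filter.1 hσ
      refine Finset.mem_filter.2 ⟨h1, fun h3 => (noShortCycle h1 hn p).2 (by rw [h3, h2])⟩
    · obtain ⟨h1, h2⟩ := Finset.mem_filter.1 hσ
      exact hvan σ h2 fun h3 => hσ' (Finset.mem_filter.2 ⟨h1, h3⟩)
  have hbij : ∑ σ ∈ (fullCycles n).filter (fun σ => σ q = p), T σ
      = ∑ σ ∈ (fullCycles n).filter (fun σ => σ p = q), -T σ := by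
    symm
    refine Finset.sum_bij' (fun σ _ => Equiv.swap p q * σ * (Equiv.swap p q)⁻¹)
      (fun σ _ => Equiv.swap p q * σ * (Equiv.swap p q)⁻¹) (fun σ hσ => ?_) (fun σ hσ => ?_)
      (fun σ _ => ?_) (fun σ _ => ?_) (fun σ hσ => ?_)
    · obtain ⟨h1, h2⟩ := Finset.mem_filter.1 hσ
      refine Finset.mem_filter.2 ⟨conj_mem_fullCycles h1 _, ?_⟩
      simp [hsw, h2]
    · obtain ⟨h1, h2⟩ := Finset.mem_filter.1 hσ
      refine Finset.mem_filter.2 ⟨conj_mem_fullCycles h1 _, ?_⟩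
      simp [hsw, h2]
    · ext i; simp [hsw]
    · ext i; simp [hsw]
    · obtain ⟨h1, h2⟩ := Finset.mem_filter.1 hσ
      rw [hpair σ h1 h2]
  rw [hsplit, hbij, Finset.sum_neg_distrib, add_neg_cancel]

theorem degreeOf_X_sub_X_le (i p q : Fin n) [Nontrivial Λ] (σ : Equiv.Perm (Fin n)) :
    degreeOf i (cofactor σ (fun i j => X i - X j : Fin n → Fin n → MvPolynomial (Fin n) Λ) p q)
      ≤ degreeOf i (X p - X q : MvPolynomial (Fin n) Λ) := by
  unfold cofactor
  split_ifs
  · simp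
  · rw [degreeOf_neg]; simp
  · exact le_rfl

theorem degreeOf_aeval_X_le [Nontrivial Λ] (P : Polynomial Λ) (i k : Fin n) :
    degreeOf i (Polynomial.aeval (X k : MvPolynomial (Fin n) Λ) P)
      ≤ if k = i then P.natDegree else 0 := by
  rw [Polynomial.aeval_eq_sum_range]
  refine (degreeOf_sum_le _ _ _).trans (Finset.sup_le fun j hj => ?_)
  have hj' := Finset.mem_range.1 hj
  rw [smul_eq_C_mul]
  refine (degreeOf_C_mul_le _ _ _).trans ?_
  split_ifs with h
  · subst h
    rw [degreeOf_X_self_pow]; omega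
  · rw [degreeOf_X_pow_of_ne j (Ne.symm h)]

/-- Each matrix occurs once in the trace, and the cofactor has at most the degree of the full
product of differences. So division by that product leaves degree at most e i. -/
theorem degreeOf_cycleNumer_le [IsDomain Λ] {Q : Fin n → Matrix (Fin 2) (Fin 2) (Polynomial Λ)}
    {e : Fin n → ℕ} (hQ : ∀ i a b, (Q i a b).natDegree ≤ e i) (i : Fin n) :
    degreeOf i (cycleNumer Q)
      ≤ e i + degreeOf i (∏ p ∈ ltPairs n, (X p.1 - X p.2) : MvPolynomial (Fin n) Λ) := by
  rw [cycleNumer]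
  refine (degreeOf_sum_le _ _ _).trans (Finset.sup_le fun σ _ => ?_)
  refine (degreeOf_mul_le _ _ _).trans (Nat.add_le_add ?_ ?_)
  · rw [cycleTrace]
    refine (degreeOf_sum_le _ _ _).trans (Finset.sup_le fun s _ => ?_)
    refine (degreeOf_prod_le _ _ _).trans ?_
    have h1 : ∀ k ∈ (Finset.univ : Finset (Fin n)),
        degreeOf i (inVar (Q (σ k)) (σ k) (s (σ k)) (s k)) ≤ if σ k = i then e i else 0 := by
      intro k _
      refine (degreeOf_aeval_X_le _ _ _).trans ?_
      split_ifs with h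
      · rw [h]; exact hQ i _ _
      · exact le_rfl
    refine (Finset.sum_le_sum h1).trans ?_
    rw [Equiv.sum_comp σ (fun k => if k = i then e i else 0)]
    simp
  · rw [degreeOf_prod_eq (ltPairs n) (fun p => (X p.1 - X p.2 : MvPolynomial (Fin n) Λ))]
    · exact (degreeOf_prod_le _ _ _).trans (Finset.sum_le_sum fun p _ => degreeOf_X_sub_X_le _ _ _ _)
    · intro p hp h0
      exact (Finset.mem_filter.1 hp).2.ne (X_injective (sub_eq_zero.1 h0))

/-- The sum of cyclic traces of commuting matrices, divided by the differences along the cycles, is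
a polynomial. -/
theorem exists_cycleNumer_eq [IsDomain Λ] (hn : 3 ≤ n)
    {Q : Fin n → Matrix (Fin 2) (Fin 2) (Polynomial Λ)} (hQ : ∀ i j, Q i * Q j = Q j * Q i)
    {e : Fin n → ℕ} (he : ∀ i a b, (Q i a b).natDegree ≤ e i) :
    ∃ w : MvPolynomial (Fin n) Λ, (∀ i, degreeOf i w ≤ e i) ∧
      cycleNumer Q = (∏ p ∈ ltPairs n, (X p.1 - X p.2)) * w := by
  obtain ⟨w, hw⟩ := prod_X_sub_X_dvd (f := cycleNumer Q) fun p q hpq => rename_cycleNumer hn hQ hpq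
  refine ⟨w, fun i => ?_, hw⟩
  rcases eq_or_ne w 0 with rfl | h0
  · simp
  have h1 : (∏ p ∈ ltPairs n, (X p.1 - X p.2) : MvPolynomial (Fin n) Λ) ≠ 0 :=
    Finset.prod_ne_zero_iff.2 fun p hp h0 =>
      (Finset.mem_filter.1 hp).2.ne (X_injective (sub_eq_zero.1 h0))
  have h2 := degreeOf_cycleNumer_le he i
  rw [hw, degreeOf_mul_eq h1 h0] at h2
  omega

end divisibility

end MinimalModel

end

/-! ### Rational functions of ζ along a fibre -/

noncomputable section

namespace MinimalModel

section zeta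

variable {V : Set (ℂ × ℂ)} {j : ℂ → ℕ → ℂ} {h : ℂ → ℂ → ℂ} {g : ℂ → ℂ → ℂ}

/-- The parametrization of the spectral curve by `ζ`. -/
theorem zetaVar_param (hz : IsUniformizer V j h (zVar g)) (hV : CurveDomain V j h) {x t : ℂ}
    (hp : (x, t) ∈ V) : zetaVar g x t ≠ 0 ∧ zetaVar g x t ^ 2 - 1 ≠ 0 ∧
      2 * zetaVar g x t * x = j t 0 * (zetaVar g x t ^ 2 + 1) ∧
      2 * zetaVar g x t * h x t = Complex.I * j t 0 * (zetaVar g x t ^ 2 - 1) := by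
  have h0 := hz.sq_add_one_ne hV hp
  have h1 := hz.z_sq hp
  have h2 := hz.z_ne hp
  have h3 := hz.h_eq hp
  set z := zVar g x t with hzdef
  have hI := Complex.I_sq
  have hm : Complex.I - z ≠ 0 := fun e => h0 (by linear_combination -(Complex.I + z) * e + hI)
  have hq : Complex.I + z ≠ 0 := fun e => h0 (by linear_combination -(Complex.I - z) * e + hI)
  have hζ : zetaVar g x t * (Complex.I - z) = Complex.I + z := by
    rw [zetaVar, ← hzdef, div_mul_cancel₀ _ hm]
  have hm2 : (Complex.I - z) ^ 2 ≠ 0 := pow_ne_zero 2 hm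
  set ζ := zetaVar g x t with hζdef
  have e2 : ζ ^ 2 * (Complex.I - z) ^ 2 = (Complex.I + z) ^ 2 := by rw [← mul_pow, hζ]
  have e1 : ζ * (Complex.I - z) ^ 2 = (Complex.I + z) * (Complex.I - z) := by
    rw [pow_two, ← mul_assoc, hζ]
  refine ⟨fun e => hq ?_, fun e => ?_, ?_, ?_⟩
  · rw [← hζ, e, zero_mul]
  · have : (4 : ℂ) * Complex.I * z = 0 := by
      linear_combination (Complex.I - z) ^ 2 * e - e2
    simp [h2] at this
  · refine mul_right_cancel₀ hm2 ?_
    linear_combination 2 * x * e1 - j t 0 * e2 + (2 * x - 2 * j t 0) * hI - 2 * h1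
  · refine mul_right_cancel₀ hm2 ?_
    linear_combination 2 * h x t * e1 - Complex.I * j t 0 * e2
      + (2 * h x t - 4 * j t 0 * z) * hI - 2 * (1 + z ^ 2) * h3 - 2 * z * h1

/-- Functions of points `x_1, …, x_n` of the fibre over `t` that are rational in the `ζ_i`, with poles
only at `±1`, of order at most `d`. -/
def ZetaRat (V : Set (ℂ × ℂ)) (g : ℂ → ℂ → ℂ) (t : ℂ) {n : ℕ} (d : ℕ) (F : (Fin n → ℂ) → ℂ) : Prop :=
  ∃ P : MvPolynomial (Fin n) ℂ, (∀ i, P.degreeOf i ≤ 2 * d) ∧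
    ∀ x : Fin n → ℂ, Function.Injective x → (∀ i, (x i, t) ∈ V) →
      F x * ∏ i, (zetaVar g (x i) t ^ 2 - 1) ^ d = MvPolynomial.eval (fun i => zetaVar g (x i) t) P

namespace ZetaRat

variable {t : ℂ} {n d : ℕ} {F G : (Fin n → ℂ) → ℂ}

theorem congr (hF : ZetaRat V g t d F) (hFG : ∀ x : Fin n → ℂ, Function.Injective x →
    (∀ i, (x i, t) ∈ V) → G x = F x) : ZetaRat V g t d G := by
  obtain ⟨P, h1, h2⟩ := hF
  exact ⟨P, h1, fun x hx hp => by rw [hFG x hx hp, h2 x hx hp]⟩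

theorem const_mul (c : ℂ) (hF : ZetaRat V g t d F) : ZetaRat V g t d (fun x => c * F x) := by
  obtain ⟨P, h1, h2⟩ := hF
  refine ⟨MvPolynomial.C c * P, fun i => (MvPolynomial.degreeOf_C_mul_le _ _ _).trans (h1 i),
    fun x hx hp => ?_⟩
  rw [map_mul, MvPolynomial.eval_C, ← h2 x hx hp, mul_assoc]

theorem sum {ι : Type*} (s : Finset ι) {F : ι → (Fin n → ℂ) → ℂ}
    (hF : ∀ i ∈ s, ZetaRat V g t d (F i)) : ZetaRat V g t d (fun x => ∑ i ∈ s, F i x) := by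
  choose! P h1 h2 using hF
  refine ⟨∑ i ∈ s, P i, fun i => (MvPolynomial.degreeOf_sum_le _ _ _).trans
    (Finset.sup_le fun k hk => h1 k hk i), fun x hx hp => ?_⟩
  rw [map_sum, Finset.sum_mul]
  exact Finset.sum_congr rfl fun k hk => h2 k hk x hx hp

theorem prod {f : Fin n → ℂ → ℂ} (hf : ∀ i, ∃ p : Polynomial ℂ, p.natDegree ≤ 2 * d ∧
    ∀ x, (x, t) ∈ V → f i x * (zetaVar g x t ^ 2 - 1) ^ d = p.eval (zetaVar g x t)) :
    ZetaRat V g t d (fun x => ∏ i, f i (x i)) := by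
  choose p h1 h2 using hf
  refine ⟨∏ i, Polynomial.aeval (MvPolynomial.X i) (p i), fun i => ?_, fun x hx hp => ?_⟩
  · refine (MvPolynomial.degreeOf_prod_le _ _ _).trans ?_
    refine (Finset.sum_le_sum fun k _ => degreeOf_aeval_X_le (p k) i k).trans ?_
    simpa using h1 i
  · rw [← Finset.prod_mul_distrib, map_prod]
    refine Finset.prod_congr rfl fun i _ => ?_
    rw [h2 i _ (hp i), Polynomial.aeval_def, Polynomial.hom_eval₂]
    simp [Polynomial.eval, MvPolynomial.algebraMap_eq, Polynomial.eval₂_eq_sum]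

/-- The numerator of a symmetric function can be taken to be symmetric. -/
theorem symmetrize (hF : ZetaRat V g t d F) (hs : ∀ (x : Fin n → ℂ) (π : Equiv.Perm (Fin n)),
    F (fun i => x (π i)) = F x) : ∃ P : MvPolynomial (Fin n) ℂ, P.IsSymmetric ∧
    (∀ i, P.degreeOf i ≤ 2 * d) ∧ ∀ x : Fin n → ℂ, Function.Injective x → (∀ i, (x i, t) ∈ V) →
      F x * ∏ i, (zetaVar g (x i) t ^ 2 - 1) ^ d
        = MvPolynomial.eval (fun i => zetaVar g (x i) t) P := by
  obtain ⟨P, h1, h2⟩ := hF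
  refine ⟨MvPolynomial.C ((n.factorial : ℂ)⁻¹) * ∑ π : Equiv.Perm (Fin n), MvPolynomial.rename π P,
    fun π => ?_, fun i => ?_, fun x hx hp => ?_⟩
  · rw [map_mul, MvPolynomial.rename_C, map_sum]
    congr 1
    refine Fintype.sum_equiv (Equiv.mulLeft π) _ _ fun ρ => ?_
    rw [MvPolynomial.rename_rename]
    rfl
  · refine (MvPolynomial.degreeOf_C_mul_le _ _ _).trans ((MvPolynomial.degreeOf_sum_le _ _ _).trans
      (Finset.sup_le fun π _ => ?_))
    obtain ⟨k, rfl⟩ := π.surjective i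
    rw [MvPolynomial.degreeOf_rename_of_injective π.injective]
    exact h1 k
  · have key : ∀ π : Equiv.Perm (Fin n), MvPolynomial.eval (fun i => zetaVar g (x i) t)
        (MvPolynomial.rename π P) = F x * ∏ i, (zetaVar g (x i) t ^ 2 - 1) ^ d := by
      intro π
      have := h2 (fun i => x (π i)) (hx.comp π.injective) fun i => hp (π i)
      rw [hs, Equiv.prod_comp π (fun i => (zetaVar g (x i) t ^ 2 - 1) ^ d)] at this
      rw [this, MvPolynomial.eval_rename]
      rfl
    have hn : (n.factorial : ℂ) ≠ 0 := Nat.cast_ne_zero.2 (Nat.factorial_ne_zero n)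
    rw [map_mul, MvPolynomial.eval_C, map_sum, Finset.sum_congr rfl fun π _ => key π,
      Finset.sum_const, Finset.card_univ, Fintype.card_perm, Fintype.card_fin, nsmul_eq_mul,
      inv_mul_cancel_left₀ hn]

end ZetaRat

variable (hz : IsUniformizer V j h (zVar g)) (hV : CurveDomain V j h) (t : ℂ)
include hz hV

omit hz hV in
theorem exists_poly_zeta_one (L : ℕ) : ∃ p : Polynomial ℂ, p.natDegree ≤ 2 * L ∧
    ∀ x, (x, t) ∈ V → 1 * (zetaVar g x t ^ 2 - 1) ^ L = p.eval (zetaVar g x t) := by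
  refine ⟨(Polynomial.X ^ 2 - 1) ^ L, ?_, fun x hp => by simp⟩
  have : (Polynomial.X ^ 2 - 1 : Polynomial ℂ).natDegree ≤ 2 := by compute_degree
  exact (Polynomial.natDegree_pow_le_of_le L this).trans (by omega)

/-- Both x = u_0 (ζ² + 1)/(2ζ) and h = i u_0 (ζ² - 1)/(2ζ) have simple poles at ζ = 0 and ∞. For k ≤
L these cancel in x^k h^{-L}, and only ζ = ±1 remains. -/
theorem exists_poly_zeta {k L : ℕ} (hk : k ≤ L) : ∃ p : Polynomial ℂ, p.natDegree ≤ 2 * L ∧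
    ∀ x, (x, t) ∈ V → (x ^ k * (h x t)⁻¹ ^ L) * (zetaVar g x t ^ 2 - 1) ^ L
      = p.eval (zetaVar g x t) := by
  refine ⟨Polynomial.C ((j t 0 / 2) ^ k * (2 / (Complex.I * j t 0)) ^ L)
    * ((Polynomial.X ^ 2 + 1) ^ k * Polynomial.X ^ (L - k)), ?_, fun x hp => ?_⟩
  · refine (Polynomial.natDegree_C_mul_le _ _).trans ?_
    have : (Polynomial.X ^ 2 + 1 : Polynomial ℂ).natDegree ≤ 2 := by compute_degree
    refine (Polynomial.natDegree_mul_le).trans ?_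
    have := Polynomial.natDegree_pow_le_of_le k this
    rw [Polynomial.natDegree_X_pow]
    omega
  · obtain ⟨h1, h2, h3, h4⟩ := zetaVar_param hz hV hp
    have h5 := hV.jet_ne hp
    have h6 := hV.h_ne hp
    have e1 : x = j t 0 / 2 * (zetaVar g x t ^ 2 + 1) * (zetaVar g x t)⁻¹ := by
      field_simp
      linear_combination h3
    have e2 : (h x t)⁻¹ * (zetaVar g x t ^ 2 - 1) = 2 / (Complex.I * j t 0) * zetaVar g x t := by
      have hI := Complex.I_ne_zero
      field_simp
      linear_combination -h4
    have e3 : (zetaVar g x t)⁻¹ ^ k * zetaVar g x t ^ L = zetaVar g x t ^ (L - k) := by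
      obtain ⟨s, rfl⟩ := Nat.exists_eq_add_of_le hk
      rw [pow_add, ← mul_assoc, ← mul_pow, inv_mul_cancel₀ h1, one_pow, one_mul,
        Nat.add_sub_cancel_left]
    simp only [Polynomial.eval_mul, Polynomial.eval_C, Polynomial.eval_pow, Polynomial.eval_add,
      Polynomial.eval_X, Polynomial.eval_one]
    rw [mul_assoc, ← mul_pow, e2, ← e3, mul_pow]
    nth_rewrite 1 [e1]
    rw [mul_pow, mul_pow]
    ring

/-- Monomials in `x_i` and `h^{-1}`, of bounded degree. -/
theorem zetaRat_monomial {n L : ℕ} (I : Finset (Fin n)) (k : Fin n → ℕ)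
    (hk : ∀ i, k i ≤ if i ∈ I then L else 0) :
    ZetaRat V g t L (fun x : Fin n → ℂ => (∏ i ∈ I, (h (x i) t)⁻¹ ^ L) * ∏ i, x i ^ k i) := by
  classical
  refine (ZetaRat.prod (f := fun i x => if i ∈ I then x ^ k i * (h x t)⁻¹ ^ L else 1)
    fun i => ?_).congr fun x _ _ => ?_
  · split_ifs with hi
    · exact exists_poly_zeta hz hV t (by simpa [hi] using hk i)
    · exact exists_poly_zeta_one t L
  · have e : ∏ i ∈ I, (h (x i) t)⁻¹ ^ L = ∏ i, if i ∈ I then (h (x i) t)⁻¹ ^ L else 1 := by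
      rw [Finset.prod_ite_mem, Finset.univ_inter]
    rw [e, ← Finset.prod_mul_distrib]
    refine Finset.prod_congr rfl fun i _ => ?_
    split_ifs with hi
    · exact mul_comm _ _
    · have : k i = 0 := by simpa [hi] using hk i
      rw [this, pow_zero, mul_one]

/-- Polynomials in `x_i`, divided by powers of `h`. -/
theorem zetaRat_poly {n L : ℕ} (I : Finset (Fin n)) {Λ : Type*} [CommRing Λ] (f : Λ →+ ℂ)
    (w : MvPolynomial (Fin n) Λ) (hw : ∀ i, w.degreeOf i ≤ if i ∈ I then L else 0) :
    ZetaRat V g t L (fun x : Fin n → ℂ => (∏ i ∈ I, (h (x i) t)⁻¹ ^ L)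
      * ∑ m ∈ w.support, f (w.coeff m) * ∏ i, x i ^ m i) := by
  refine (ZetaRat.sum w.support (F := fun m x => f (w.coeff m) *
    ((∏ i ∈ I, (h (x i) t)⁻¹ ^ L) * ∏ i, x i ^ m i)) fun m hm => ?_).congr fun x _ _ => ?_
  · exact (zetaRat_monomial hz hV t I (fun i => m i) fun i =>
      (MvPolynomial.monomial_le_degreeOf i hm).trans (hw i)).const_mul _
  · rw [Finset.mul_sum]
    exact Finset.sum_congr rfl fun m _ => by ring

end zeta

end MinimalModel

end

noncomputable section

namespace MinimalModel

/-! ### Truncation of formal series -/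

/-- Reduction modulo `X^{K+1}`. -/
abbrev modX (K : ℕ) : PowerSeries ℂ →+*
    PowerSeries ℂ ⧸ Ideal.span {(PowerSeries.X : PowerSeries ℂ) ^ (K + 1)} :=
  Ideal.Quotient.mk _

theorem modX_eq_iff {K : ℕ} {F G : PowerSeries ℂ} :
    modX K F = modX K G ↔ ∀ k ≤ K, PowerSeries.coeff k F = PowerSeries.coeff k G := by
  rw [modX, Ideal.Quotient.eq, Ideal.mem_span_singleton, PowerSeries.X_pow_dvd_iff]
  simp only [map_sub, sub_eq_zero, Nat.lt_succ_iff]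

open Polynomial in
/-- The polynomial `∑_{k ≤ K} P_k X^k`, with `X` the variable of the formal series. -/
def seriesPoly (K : ℕ) (P : ℕ → ℂ[X]) : (PowerSeries ℂ)[X] :=
  ∑ k ∈ Finset.range (K + 1), C (PowerSeries.X ^ k) * (P k).map PowerSeries.C

theorem coeff_eval_seriesPoly {K k : ℕ} (P : ℕ → Polynomial ℂ) (hk : k ≤ K) (x : ℂ) :
    PowerSeries.coeff k ((seriesPoly K P).eval (PowerSeries.C x)) = (P k).eval x := by
  have : ∀ i, (((P i).map PowerSeries.C).eval (PowerSeries.C x) : PowerSeries ℂ)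
      = PowerSeries.C ((P i).eval x) := fun i => by
    rw [Polynomial.eval_map, Polynomial.eval₂_hom]
  simp only [seriesPoly, Polynomial.eval_finsetSum, Polynomial.eval_mul, Polynomial.eval_C, this,
    map_sum]
  rw [Finset.sum_eq_single k]
  · rw [mul_comm, PowerSeries.coeff_C_mul, PowerSeries.coeff_X_pow_self, mul_one]
  · intro i _ hik
    rw [mul_comm, PowerSeries.coeff_C_mul, PowerSeries.coeff_X_pow, if_neg (Ne.symm hik), mul_zero]
  · intro h; exact absurd (Finset.mem_range.2 (by omega)) h

theorem natDegree_seriesPoly_le {K L : ℕ} {P : ℕ → Polynomial ℂ} (hP : ∀ k ≤ K, (P k).natDegree ≤ L) :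
    (seriesPoly K P).natDegree ≤ L := by
  refine Polynomial.natDegree_sum_le_of_forall_le _ _ fun k hk => ?_
  have := Finset.mem_range.1 hk
  exact (Polynomial.natDegree_C_mul_le _ _).trans (Polynomial.natDegree_map_le.trans (hP k (by omega)))

theorem coeff_eval_C {n : ℕ} (K : ℕ) (w : MvPolynomial (Fin n) (PowerSeries ℂ)) (x : Fin n → ℂ) :
    PowerSeries.coeff K (MvPolynomial.eval (fun i => PowerSeries.C (x i)) w)
      = ∑ m ∈ w.support, PowerSeries.coeff K (w.coeff m) * ∏ i, x i ^ m i := by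
  rw [MvPolynomial.eval_eq', map_sum]
  refine Finset.sum_congr rfl fun m _ => ?_
  have : ∏ i, (PowerSeries.C (x i) : PowerSeries ℂ) ^ m i = PowerSeries.C (∏ i, x i ^ m i) := by
    rw [map_prod]; simp
  rw [this, mul_comm, PowerSeries.coeff_C_mul, mul_comm]

/-! ### The coefficients of `S` along a fibre -/

section fibre

variable {V : Set (ℂ × ℂ)} {j : ℂ → ℕ → ℂ} {h : ℂ → ℂ → ℂ}

/-- For fixed t the powers of j_0 are constants and go into P. The exponent b is left free above a
bound so that several functions can share one power of h. -/
theorem Good.exists_fibre (hV : CurveDomain V j h) (t : ℂ) {d : ℤ} (hd : d ≤ 0) {F : ℂ → ℂ → ℂ}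
    (hF : Good V j h 1 d F) : ∃ b₀ : ℕ, ∀ b ≥ b₀, ∃ P : Polynomial ℂ, P.natDegree ≤ 2 * b + 1 ∧
      ∀ x, (x, t) ∈ V → F x t = (h x t)⁻¹ ^ (2 * b + 1) * P.eval x := by
  obtain ⟨b₀, r, H⟩ := hF.exists_raise hV
  refine ⟨b₀, fun b hb => ?_⟩
  obtain ⟨P, h1, h2⟩ := H b r hb le_rfl
  refine ⟨Polynomial.C ((j t 0 ^ r)⁻¹) * P.map (MvPolynomial.eval (j t)), ?_, fun x hp => ?_⟩
  · have := (Polynomial.natDegree_C_mul_le ((j t 0 ^ r)⁻¹) (P.map (MvPolynomial.eval (j t)))).trans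
      Polynomial.natDegree_map_le
    push_cast at h1
    omega
  · have h3 := hV.jet_ne hp
    have h4 := hV.h_ne hp
    have h5 := h2 x t hp
    rw [polyAt] at h5
    rw [Polynomial.eval_mul, Polynomial.eval_C, ← h5, inv_pow]
    field_simp

theorem GoodS.exists_fibre (hV : CurveDomain V j h) (t : ℂ) {F : ℂ → ℂ → PowerSeries ℂ}
    (hF : GoodS V j h 1 0 F) (K : ℕ) : ∃ b₀ : ℕ, ∀ b ≥ b₀, ∃ P : ℕ → Polynomial ℂ,
      (∀ k ≤ K, (P k).natDegree ≤ 2 * b + 1) ∧ ∀ x, (x, t) ∈ V → ∀ k ≤ K,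
        PowerSeries.coeff k (F x t) = (h x t)⁻¹ ^ (2 * b + 1) * (P k).eval x := by
  choose b₀ H using fun k => (hF k).exists_fibre hV t le_rfl
  refine ⟨(Finset.range (K + 1)).sup b₀, fun b hb => ?_⟩
  have : ∀ k, ∃ P : Polynomial ℂ, k ≤ K → P.natDegree ≤ 2 * b + 1 ∧
      ∀ x, (x, t) ∈ V → PowerSeries.coeff k (F x t) = (h x t)⁻¹ ^ (2 * b + 1) * P.eval x := by
    intro k
    by_cases hk : k ≤ K
    · obtain ⟨P, hP⟩ := H k b ((Finset.le_sup (Finset.mem_range.2 (by omega))).trans hb)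
      exact ⟨P, fun _ => hP⟩
    · exact ⟨0, fun h => absurd h hk⟩
  choose P hP using this
  exact ⟨P, fun k hk => (hP k hk).1, fun x hp k hk => (hP k hk).2 x hp⟩

theorem GoodTriple.exists_fibre (hV : CurveDomain V j h) {Ψ : FormalMatrix}
    (hS : GoodTriple V j h Ψ) (t : ℂ) (K : ℕ) : ∃ (L : ℕ) (PA PB PC : ℕ → Polynomial ℂ),
      (∀ k ≤ K, (PA k).natDegree ≤ L ∧ (PB k).natDegree ≤ L ∧ (PC k).natDegree ≤ L) ∧
      ∀ x, (x, t) ∈ V → ∀ k ≤ K,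
        PowerSeries.coeff k (sA Ψ x t) = (h x t)⁻¹ ^ L * (PA k).eval x ∧
        PowerSeries.coeff k (sB Ψ x t) = (h x t)⁻¹ ^ L * (PB k).eval x ∧
        PowerSeries.coeff k (sC Ψ x t) = (h x t)⁻¹ ^ L * (PC k).eval x := by
  obtain ⟨b₁, H1⟩ := (hS.A.mono (by norm_num : (-2 : ℤ) ≤ 0)).exists_fibre hV t K
  obtain ⟨b₂, H2⟩ := (hS.B.mono (by norm_num : (-1 : ℤ) ≤ 0)).exists_fibre hV t K
  obtain ⟨b₃, H3⟩ := hS.C.exists_fibre hV t K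
  obtain ⟨PA, hA, hA'⟩ := H1 (b₁ + b₂ + b₃) (by omega)
  obtain ⟨PB, hB, hB'⟩ := H2 (b₁ + b₂ + b₃) (by omega)
  obtain ⟨PC, hC, hC'⟩ := H3 (b₁ + b₂ + b₃) (by omega)
  exact ⟨2 * (b₁ + b₂ + b₃) + 1, PA, PB, PC, fun k hk => ⟨hA k hk, hB k hk, hC k hk⟩,
    fun x hp k hk => ⟨hA' x hp k hk, hB' x hp k hk, hC' x hp k hk⟩⟩

end fibre

/-! ### Products of kernels along cycles -/

/-- The rank one projector on the first column of `Ψ`. -/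
def projector (Ψ : FormalMatrix) (x t : ℂ) : Matrix (Fin 2) (Fin 2) (PowerSeries ℂ) :=
  !![Ψ x t 0 0 * Ψ x t 1 1, -(Ψ x t 0 0 * Ψ x t 0 1);
     Ψ x t 1 0 * Ψ x t 1 1, -(Ψ x t 1 0 * Ψ x t 0 1)]

/-- The kernel pairs the first column of Ψ(x_i) with the first row of Ψ(x_{σ(i)})⁻¹. Regrouped by
points, each column meets the row at the same point and forms the projector Ψ diag(1,0) Ψ⁻¹. -/
theorem prod_kernelK (g : ℂ → ℂ → ℂ) (a : FormalMatrix) (t : ℂ) {n : ℕ} (x : Fin n → ℂ)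
    (σ : Equiv.Perm (Fin n)) : ∏ i, kernelK g a t (x i) (x (σ i))
      = PowerSeries.C (∏ i, (x i - x (σ i))⁻¹)
        * cycleTrace σ (fun i => projector (amplitude g a) (x i) t) := by
  have e : ∀ i k : Fin n, kernelK g a t (x i) (x k) = PowerSeries.C ((x i - x k)⁻¹)
      * ∑ s : Fin 2, amplitude g a (x i) t s 0
        * ![amplitude g a (x k) t 1 1, -amplitude g a (x k) t 0 1] s := fun i k => by
    rw [kernelK, Fin.sum_univ_two, one_div]
    simp only [Matrix.cons_val_zero, Matrix.cons_val_one]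
    ring
  simp only [e]
  rw [Finset.prod_mul_distrib, ← map_prod, Finset.prod_univ_sum, Fintype.piFinset_univ, cycleTrace]
  congr 1
  refine Finset.sum_congr rfl fun s _ => ?_
  rw [Finset.prod_mul_distrib, ← Equiv.prod_comp σ (fun i => amplitude g a (x i) t (s i) 0),
    ← Finset.prod_mul_distrib]
  refine Finset.prod_congr rfl fun i _ => ?_
  generalize s (σ i) = b
  generalize s i = c
  fin_cases b <;> fin_cases c <;> simp [projector]

/-- The trace is multilinear in the matrices. This isolates the odd factors h^{-L} of S from the
scalar part 1/2 of the projectors, leaving traces of polynomial matrices. -/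
theorem cycleTrace_add {A : Type*} [CommRing A] {n : ℕ} (σ : Equiv.Perm (Fin n)) (c : Fin n → A)
    (P Q : Fin n → Matrix (Fin 2) (Fin 2) A) :
    cycleTrace σ (fun i => c i • P i + Q i) = ∑ I : Finset (Fin n),
      (∏ i ∈ I, c i) * cycleTrace σ (fun i => if i ∈ I then P i else Q i) := by
  classical
  have key : ∀ (M : Fin n → Matrix (Fin 2) (Fin 2) A) (s : Fin n → Fin 2),
      ∏ i, M (σ i) (s (σ i)) (s i) = ∏ i, M i (s i) (s (σ⁻¹ i)) := fun M s => by
    rw [← Equiv.prod_comp σ (fun i => M i (s i) (s (σ⁻¹ i)))]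
    simp
  have hct : ∀ M : Fin n → Matrix (Fin 2) (Fin 2) A,
      cycleTrace σ M = ∑ s : Fin n → Fin 2, ∏ i, M i (s i) (s (σ⁻¹ i)) := fun M =>
    Finset.sum_congr rfl fun s _ => key M s
  simp only [hct, Matrix.add_apply, Matrix.smul_apply, smul_eq_mul, Finset.mul_sum]
  rw [Finset.sum_comm]
  refine Finset.sum_congr rfl fun s _ => ?_
  rw [Finset.prod_add, Finset.powerset_univ]
  refine Finset.sum_congr rfl fun I _ => ?_
  rw [Finset.prod_mul_distrib, mul_assoc]
  congr 1
  rw [← Finset.prod_sdiff (Finset.subset_univ I), mul_comm]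
  congr 1
  · refine Finset.prod_congr rfl fun i hi => ?_
    rw [if_neg (Finset.mem_sdiff.1 hi).2]
  · refine Finset.prod_congr rfl fun i hi => ?_
    rw [if_pos hi]

open Polynomial in
/-- The polynomial matrix representing `S / 2` along a fibre. -/
def fibreMatrix (K : ℕ) (PA PB PC : ℕ → ℂ[X]) : Matrix (Fin 2) (Fin 2) (PowerSeries ℂ)[X] :=
  !![C (PowerSeries.C (1 / 2)) * seriesPoly K PA,
      C (PowerSeries.C (1 / 2)) * (seriesPoly K PB + seriesPoly K PC);
     C (PowerSeries.C (1 / 2)) * (seriesPoly K PB - seriesPoly K PC),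
      C (PowerSeries.C (1 / 2)) * -seriesPoly K PA]

open Polynomial in
/-- The matrices in the expansion of the products of projectors. -/
def expansionMatrix {n : ℕ} (K : ℕ) (PA PB PC : ℕ → ℂ[X]) (I : Finset (Fin n)) (i : Fin n) :
    Matrix (Fin 2) (Fin 2) (PowerSeries ℂ)[X] :=
  if i ∈ I then fibreMatrix K PA PB PC else Matrix.scalar (Fin 2) (C (PowerSeries.C (1 / 2)))

section expansion

variable {n K L : ℕ} {PA PB PC : ℕ → Polynomial ℂ}

/-- As matrices in one common variable, all are either the same matrix or scalar; this is the
commutation required on the diagonals x_p = x_q. -/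
theorem expansionMatrix_comm (I : Finset (Fin n)) (i k : Fin n) :
    expansionMatrix K PA PB PC I i * expansionMatrix K PA PB PC I k
      = expansionMatrix K PA PB PC I k * expansionMatrix K PA PB PC I i := by
  unfold expansionMatrix
  split_ifs
  · rfl
  · exact (Matrix.scalar_commute _ (fun r => Commute.all _ r) _).symm
  · exact Matrix.scalar_commute _ (fun r => Commute.all _ r) _
  · rfl

theorem natDegree_expansionMatrix
    (hP : ∀ k ≤ K, (PA k).natDegree ≤ L ∧ (PB k).natDegree ≤ L ∧ (PC k).natDegree ≤ L)
    (I : Finset (Fin n)) (i : Fin n) (b c : Fin 2) :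
    (expansionMatrix K PA PB PC I i b c).natDegree ≤ if i ∈ I then L else 0 := by
  have hA := natDegree_seriesPoly_le fun k hk => (hP k hk).1
  have hB := natDegree_seriesPoly_le fun k hk => (hP k hk).2.1
  have hC := natDegree_seriesPoly_le fun k hk => (hP k hk).2.2
  unfold expansionMatrix
  split_ifs
  · fin_cases b <;> fin_cases c <;> simp only [fibreMatrix] <;>
      refine (Polynomial.natDegree_C_mul_le _ _).trans ?_
    · exact hA
    · exact (Polynomial.natDegree_add_le_of_degree_le hB hC)
    · exact (Polynomial.natDegree_sub_le_of_le hB hC).trans (max_self L).le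
    · exact (Polynomial.natDegree_neg _).trans_le hA
  · fin_cases b <;> fin_cases c <;> simp

/-- Since det Ψ = 1, the projector is (1 + S)/2, and S is h^{-L} times a polynomial matrix up to
order K in X. -/
theorem modX_projector {V : Set (ℂ × ℂ)} {u : ℂ → PowerSeries ℂ} {h y : ℂ → ℂ → ℂ}
    {D Ψ : FormalMatrix} (W : IsWave V u h y D Ψ) {x t : ℂ} (hp : (x, t) ∈ V)
    (hP : ∀ k ≤ K, PowerSeries.coeff k (sA Ψ x t) = (h x t)⁻¹ ^ L * (PA k).eval x ∧
        PowerSeries.coeff k (sB Ψ x t) = (h x t)⁻¹ ^ L * (PB k).eval x ∧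
        PowerSeries.coeff k (sC Ψ x t) = (h x t)⁻¹ ^ L * (PC k).eval x) :
    (projector Ψ x t).map (modX K) = ((PowerSeries.C ((h x t)⁻¹ ^ L)
      • (fibreMatrix K PA PB PC).map (Polynomial.eval (PowerSeries.C x))
        + (Matrix.scalar (Fin 2) (Polynomial.C (PowerSeries.C (1 / 2)))).map
          (Polynomial.eval (PowerSeries.C x))).map (modX K)) := by
  have h2 : PowerSeries.C (1 / 2 : ℂ) * (2 : PowerSeries ℂ) = 1 := by
    rw [← map_ofNat (PowerSeries.C (R := ℂ)) 2, ← map_mul]; norm_num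
  have hd := W.det hp
  have key : ∀ {F : PowerSeries ℂ} {P : ℕ → Polynomial ℂ},
      (∀ k ≤ K, PowerSeries.coeff k F = (h x t)⁻¹ ^ L * (P k).eval x) →
      modX K F = modX K (PowerSeries.C ((h x t)⁻¹ ^ L)
        * (seriesPoly K P).eval (PowerSeries.C x)) := by
    intro F P hF
    refine modX_eq_iff.2 fun k hk => ?_
    rw [hF k hk, PowerSeries.coeff_C_mul, coeff_eval_seriesPoly P hk]
  have kA := key fun k hk => (hP k hk).1
  have kB := key fun k hk => (hP k hk).2.1
  have kC := key fun k hk => (hP k hk).2.2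
  have p00 : projector Ψ x t 0 0 = PowerSeries.C (1 / 2) * (sA Ψ x t + 1) := by
    change Ψ x t 0 0 * Ψ x t 1 1 = _
    rw [sA]
    linear_combination -(Ψ x t 0 0 * Ψ x t 1 1) * h2 + PowerSeries.C (1 / 2) * hd
  have p01 : projector Ψ x t 0 1 = PowerSeries.C (1 / 2) * (sB Ψ x t + sC Ψ x t) := by
    change -(Ψ x t 0 0 * Ψ x t 0 1) = _
    rw [sB, sC]
    linear_combination (Ψ x t 0 0 * Ψ x t 0 1) * h2
  have p10 : projector Ψ x t 1 0 = PowerSeries.C (1 / 2) * (sB Ψ x t - sC Ψ x t) := by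
    change Ψ x t 1 0 * Ψ x t 1 1 = _
    rw [sB, sC]
    linear_combination -(Ψ x t 1 0 * Ψ x t 1 1) * h2
  have p11 : projector Ψ x t 1 1 = PowerSeries.C (1 / 2) * (1 - sA Ψ x t) := by
    change -(Ψ x t 1 0 * Ψ x t 0 1) = _
    rw [sA]
    linear_combination (Ψ x t 1 0 * Ψ x t 0 1) * h2 + PowerSeries.C (1 / 2) * hd
  refine Matrix.ext fun b c => ?_
  simp only [Matrix.map_apply, Matrix.add_apply, Matrix.smul_apply, smul_eq_mul, map_add, map_mul]
  fin_cases b <;> fin_cases c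
  · change modX K (projector Ψ x t 0 0) = _
    rw [p00, map_mul, map_add, kA]
    simp [fibreMatrix]
    ring
  · change modX K (projector Ψ x t 0 1) = _
    rw [p01, map_mul, map_add, kB, kC]
    simp [fibreMatrix]
    ring
  · change modX K (projector Ψ x t 1 0) = _
    rw [p10, map_mul, map_sub, kB, kC]
    simp [fibreMatrix]
    ring
  · change modX K (projector Ψ x t 1 1) = _
    rw [p11, map_mul, map_sub, kA]
    simp [fibreMatrix]
    ring

/-- The coefficients of the sum over cycles of the products of kernels. -/
theorem coeff_sum_kernelK {V : Set (ℂ × ℂ)} {u : ℂ → PowerSeries ℂ} {h y g : ℂ → ℂ → ℂ}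
    {D a : FormalMatrix} (W : IsWave V u h y D (amplitude g a)) {t : ℂ}
    (hP : ∀ x, (x, t) ∈ V → ∀ k ≤ K,
        PowerSeries.coeff k (sA (amplitude g a) x t) = (h x t)⁻¹ ^ L * (PA k).eval x ∧
        PowerSeries.coeff k (sB (amplitude g a) x t) = (h x t)⁻¹ ^ L * (PB k).eval x ∧
        PowerSeries.coeff k (sC (amplitude g a) x t) = (h x t)⁻¹ ^ L * (PC k).eval x)
    (hn : 3 ≤ n) {w : Finset (Fin n) → MvPolynomial (Fin n) (PowerSeries ℂ)}
    (hw : ∀ I, cycleNumer (expansionMatrix K PA PB PC I)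
      = (∏ p ∈ ltPairs n, (MvPolynomial.X p.1 - MvPolynomial.X p.2)) * w I)
    {x : Fin n → ℂ} (hx : Function.Injective x) (hp : ∀ i, (x i, t) ∈ V) :
    PowerSeries.coeff K (∑ σ ∈ fullCycles n, ∏ i, kernelK g a t (x i) (x (σ i)))
      = ∑ I : Finset (Fin n), (∏ i ∈ I, (h (x i) t)⁻¹ ^ L)
        * ∑ m ∈ (w I).support, PowerSeries.coeff K ((w I).coeff m) * ∏ i, x i ^ m i := by
  classical
  set Vd : ℂ := ∏ p ∈ ltPairs n, (x p.1 - x p.2) with hVd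
  have hVd0 : Vd ≠ 0 := Finset.prod_ne_zero_iff.2 fun p hp h0 =>
    (Finset.mem_filter.1 hp).2.ne (hx (sub_eq_zero.1 h0))
  set d : Fin n → Fin n → PowerSeries ℂ := fun i k => PowerSeries.C (x i - x k) with hd
  have hda : ∀ i k, d i k = -d k i := fun i k => by rw [hd]; simp
  set N : Equiv.Perm (Fin n) → PowerSeries ℂ := fun σ =>
    ∏ p ∈ ltPairs n, cofactor σ d p.1 p.2 with hN
  have h1 : PowerSeries.C Vd * ∑ σ ∈ fullCycles n, ∏ i, kernelK g a t (x i) (x (σ i))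
      = ∑ σ ∈ fullCycles n,
        cycleTrace σ (fun i => projector (amplitude g a) (x i) t) * N σ := by
    rw [Finset.mul_sum]
    refine Finset.sum_congr rfl fun σ hσ => ?_
    have hns := noShortCycle hσ hn
    have e1 : PowerSeries.C Vd = N σ * ∏ i, d i (σ i) := by
      rw [hN, prod_cofactor_mul hns hda, hVd, map_prod]
    have e2 : (∏ i, d i (σ i)) * PowerSeries.C (∏ i, (x i - x (σ i))⁻¹) = 1 := by
      rw [hd, ← map_prod, ← map_mul, ← Finset.prod_mul_distrib, Finset.prod_eq_one, map_one]
      intro i _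
      exact mul_inv_cancel₀ (sub_ne_zero.2 fun e => (hns i).1 (hx e).symm)
    rw [prod_kernelK, e1]
    linear_combination N σ * cycleTrace σ (fun i => projector (amplitude g a) (x i) t) * e2
  have h2 : ∀ I, ∑ σ ∈ fullCycles n, cycleTrace σ (fun i =>
      (expansionMatrix K PA PB PC I i).map (Polynomial.eval (PowerSeries.C (x i)))) * N σ
      = PowerSeries.C Vd * MvPolynomial.eval (fun i => PowerSeries.C (x i)) (w I) := by
    intro I
    have := congrArg (MvPolynomial.eval (fun i => (PowerSeries.C (x i) : PowerSeries ℂ))) (hw I)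
    rw [map_mul, map_prod, cycleNumer, map_sum] at this
    simp only [map_mul, map_prod, cycleTrace_map, map_cofactor, map_sub, MvPolynomial.eval_X] at this
    have e3 : ∀ i, (inVar (expansionMatrix K PA PB PC I i) i).map
        (MvPolynomial.eval (fun i => (PowerSeries.C (x i) : PowerSeries ℂ)))
        = (expansionMatrix K PA PB PC I i).map (Polynomial.eval (PowerSeries.C (x i))) := by
      intro i
      refine Matrix.ext fun b c => ?_
      simp only [inVar, Matrix.map_apply]
      rw [Polynomial.aeval_def, Polynomial.hom_eval₂, MvPolynomial.eval_X]
      have : (MvPolynomial.eval fun i => (PowerSeries.C (x i) : PowerSeries ℂ)).comp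
          (algebraMap (PowerSeries ℂ) (MvPolynomial (Fin n) (PowerSeries ℂ))) = RingHom.id _ := by
        ext1 r
        simp [MvPolynomial.algebraMap_eq]
      rw [this, Polynomial.eval₂_id]
    simp only [e3] at this
    rw [hVd, map_prod]
    simp only [hN, hd, map_sub]
    exact this
  -- The polynomial representation of S is known up to order K only; reduction modulo X^{K+1} is a
  -- ring homomorphism and passes through the traces.
  have h3 : modX K (PowerSeries.C Vd * ∑ σ ∈ fullCycles n, ∏ i, kernelK g a t (x i) (x (σ i)))
      = modX K (PowerSeries.C Vd * ∑ I : Finset (Fin n), PowerSeries.C (∏ i ∈ I, (h (x i) t)⁻¹ ^ L)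
        * MvPolynomial.eval (fun i => PowerSeries.C (x i)) (w I)) := by
    have h4 : PowerSeries.C Vd * ∑ I : Finset (Fin n), PowerSeries.C (∏ i ∈ I, (h (x i) t)⁻¹ ^ L)
        * MvPolynomial.eval (fun i => PowerSeries.C (x i)) (w I)
        = ∑ σ ∈ fullCycles n, cycleTrace σ (fun i => (PowerSeries.C ((h (x i) t)⁻¹ ^ L)
          • (fibreMatrix K PA PB PC).map (Polynomial.eval (PowerSeries.C (x i)))
          + (Matrix.scalar (Fin 2) (Polynomial.C (PowerSeries.C (1 / 2)))).map
          (Polynomial.eval (PowerSeries.C (x i))))) * N σ := by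
      simp only [cycleTrace_add, Finset.sum_mul]
      rw [Finset.sum_comm, Finset.mul_sum]
      refine Finset.sum_congr rfl fun I _ => ?_
      have := h2 I
      have e4 : ∀ i, (expansionMatrix K PA PB PC I i).map (Polynomial.eval (PowerSeries.C (x i)))
          = if i ∈ I then (fibreMatrix K PA PB PC).map (Polynomial.eval (PowerSeries.C (x i)))
            else (Matrix.scalar (Fin 2) (Polynomial.C (PowerSeries.C (1 / 2)))).map
              (Polynomial.eval (PowerSeries.C (x i))) := fun i => by
        unfold expansionMatrix
        split_ifs <;> rfl
      simp only [e4] at this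
      rw [mul_left_comm, ← this, Finset.mul_sum, map_prod]
      exact Finset.sum_congr rfl fun σ _ => by ring
    rw [h4, h1, map_sum, map_sum]
    refine Finset.sum_congr rfl fun σ _ => ?_
    rw [map_mul, map_mul, cycleTrace_map, cycleTrace_map]
    congr 1
    congr 1
    funext i
    exact modX_projector W (hp i) (hP (x i) (hp i))
  have h5 := modX_eq_iff.1 h3 K le_rfl
  rw [PowerSeries.coeff_C_mul, PowerSeries.coeff_C_mul] at h5
  rw [mul_left_cancel₀ hVd0 h5, map_sum]
  refine Finset.sum_congr rfl fun I _ => ?_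
  rw [PowerSeries.coeff_C_mul, coeff_eval_C]

end expansion

theorem zetaRat_sum_kernelK {V : Set (ℂ × ℂ)} {j : ℂ → ℕ → ℂ} {u : ℂ → PowerSeries ℂ}
    {h y g : ℂ → ℂ → ℂ} {D a : FormalMatrix} (W : IsWave V u h y D (amplitude g a))
    (hz : IsUniformizer V j h (zVar g)) (hV : CurveDomain V j h)
    (hS : GoodTriple V j h (amplitude g a)) (t : ℂ) {n : ℕ} (hn : 3 ≤ n) (K : ℕ) :
    ∃ d, ZetaRat V g t d (fun x : Fin n → ℂ =>
      PowerSeries.coeff K (∑ σ ∈ fullCycles n, ∏ i, kernelK g a t (x i) (x (σ i)))) := by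
  obtain ⟨L, PA, PB, PC, hdeg, hP⟩ := hS.exists_fibre hV t K
  choose w hw1 hw2 using fun I : Finset (Fin n) => exists_cycleNumer_eq hn
    (expansionMatrix_comm (K := K) (PA := PA) (PB := PB) (PC := PC) I)
    (natDegree_expansionMatrix hdeg I)
  -- Extracting the coefficient of order K is not multiplicative, but additivity suffices: the
  -- points x_i are constants, and it acts on the coefficients of w alone.
  refine ⟨L, (ZetaRat.sum Finset.univ fun I _ => zetaRat_poly hz hV t I
    (PowerSeries.coeff K : PowerSeries ℂ →ₗ[ℂ] ℂ).toAddMonoidHom (w I) (hw1 I)).congr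
    fun x hx hp => ?_⟩
  exact coeff_sum_kernelK W hP hn hw2 hx hp

end MinimalModel

end

noncomputable section

namespace MinimalModel

/-! ### Symmetry of the correlation functions -/

theorem sum_fullCycles_comp {n : ℕ} {A M : Type*} [CommRing A] (κ : M → M → A) (x : Fin n → M)
    (π : Equiv.Perm (Fin n)) : ∑ σ ∈ fullCycles n, ∏ i, κ (x (π i)) (x (π (σ i)))
      = ∑ σ ∈ fullCycles n, ∏ i, κ (x i) (x (σ i)) := by
  refine Finset.sum_bij' (fun σ _ => π * σ * π⁻¹) (fun σ _ => π⁻¹ * σ * π)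
    (fun σ hσ => conj_mem_fullCycles hσ π) (fun σ hσ => by
      simpa using conj_mem_fullCycles hσ π⁻¹) (fun σ _ => by simp [mul_assoc])
    (fun σ _ => by simp [mul_assoc]) (fun σ _ => ?_)
  rw [← Equiv.prod_comp π (fun i => κ (x i) (x ((π * σ * π⁻¹) i)))]
  simp

theorem corrN_add_two (m : ℕ) (τ : ℕ → ℂ) (u : ℂ → PowerSeries ℂ) (g : ℂ → ℂ → ℂ)
    (a : FormalMatrix) (t : ℂ) (n : ℕ) (x : Fin (n + 2) → ℂ) :
    corrN m τ u g a t (n + 2) x = PowerSeries.X *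
      (-(if n = 0 then PowerSeries.C (1 / (x 0 - x 1) ^ 2) else 0)
        - (-1) ^ (n + 2) * ∑ σ ∈ fullCycles (n + 2), ∏ i, kernelK g a t (x i) (x (σ i))) :=
  rfl

theorem corrW_comp (m : ℕ) (τ : ℕ → ℂ) (u : ℂ → PowerSeries ℂ) (g : ℂ → ℂ → ℂ)
    (a : FormalMatrix) (t : ℂ) (n γ : ℕ) (x : Fin n → ℂ) (π : Equiv.Perm (Fin n)) :
    corrW m τ u g a t n γ (fun i => x (π i)) = corrW m τ u g a t n γ x := by
  rw [corrW, corrW]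
  congr 1
  match n with
  | 0 => rfl
  | 1 => rw [Subsingleton.elim π 1]; rfl
  | n + 2 =>
    rw [corrN_add_two, corrN_add_two, sum_fullCycles_comp (kernelK g a t)]
    congr 3
    split_ifs with hn
    · subst hn
      have h01 : π 0 ≠ π 1 := fun h => absurd (π.injective h) (by decide)
      have h2 : (x (π 0) - x (π 1)) ^ 2 = (x 0 - x 1) ^ 2 := by
        generalize π 0 = b at h01
        generalize π 1 = c at h01
        fin_cases b <;> fin_cases c
        · exact absurd rfl h01
        · rfl
        · exact sub_sq_comm _ _
        · exact absurd rfl h01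
      rw [h2]
    · rfl

/-! ### The correlation functions of at least three points -/

section zeta

variable {V : Set (ℂ × ℂ)} {j : ℂ → ℕ → ℂ} {h : ℂ → ℂ → ℂ} {g : ℂ → ℂ → ℂ}

theorem zetaRat_eval (hz : IsUniformizer V j h (zVar g)) (hV : CurveDomain V j h) (t : ℂ) {n L : ℕ}
    (w : MvPolynomial (Fin n) ℂ) (hw : ∀ i, w.degreeOf i ≤ L) :
    ZetaRat V g t L (fun x : Fin n → ℂ => (∏ i, (h (x i) t)⁻¹ ^ L) * MvPolynomial.eval x w) :=
  (zetaRat_poly hz hV t Finset.univ (AddMonoidHom.id ℂ) w fun i => by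
    rw [if_pos (Finset.mem_univ i)]; exact hw i).congr fun x _ _ => by
      rw [MvPolynomial.eval_eq']; rfl

theorem ZetaRat.corrW_add_three {m : ℕ} {τ : ℕ → ℂ} {u : ℂ → PowerSeries ℂ} {a : FormalMatrix}
    {t : ℂ} {n γ d : ℕ} (hF : ZetaRat V g t d (fun x : Fin (n + 3) → ℂ => PowerSeries.coeff
      (2 * γ + n + 1) (∑ σ ∈ fullCycles (n + 3), ∏ i, kernelK g a t (x i) (x (σ i))))) :
    ZetaRat V g t d (corrW m τ u g a t (n + 3) γ) := by
  refine (hF.const_mul (-(-1) ^ (n + 3))).congr fun x _ _ => ?_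
  have h1 : ((-1) ^ (n + 3) : PowerSeries ℂ) = PowerSeries.C ((-1) ^ (n + 3)) := by simp
  rw [corrW, corrN_add_two m τ u g a t (n + 1), if_neg (Nat.succ_ne_zero n),
    show 2 * γ + (n + 3) - 1 = (2 * γ + n + 1) + 1 by omega, PowerSeries.coeff_succ_X_mul, neg_zero,
    zero_sub, map_neg, h1, PowerSeries.coeff_C_mul, neg_mul]

/-! ### The one-point functions -/

/-- The x-equation replaces the derivative in W_1 by 𝒟Ψ, leaving the (0,0) entry of Ψ⁻¹𝒟Ψ, which
equals Tr(𝒟S)/2 because 𝒟 is traceless. -/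
theorem corrN_one {m : ℕ} {τ : ℕ → ℂ} {u : ℂ → PowerSeries ℂ} {a : FormalMatrix}
    (hBA : IsBakerAkhiezer m τ u V g a) {t : ℂ} {x : Fin 1 → ℂ} (hp : (x 0, t) ∈ V) :
    corrN m τ u g a t 1 x = waveTau (laxD m τ u) (amplitude g a) (x 0) t := by
  have h1 := laxD_trace m τ u (x 0) t
  change waveX m τ u g a (x 0) t 0 0 * amplitude g a (x 0) t 1 1
        - waveX m τ u g a (x 0) t 1 0 * amplitude g a (x 0) t 0 1 = _
  rw [hBA.eq_x _ _ hp, Matrix.mul_apply, Matrix.mul_apply, Fin.sum_univ_two, Fin.sum_univ_two, h1,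
    waveTau, sA]
  ring

theorem zetaRat_of_good (hz : IsUniformizer V j h (zVar g)) (hV : CurveDomain V j h) (t : ℂ)
    {F : ℂ → ℂ → ℂ} (hF : Good V j h 1 (-2) F) :
    ∃ d, ZetaRat V g t d (fun x : Fin 1 → ℂ => F (x 0) t) := by
  obtain ⟨b, H⟩ := hF.exists_fibre hV t (by norm_num)
  obtain ⟨P, h1, h2⟩ := H b le_rfl
  refine ⟨2 * b + 1, (zetaRat_eval hz hV t (Polynomial.aeval (MvPolynomial.X 0) P) fun i => ?_).congr
    fun x _ hp => ?_⟩
  · refine (degreeOf_aeval_X_le P i 0).trans ?_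
    split_ifs
    · exact h1
    · exact Nat.zero_le _
  · have : MvPolynomial.eval x (Polynomial.aeval (MvPolynomial.X 0) P) = P.eval (x 0) := by
      rw [← MvPolynomial.coe_aeval_eq_eval, RingHom.coe_coe, ← Polynomial.aeval_algHom_apply,
        MvPolynomial.aeval_X, Polynomial.coe_aeval_eq_eval]
    rw [h2 _ (hp 0), this, Fin.prod_univ_one]

/-- Polynomials in `x`, multiplied by the square root, are Laurent polynomials in `ζ`. -/
theorem exists_laurent_zeta (hz : IsUniformizer V j h (zVar g)) (hV : CurveDomain V j h) (t : ℂ)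
    (c : Polynomial ℂ) : ∃ (d : ℕ) (P : Polynomial ℂ), ∀ x, (x, t) ∈ V →
      h x t * c.eval x = P.eval (zetaVar g x t) / zetaVar g x t ^ d := by
  refine ⟨c.natDegree + 1, Polynomial.C (Complex.I * j t 0 / 2) * (Polynomial.X ^ 2 - 1)
    * ∑ k ∈ Finset.range (c.natDegree + 1), Polynomial.C (c.coeff k * (j t 0 / 2) ^ k)
      * (Polynomial.X ^ 2 + 1) ^ k * Polynomial.X ^ (c.natDegree - k), fun x hp => ?_⟩
  obtain ⟨h1, -, h3, h4⟩ := zetaVar_param hz hV hp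
  have e1 : x * zetaVar g x t = j t 0 / 2 * (zetaVar g x t ^ 2 + 1) := by linear_combination h3 / 2
  have e2 : h x t * zetaVar g x t = Complex.I * j t 0 / 2 * (zetaVar g x t ^ 2 - 1) := by
    linear_combination h4 / 2
  simp only [Polynomial.eval_mul, Polynomial.eval_finsetSum, Polynomial.eval_C,
    Polynomial.eval_pow, Polynomial.eval_add, Polynomial.eval_sub, Polynomial.eval_X,
    Polynomial.eval_one]
  rw [eq_div_iff (pow_ne_zero _ h1), Polynomial.eval_eq_sum_range, ← e2, pow_succ']
  have : ∀ k ∈ Finset.range (c.natDegree + 1), c.coeff k * (j t 0 / 2) ^ k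
      * (zetaVar g x t ^ 2 + 1) ^ k * zetaVar g x t ^ (c.natDegree - k)
      = c.coeff k * x ^ k * zetaVar g x t ^ c.natDegree := by
    intro k hk
    have hk' := Finset.mem_range.1 hk
    rw [mul_assoc (c.coeff k), ← mul_pow, ← e1, mul_pow, ← mul_assoc, mul_assoc, ← pow_add,
      Nat.add_sub_of_le (by omega)]
  rw [Finset.sum_congr rfl this, ← Finset.sum_mul]
  ring

/-! ### The two-point functions -/

theorem fullCycles_two : fullCycles 2 = {Equiv.swap 0 1} := by
  ext σ
  rw [mem_fullCycles, Finset.mem_singleton]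
  refine ⟨fun hσ => ?_, ?_⟩
  · have hn : (Set.univ : Set (Fin 2)).Nontrivial := Set.nontrivial_univ
    have h0 := hσ.apply_ne hn (Set.mem_univ 0)
    have h1 := hσ.apply_ne hn (Set.mem_univ 1)
    ext i
    fin_cases i
    · change (σ 0 : ℕ) = 1; omega
    · change (σ 1 : ℕ) = 0; omega
  · rintro rfl
    have := Equiv.Perm.isCycleOn_swap (zero_ne_one : (0 : Fin 2) ≠ 1)
    have e : ({0, 1} : Set (Fin 2)) = Set.univ := by ext i; fin_cases i <;> simp
    rwa [e] at this

/-- `Tr(S(x₁) S(x₂)) / 2`. -/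
def tracePair (Ψ : FormalMatrix) (x₁ x₂ t : ℂ) : PowerSeries ℂ :=
  sA Ψ x₁ t * sA Ψ x₂ t + sB Ψ x₁ t * sB Ψ x₂ t - sC Ψ x₁ t * sC Ψ x₂ t

/-- The only cycle gives K(x_0,x_1) K(x_1,x_0) = -Tr(P_0 P_1)/(x_0 - x_1)², where P_i = (1 +
S(x_i))/2, so Tr(P_0 P_1) = (1 + `tracePair`)/2. The subtracted double pole replaces this by
(`tracePair` - 1)/2. -/
theorem corrW_two {m : ℕ} {τ : ℕ → ℂ} {u : ℂ → PowerSeries ℂ} {y : ℂ → ℂ → ℂ}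
    {D a : FormalMatrix} (W : IsWave V u h y D (amplitude g a)) {t : ℂ} {x : Fin 2 → ℂ}
    (hp : ∀ i, (x i, t) ∈ V) (γ : ℕ) : corrW m τ u g a t 2 γ x = ((x 0 - x 1)⁻¹ ^ 2 / 2)
      * PowerSeries.coeff (2 * γ) (tracePair (amplitude g a) (x 0) (x 1) t - 1) := by
  have h2 : PowerSeries.C (1 / 2 : ℂ) * (2 : PowerSeries ℂ) = 1 := by
    rw [← map_ofNat (PowerSeries.C (R := ℂ)) 2, ← map_mul]; norm_num
  have d0 := W.det (hp 0)
  have d1 := W.det (hp 1)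
  have hC1 : PowerSeries.C (1 / (x 1 - x 0)) = -(PowerSeries.C ((x 0 - x 1)⁻¹) : PowerSeries ℂ) := by
    rw [← map_neg, one_div, ← inv_neg, neg_sub]
  have hC2 : (PowerSeries.C (1 / (x 0 - x 1) ^ 2) : PowerSeries ℂ)
      = PowerSeries.C ((x 0 - x 1)⁻¹) ^ 2 := by rw [← map_pow, one_div, inv_pow]
  have hC3 : (PowerSeries.C ((x 0 - x 1)⁻¹ ^ 2 / 2) : PowerSeries ℂ)
      = PowerSeries.C ((x 0 - x 1)⁻¹) ^ 2 * PowerSeries.C (1 / 2) := by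
    rw [← map_pow, ← map_mul]; congr 1; ring
  rw [corrW, corrN_add_two m τ u g a t 0, if_pos rfl, show 2 * γ + 2 - 1 = 2 * γ + 1 by omega,
    PowerSeries.coeff_succ_X_mul, ← PowerSeries.coeff_C_mul, fullCycles_two, Finset.sum_singleton,
    Fin.prod_univ_two, Equiv.swap_apply_left, Equiv.swap_apply_right, kernelK, kernelK, hC1, hC2,
    hC3, one_div, tracePair]
  simp only [sA, sB, sC]
  congr 1
  set c := (PowerSeries.C ((x 0 - x 1)⁻¹) : PowerSeries ℂ)
  generalize amplitude g a (x 0) t = M at *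
  generalize amplitude g a (x 1) t = N at *
  linear_combination (-c ^ 2 * (M 0 0 * N 1 1 - M 1 0 * N 0 1) * (N 0 0 * M 1 1 - N 1 0 * M 0 1)
    + c ^ 2) * h2
    + c ^ 2 * PowerSeries.C (1 / 2) * ((N 0 0 * N 1 1 - N 0 1 * N 1 0) * d0 + d1)

/-- With ζ = e^θ one has x = s cosh θ and h = i s sinh θ, so s² - x₀x₁ - h₀h₁ = s² (1 - cosh(θ₀ -
θ₁)), a multiple of (ζ₀ - ζ₁)². It cancels against the factor ζ₀ - ζ₁ of x₀ - x₁, squared, and only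
the factor ζ₀ζ₁ - 1 survives. -/
theorem two_point_zeta {s x₀ x₁ h₀ h₁ ζ₀ ζ₁ : ℂ} (hs : s ≠ 0) (hx : x₀ ≠ x₁) (hζ₀ : ζ₀ ≠ 0)
    (hζ₁ : ζ₁ ≠ 0) (h1₀ : ζ₀ ^ 2 - 1 ≠ 0) (h1₁ : ζ₁ ^ 2 - 1 ≠ 0)
    (hx₀ : 2 * ζ₀ * x₀ = s * (ζ₀ ^ 2 + 1)) (hx₁ : 2 * ζ₁ * x₁ = s * (ζ₁ ^ 2 + 1))
    (hh₀ : 2 * ζ₀ * h₀ = Complex.I * s * (ζ₀ ^ 2 - 1))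
    (hh₁ : 2 * ζ₁ * h₁ = Complex.I * s * (ζ₁ ^ 2 - 1)) :
    ((x₀ - x₁)⁻¹ ^ 2 / 2) * ((s ^ 2 - x₀ * x₁) * (h₀⁻¹ * h₁⁻¹) - 1)
      = 4 * ζ₀ ^ 2 * ζ₁ ^ 2 / (s ^ 2 * (ζ₀ ^ 2 - 1) * (ζ₁ ^ 2 - 1) * (ζ₀ * ζ₁ - 1) ^ 2) := by
  have hI := Complex.I_sq
  have hI0 := Complex.I_ne_zero
  have e : 2 * ζ₀ * ζ₁ * (x₀ - x₁) = s * ((ζ₀ - ζ₁) * (ζ₀ * ζ₁ - 1)) := by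
    linear_combination ζ₁ * hx₀ - ζ₀ * hx₁
  have hne : s * ((ζ₀ - ζ₁) * (ζ₀ * ζ₁ - 1)) ≠ 0 := by
    rw [← e]
    exact mul_ne_zero (mul_ne_zero (mul_ne_zero two_ne_zero hζ₀) hζ₁) (sub_ne_zero.2 hx)
  have hd := (mul_ne_zero_iff.1 (mul_ne_zero_iff.1 hne).2).1
  have hd' := (mul_ne_zero_iff.1 (mul_ne_zero_iff.1 hne).2).2
  have e0 : x₀ - x₁ = s * ((ζ₀ - ζ₁) * (ζ₀ * ζ₁ - 1)) / (2 * ζ₀ * ζ₁) := by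
    field_simp; linear_combination e
  have a0 : x₀ = s * (ζ₀ ^ 2 + 1) / (2 * ζ₀) := by field_simp; linear_combination hx₀
  have a1 : x₁ = s * (ζ₁ ^ 2 + 1) / (2 * ζ₁) := by field_simp; linear_combination hx₁
  have hh : h₀ * h₁ = -(s ^ 2 * (ζ₀ ^ 2 - 1) * (ζ₁ ^ 2 - 1)) / (4 * ζ₀ * ζ₁) := by
    field_simp
    linear_combination (2 * ζ₁ * h₁) * hh₀ + (Complex.I * s * (ζ₀ ^ 2 - 1)) * hh₁
      + s ^ 2 * (ζ₀ ^ 2 - 1) * (ζ₁ ^ 2 - 1) * hI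
  rw [e0, ← mul_inv, hh, a0, a1]
  field_simp
  ring

open MvPolynomial in
/-- The numerator of `Tr(S(x₁) S(x₂))`. -/
def pairNumer (K : ℕ) (P : ℕ → Polynomial ℂ) : MvPolynomial (Fin 2) ℂ :=
  ∑ p ∈ Finset.HasAntidiagonal.antidiagonal K,
    Polynomial.aeval (X 0 : MvPolynomial (Fin 2) ℂ) (P p.1) * Polynomial.aeval (X 1) (P p.2)

theorem degreeOf_pairNumer_le {K L : ℕ} {P : ℕ → Polynomial ℂ} (hP : ∀ k ≤ K, (P k).natDegree ≤ L)
    (i : Fin 2) : (pairNumer K P).degreeOf i ≤ L := by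
  refine (MvPolynomial.degreeOf_sum_le _ _ _).trans (Finset.sup_le fun p hp => ?_)
  have h1 := hP p.1 (Finset.HasAntidiagonal.antidiagonal.fst_le hp)
  have h2 := hP p.2 (Finset.HasAntidiagonal.antidiagonal.snd_le hp)
  refine (MvPolynomial.degreeOf_mul_le _ _ _).trans ((Nat.add_le_add (degreeOf_aeval_X_le _ i 0)
    (degreeOf_aeval_X_le _ i 1)).trans ?_)
  fin_cases i
  · simpa using h1
  · simpa using h2

theorem rename_pairNumer (K : ℕ) (P : ℕ → Polynomial ℂ) (f : Fin 2 → Fin 2) :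
    MvPolynomial.rename f (pairNumer K P) = ∑ p ∈ Finset.HasAntidiagonal.antidiagonal K,
      Polynomial.aeval (MvPolynomial.X (f 0) : MvPolynomial (Fin 2) ℂ) (P p.1)
        * Polynomial.aeval (MvPolynomial.X (f 1)) (P p.2) := by
  simp only [pairNumer, map_sum, map_mul, ← Polynomial.aeval_algHom_apply, MvPolynomial.rename_X]

theorem rename_swap_pairNumer (K : ℕ) (P : ℕ → Polynomial ℂ) :
    MvPolynomial.rename (Equiv.swap (0 : Fin 2) 1) (pairNumer K P) = pairNumer K P := by
  rw [rename_pairNumer, Equiv.swap_apply_left, Equiv.swap_apply_right, pairNumer,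
    ← Finset.Nat.sum_antidiagonal_swap]
  exact Finset.sum_congr rfl fun p _ => mul_comm _ _

theorem eval_pairNumer (K : ℕ) (P : ℕ → Polynomial ℂ) (x : Fin 2 → ℂ) :
    MvPolynomial.eval x (pairNumer K P)
      = ∑ p ∈ Finset.HasAntidiagonal.antidiagonal K, (P p.1).eval (x 0) * (P p.2).eval (x 1) := by
  have : ∀ (i : Fin 2) (p : Polynomial ℂ),
      MvPolynomial.eval x (Polynomial.aeval (MvPolynomial.X i) p) = p.eval (x i) := fun i p => by
    rw [← MvPolynomial.coe_aeval_eq_eval, RingHom.coe_coe, ← Polynomial.aeval_algHom_apply,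
      MvPolynomial.aeval_X, Polynomial.coe_aeval_eq_eval]
  simp only [pairNumer, map_sum, map_mul, this]

open MvPolynomial in
/-- A symmetric polynomial in two variables that vanishes on the diagonal is divisible by the square
of the difference of the variables. -/
theorem exists_eq_sq_mul {q : MvPolynomial (Fin 2) ℂ} (hs : rename (Equiv.swap (0 : Fin 2) 1) q = q)
    (h0 : rename (Function.update id 1 0) q = 0) : ∃ w, q = (X 0 - X 1) ^ 2 * w := by
  obtain ⟨r, hr⟩ := X_sub_X_dvd_of_rename h0
  have hX : (X 0 - X 1 : MvPolynomial (Fin 2) ℂ) ≠ 0 :=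
    sub_ne_zero.2 fun e => absurd (X_injective e) (by decide)
  have h1 : rename (Equiv.swap (0 : Fin 2) 1) r = -r := by
    refine mul_left_cancel₀ hX ?_
    rw [hr, map_mul, map_sub, rename_X, rename_X, Equiv.swap_apply_left, Equiv.swap_apply_right] at hs
    linear_combination -hs
  -- The quotient of a symmetric polynomial by X_0 - X_1 is antisymmetric, hence it too vanishes on
  -- the diagonal.
  have h2 : rename (Function.update id 1 0) r = -rename (Function.update id (1 : Fin 2) 0) r := by
    rw [← map_neg, ← h1, rename_rename]
    congr 1
    congr 1
    funext i
    fin_cases i <;> simp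
  obtain ⟨w, hw⟩ := X_sub_X_dvd_of_rename (self_eq_neg.1 h2)
  exact ⟨w, by rw [hr, hw]; ring⟩

/-- The numerator of the coefficient of Tr(S(x_0)S(x_1))/2 is a symmetric polynomial that vanishes
on the diagonal, where S² = 1. So it absorbs the double pole (x_0 - x_1)⁻². -/
theorem zetaRat_two_point {m : ℕ} {τ : ℕ → ℂ} {u : ℂ → PowerSeries ℂ} {y : ℂ → ℂ → ℂ}
    {D a : FormalMatrix} (W : IsWave V u h y D (amplitude g a))
    (hz : IsUniformizer V j h (zVar g)) (hV : CurveDomain V j h)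
    (hS : GoodTriple V j h (amplitude g a)) (t : ℂ) {γ : ℕ} (hγ : γ ≠ 0) :
    ∃ d, ZetaRat V g t d (corrW m τ u g a t 2 γ) := by
  obtain ⟨L, PA, PB, PC, hdeg, hP⟩ := hS.exists_fibre hV t (2 * γ)
  set K := 2 * γ with hK
  have hK0 : K ≠ 0 := by omega
  by_cases hne : ∃ x, (x, t) ∈ V
  swap
  · exact ⟨0, 0, fun i => by simp, fun x _ hp => absurd ⟨_, hp 0⟩ hne⟩
  obtain ⟨x₀, hx₀⟩ := hne
  set q : MvPolynomial (Fin 2) ℂ := pairNumer K PA + pairNumer K PB - pairNumer K PC with hq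
  have hcoeff : ∀ x y, (x, t) ∈ V → (y, t) ∈ V →
      PowerSeries.coeff K (tracePair (amplitude g a) x y t - 1)
      = ((h x t)⁻¹ ^ L * (h y t)⁻¹ ^ L) * MvPolynomial.eval ![x, y] q := by
    intro x y hx hy
    rw [map_sub, PowerSeries.coeff_one, if_neg hK0, sub_zero, tracePair, map_sub, map_add,
      PowerSeries.coeff_mul, PowerSeries.coeff_mul, PowerSeries.coeff_mul, hq, map_sub, map_add,
      eval_pairNumer, eval_pairNumer, eval_pairNumer, mul_sub, mul_add, Finset.mul_sum,
      Finset.mul_sum, Finset.mul_sum]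
    refine congrArg₂ _ (congrArg₂ _ ?_ ?_) ?_ <;>
      refine Finset.sum_congr rfl fun p hp => ?_ <;>
      simp only [Matrix.cons_val_zero, Matrix.cons_val_one]
    · rw [(hP x hx p.1 (Finset.HasAntidiagonal.antidiagonal.fst_le hp)).1,
        (hP y hy p.2 (Finset.HasAntidiagonal.antidiagonal.snd_le hp)).1]
      ring
    · rw [(hP x hx p.1 (Finset.HasAntidiagonal.antidiagonal.fst_le hp)).2.1,
        (hP y hy p.2 (Finset.HasAntidiagonal.antidiagonal.snd_le hp)).2.1]
      ring
    · rw [(hP x hx p.1 (Finset.HasAntidiagonal.antidiagonal.fst_le hp)).2.2,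
        (hP y hy p.2 (Finset.HasAntidiagonal.antidiagonal.snd_le hp)).2.2]
      ring
  have hsym : MvPolynomial.rename (Equiv.swap (0 : Fin 2) 1) q = q := by
    rw [hq, map_sub, map_add, rename_swap_pairNumer, rename_swap_pairNumer, rename_swap_pairNumer]
  set r : (ℕ → Polynomial ℂ) → Polynomial ℂ := fun P =>
    ∑ p ∈ Finset.HasAntidiagonal.antidiagonal K, P p.1 * P p.2 with hr
  -- On the diagonal the coefficient of positive order 2γ of S² = 1 is zero; this holds on the open
  -- set of x with (x, t) ∈ V, hence identically.
  have hr0 : r PA + r PB - r PC = 0 := by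
    refine Polynomial.eq_zero_of_infinite_isRoot _ (Set.Infinite.mono (s := {x | (x, t) ∈ V}) ?_ ?_)
    · intro x hx
      have h1 := hcoeff x x hx hx
      rw [tracePair, W.sq_eq_one hx, sub_self, map_zero] at h1
      have h2 := hV.h_ne hx
      have h3 := (mul_eq_zero.1 h1.symm).resolve_left
        (mul_ne_zero (pow_ne_zero _ (inv_ne_zero h2)) (pow_ne_zero _ (inv_ne_zero h2)))
      rw [hq, map_sub, map_add, eval_pairNumer, eval_pairNumer, eval_pairNumer] at h3
      simpa [hr, Polynomial.IsRoot, Polynomial.eval_finsetSum] using h3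
    · exact infinite_of_mem_nhds x₀ ((hV.isOpen.preimage
        (continuous_id.prodMk continuous_const)).mem_nhds hx₀)
  have hdiag : MvPolynomial.rename (Function.update id 1 0) q = 0 := by
    have e : ∀ P, MvPolynomial.rename (Function.update id (1 : Fin 2) 0) (pairNumer K P)
        = Polynomial.aeval (MvPolynomial.X 0) (r P) := fun P => by
      rw [rename_pairNumer]
      simp [hr]
    rw [hq, map_sub, map_add, e, e, e, ← map_add, ← map_sub, hr0, map_zero]
  obtain ⟨w, hw⟩ := exists_eq_sq_mul hsym hdiag
  refine ⟨L, ((zetaRat_eval hz hV t w fun i => ?_).const_mul (1 / 2)).congr fun x hx hp => ?_⟩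
  · rcases eq_or_ne w 0 with rfl | hw0
    · simp
    have hX : (MvPolynomial.X 0 - MvPolynomial.X 1 : MvPolynomial (Fin 2) ℂ) ^ 2 ≠ 0 :=
      pow_ne_zero 2 (sub_ne_zero.2 fun e => absurd (MvPolynomial.X_injective e) (by decide))
    have h1 : q.degreeOf i ≤ L := by
      refine (MvPolynomial.degreeOf_sub_le _ _ _).trans (max_le
        ((MvPolynomial.degreeOf_add_le _ _ _).trans (max_le ?_ ?_)) ?_)
      · exact degreeOf_pairNumer_le (fun k hk => (hdeg k hk).1) i
      · exact degreeOf_pairNumer_le (fun k hk => (hdeg k hk).2.1) i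
      · exact degreeOf_pairNumer_le (fun k hk => (hdeg k hk).2.2) i
    rw [hw, MvPolynomial.degreeOf_mul_eq hX hw0] at h1
    omega
  · have hx01 : x 0 - x 1 ≠ 0 := sub_ne_zero.2 fun e => absurd (hx e) (by decide)
    have ex : ![x 0, x 1] = x := by funext i; fin_cases i <;> rfl
    rw [corrW_two W hp, ← hK, hcoeff _ _ (hp 0) (hp 1), ex, hw, Fin.prod_univ_two, map_mul, map_pow,
      map_sub, MvPolynomial.eval_X, MvPolynomial.eval_X]
    field_simp

end zeta

end MinimalModel

end

/-! ### The pole structure theorem -/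

open MinimalModel in
theorem mainTheorem2 (m : ℕ) (hm : 1 ≤ m) (τ : ℕ → ℂ)
    (U : Set ℂ) (hU : IsOpen U) (u : ℂ → PowerSeries ℂ) (hu : IsStringSolution m τ U u)
    (V : Set (ℂ × ℂ)) (hV : IsOpen V) (hVc : IsPreconnected V)
    (hVU : ∀ x t, (x, t) ∈ V → t ∈ U ∧ x ^ 2 ≠ u0 u t ^ 2)
    (g : ℂ → ℂ → ℂ) (a : FormalMatrix) (hBA : IsBakerAkhiezer m τ u V g a) :
    -- the WKB coefficients are rational in `z`, with poles only at `±i, 0, ∞`, and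
    -- their coefficients are rational expressions in `u_0` and its derivatives
    (∀ (i j : Fin 2) (k : ℕ),
      ∃ (α β : ℕ) (P : Polynomial (MvPolynomial ℕ ℂ)) (q : MvPolynomial ℕ ℂ),
        ∀ x t, (x, t) ∈ V →
          MvPolynomial.eval (jet u t) q ≠ 0 ∧
          PowerSeries.coeff k (a x t i j) =
            (P.map (MvPolynomial.eval (jet u t))).eval (zVar g x t) /
              (MvPolynomial.eval (jet u t) q * zVar g x t ^ α * (zVar g x t ^ 2 + 1) ^ β)) ∧
    -- the stable correlation functions are symmetric rational functions of the `ζ_i` with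
    -- poles only at `ζ_i = ±1`; the degree bound says that there is no pole at `ζ_i = ∞`
    (∀ n γ : ℕ, 1 ≤ n → (n, γ) ≠ (1, 0) → (n, γ) ≠ (2, 0) → ∀ t,
      ∃ (d : ℕ) (P : MvPolynomial (Fin n) ℂ),
        P.IsSymmetric ∧ (∀ i, P.degreeOf i ≤ 2 * d) ∧
        ∀ x : Fin n → ℂ, Function.Injective x → (∀ i, (x i, t) ∈ V) →
          corrW m τ u g a t n γ x =
            MvPolynomial.eval (fun i => zetaVar g (x i) t) P /
              ∏ i, (zetaVar g (x i) t ^ 2 - 1) ^ d) ∧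
    -- `W_1^{(0)} = y` has poles only at `0, ∞`
    (∀ t, ∃ (d : ℕ) (P : Polynomial ℂ), ∀ x : Fin 1 → ℂ, (x 0, t) ∈ V →
      corrW m τ u g a t 1 0 x = yLax m τ u g (x 0) t ∧
      corrW m τ u g a t 1 0 x = P.eval (zetaVar g (x 0) t) / zetaVar g (x 0) t ^ d) ∧
    -- `W_2^{(0)}` also has a pole at `ζ_1 ζ_2 = 1`
    (∀ t, ∀ x : Fin 2 → ℂ, Function.Injective x → (∀ i, (x i, t) ∈ V) →
      corrW m τ u g a t 2 0 x =
        4 * zetaVar g (x 0) t ^ 2 * zetaVar g (x 1) t ^ 2 /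
          (u0 u t ^ 2 * (zetaVar g (x 0) t ^ 2 - 1) * (zetaVar g (x 1) t ^ 2 - 1)
            * (zetaVar g (x 0) t * zetaVar g (x 1) t - 1) ^ 2)) := by
  have hC := curveDomain_amplitude hU hu hV hVU hBA
  have W := wave_amplitude hV hVU hBA
  have hz := isUniformizer hVU hBA.g_pow
  have hS := goodTriple_amplitude hU hu hV hVU hBA
  refine ⟨coefficients_eq_div hU hu hV hVU hBA hVc, fun n γ hn h1 h2 t => ?_, fun t => ?_,
    fun t x hx hp => ?_⟩
  · have key : ∃ d, ZetaRat V g t d (corrW m τ u g a t n γ) := by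
      match n, hn with
      | 1, _ =>
        obtain ⟨γ, rfl⟩ := Nat.exists_eq_succ_of_ne_zero (n := γ) fun h0 => h1 (by rw [h0])
        obtain ⟨d, hd⟩ := zetaRat_of_good hz hC t
          (good_waveTau_amplitude hU hu hV hVU hBA (2 * γ + 1))
        refine ⟨d, hd.congr fun x _ hp => ?_⟩
        rw [corrW, corrN_one hBA (hp 0)]
        rfl
      | 2, _ => exact zetaRat_two_point W hz hC hS t fun h0 => h2 (by rw [h0])
      | n + 3, _ =>
        obtain ⟨d, hd⟩ := zetaRat_sum_kernelK W hz hC hS t (Nat.le_add_left 3 n) (2 * γ + n + 1)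
        exact ⟨d, hd.corrW_add_three⟩
    obtain ⟨d, hd⟩ := key
    -- The numerator is determined only by its values at points of V; averaging over permutations
    -- makes the polynomial itself symmetric.
    obtain ⟨P, hP1, hP2, hP3⟩ := hd.symmetrize (corrW_comp m τ u g a t n γ)
    refine ⟨d, P, hP1, hP2, fun x hx hp => ?_⟩
    rw [← hP3 x hx hp, mul_div_cancel_right₀]
    exact Finset.prod_ne_zero_iff.2 fun i _ => pow_ne_zero d (zetaVar_param hz hC (hp i)).2.1
  · obtain ⟨d, P, hP⟩ := exists_laurent_zeta hz hC t (curvePoly m τ (u0 u t))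
    refine ⟨d, P, fun x hp => ?_⟩
    have e : corrW m τ u g a t 1 0 x = yLax m τ u g (x 0) t := by
      rw [corrW, corrN_one hBA hp, show 2 * 0 + 1 - 1 = 0 from rfl,
        PowerSeries.coeff_zero_eq_constantCoeff_apply, W.constantCoeff_waveTau hp]
    exact ⟨e, by rw [e, yLax_eq, hP _ hp]⟩
  · obtain ⟨a1, a2, a3, a4⟩ := zetaVar_param hz hC (hp 0)
    obtain ⟨b1, b2, b3, b4⟩ := zetaVar_param hz hC (hp 1)
    have hx01 : x 0 ≠ x 1 := fun e => absurd (hx e) (by decide)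
    have h0 := hC.jet_ne (hp 0)
    rw [corrW_two W hp, ← jet_zero, ← two_point_zeta h0 hx01 a1 b1 a2 b2 a3 b3 a4 b4]
    obtain ⟨c1, c2, c3⟩ := constantCoeff_S hVU hBA (hp 0)
    obtain ⟨d1, d2, d3⟩ := constantCoeff_S hVU hBA (hp 1)
    congr 1
    rw [Nat.mul_zero, PowerSeries.coeff_zero_eq_constantCoeff_apply, tracePair]
    simp only [map_sub, map_add, map_mul, c1, c2, c3, d1, d2, d3, map_one]
    ring
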